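/- **Theorem 3.1.** Let $d\ge 1$, $d/2<p<d$, let $D\subset\mathbb R^d$ be a nonempty bounded open set, and let $\omega$ be a Poisson field on $\mathbb R^d$ with Lebesgue intensity $dx$, defined on a probability space with law $\mathbb P$. For $\epsilon>0$ let $\omega(\epsilon\,dx)$ denote the image of $\omega$ under $x\mapsto\epsilon^{-1/d}x$, a Poisson field with intensity $\epsilon\,dx$. Let $W^{1,2}(D)$ be the closure of $C_c^\infty(D)$ under the Sobolev norm and $$\mathcal G_d(D)=\Big\{g\in W^{1,2}(D):\ \|g\|_{L^2(D)}^2+\tfrac12\|\nabla g\|_{L^2(D)}^2=1\Big\}.$$ Let $\alpha:[0,\infty)\to[0,1]$ be smooth with $\alpha=1$ on $[0,1]$, $\alpha=0$ on $[3,\infty)$ and $-1\le\alpha'\le0$. For $a,\epsilon>0$ put $$K^{(0)}_{a,\epsilon}(x)=\frac{1}{|x|^p}\,\alpha\Big(a^{-1}\epsilon^{\frac{2+d-p}{d(d-p)}}|x|\Big),\qquad L^{(0)}_{a,\epsilon}(x)=\frac1{|x|^p}-K^{(0)}_{a,\epsilon}(x),$$ and for $g\in\mathcal G_d(D)$ $$G^{(0)}_{a,\epsilon}(g)=\int_{\mathbb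 R^d}\Big[\int_D K^{(0)}_{a,\epsilon}(y-x)g^2(y)\,dy\Big][\omega(\epsilon\,dx)-\epsilon\,dx],\qquad F^{(0)}_{a,\epsilon}(g)=\int_{\mathbb R^d}\Big[\int_D L^{(0)}_{a,\epsilon}(y-x)g^2(y)\,dy\Big][\omega(\epsilon\,dx)-\epsilon\,dx],$$ $$\zeta_\epsilon(g)=\int_{\mathbb R^d}\Big[\int_D \frac{g^2(y)}{|y-x|^p}\,dy\Big][\omega(\epsilon\,dx)-\epsilon\,dx].$$ Here $\int_{\mathbb R^d}f(x)\,[\omega(\epsilon\,dx)-\epsilon\,dx]$, for $f\ge0$, means $\lim_{n\to\infty}\big(\int_{|x|<n}f(x)\,\omega(\epsilon\,dx)-\epsilon\int_{|x|<n}f(x)\,dx\big)$ in $[-\infty,+\infty]$. For all $a,\epsilon>0$, almost surely the limits defining $\zeta_\epsilon(g)$, $G^{(0)}_{a,\epsilon}(g)$ and $F^{(0)}_{a,\epsilon}(g)$ exist for all $g\in\mathcal G_d(D)$ simultaneously, and for each fixed $g\in\mathcal G_d(D)$ they are almost surely finite. For every $\gamma>0$, with $\log 0=-\infty$, $$\lim_{a\to\infty}\limsup_{\epsilon\to0^+}\epsilon^{2/(d-p)}\log\mathbb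 P\Big\{\sup_{g\in\mathcal G_d(D)}\big|F^{(0)}_{a,\epsilon}(g)\big|\ge\gamma\epsilon^{-(2-p)/d}\Big\}=-\infty,$$ $$\liminf_{a\to\infty}\liminf_{\epsilon\to0^+}\epsilon^{2/(d-p)}\log\mathbb P\Big\{\inf_{g\in\mathcal G_d(D)}G^{(0)}_{a,\epsilon}(g)\le-\gamma\epsilon^{-(2-p)/d}\Big\}\ge-I_D(\gamma),$$ $$\lim_{\epsilon\to0^+}\epsilon^{2/(d-p)}\log\mathbb P\Big\{\inf_{g\in\mathcal G_d(D)}\zeta_\epsilon(g)\le-\gamma\epsilon^{-(2-p)/d}\Big\}=-I_D(\gamma),$$ where, with $\omega_d$ the volume of the unit ball of $\mathbb R^d$, $$I_D(\gamma)=\Big(\frac{\gamma(d-p)}{d}\Big)^{\frac d{d-p}}\Big(\omega_d\,\Gamma\Big(\frac{2p-d}{p}\Big)\Big)^{-\frac p{d-p}}\Big(\sup_{g\in\mathcal G_d(D)}\|g\|_{L^2(D)}\Big)^{-\frac{2d}{d-p}}.$$ (Probabilities of events that are not known to be measurable are outer probabilities.) -/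

import Mathlib

open Real Set Filter Topology MeasureTheory ProbabilityTheory
open scoped NNReal ENNReal ContDiff

noncomputable section

/-- A Poisson field on `ℝᵈ` with Lebesgue intensity, on the probability space `(Ω, P)`: a random
measure whose value on a set of finite volume is Poisson with the volume as its parameter, and
whose values on disjoint sets are independent. -/
structure IsPoissonField {Ω : Type*} [MeasurableSpace Ω] (P : Measure Ω) {d : ℕ}
    (N : Ω → Measure (EuclideanSpace ℝ (Fin d))) : Prop where
  measurable : Measurable N
  count_law : ∀ A : Set (EuclideanSpace ℝ (Fin d)), MeasurableSet A → volume A ≠ ⊤ →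
    P.map (fun w => N w A) =
      (poissonMeasure (volume A).toNNReal).map (fun n : ℕ => (n : ℝ≥0∞))
  indep : ∀ (m : ℕ) (A : Fin m → Set (EuclideanSpace ℝ (Fin d))),
    (∀ i, MeasurableSet (A i)) → Pairwise (fun i j => Disjoint (A i) (A j)) →
    iIndepFun (fun i w => N w (A i)) P

/-- The contracted field `ω(ε dx)`: every obstacle `x` is moved to `ε^{-1/d} x`, so that the
intensity of the field becomes `ε dx`. -/
def contractedField {d : ℕ} (ε : ℝ) (ν : Measure (EuclideanSpace ℝ (Fin d))) :
    Measure (EuclideanSpace ℝ (Fin d)) :=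
  ν.map (fun x => (ε ^ (-(1 / (d : ℝ)))) • x)

/-- `∫_{|x| < n} f(x) [ω(ε dx) - ε dx]` for a nonnegative `f`, where `ν` is the realization of
`ω`. The value is `+∞` if an obstacle in the ball sits at an infinity of `f`; the subtracted term is
finite for every locally integrable `f`. -/
def compensatedPartial {d : ℕ} (ε : ℝ) (ν : Measure (EuclideanSpace ℝ (Fin d)))
    (f : EuclideanSpace ℝ (Fin d) → ℝ≥0∞) (n : ℕ) : EReal :=
  ((∫⁻ x in Metric.ball 0 (n : ℝ), f x ∂(contractedField ε ν) : ℝ≥0∞) : EReal) -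
    ((ENNReal.ofReal ε * ∫⁻ x in Metric.ball 0 (n : ℝ), f x : ℝ≥0∞) : EReal)

/-- The compensated Poisson integral `∫ f(x) [ω(ε dx) - ε dx]`, as the limit of the integrals over
the balls of radius `n` about the origin. (`limsup` is only used to have a total function: the
theorem asserts that the limit exists.) -/
def compensatedIntegral {d : ℕ} (ε : ℝ) (ν : Measure (EuclideanSpace ℝ (Fin d)))
    (f : EuclideanSpace ℝ (Fin d) → ℝ≥0∞) : EReal :=
  limsup (compensatedPartial ε ν f) atTop

/-- The limit that defines the compensated Poisson integral exists. -/
def CompensatedIntegralConverges {d : ℕ} (ε : ℝ) (ν : Measure (EuclideanSpace ℝ (Fin d)))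
    (f : EuclideanSpace ℝ (Fin d) → ℝ≥0∞) : Prop :=
  Tendsto (compensatedPartial ε ν f) atTop (𝓝 (compensatedIntegral ε ν f))

/-- `g` belongs to `W^{1,2}(D)`, the closure of `C_c^∞(D)` under the Sobolev norm, and `v` is its
gradient: some `φₙ ∈ C_c^∞(D)` converge to `g`, and their gradients to `v`, in `L²(D)`.
Only the values on `D` matter. -/
def HasSobolevGradient {d : ℕ} (D : Set (EuclideanSpace ℝ (Fin d)))
    (g : EuclideanSpace ℝ (Fin d) → ℝ)
    (v : EuclideanSpace ℝ (Fin d) → EuclideanSpace ℝ (Fin d)) : Prop :=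
  MemLp g 2 (volume.restrict D) ∧ MemLp v 2 (volume.restrict D) ∧
    ∃ φ : ℕ → EuclideanSpace ℝ (Fin d) → ℝ,
      (∀ n, ContDiff ℝ ∞ (φ n) ∧ HasCompactSupport (φ n) ∧ tsupport (φ n) ⊆ D) ∧
      Tendsto (fun n => eLpNorm (fun x => φ n x - g x) 2 (volume.restrict D)) atTop (𝓝 0) ∧
      Tendsto (fun n => eLpNorm (fun x => gradient (φ n) x - v x) 2 (volume.restrict D))
        atTop (𝓝 0)

/-- The norm of `L²(D)`. -/
def l2Norm {d : ℕ} {F : Type*} [NormedAddCommGroup F] (D : Set (EuclideanSpace ℝ (Fin d)))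
    (f : EuclideanSpace ℝ (Fin d) → F) : ℝ :=
  (eLpNorm f 2 (volume.restrict D)).toReal

/-- The class `𝒢_d(D)` of all `g ∈ W^{1,2}(D)` with `‖g‖² + ½ ‖∇g‖² = 1`. -/
def sobolevSphere {d : ℕ} (D : Set (EuclideanSpace ℝ (Fin d))) :
    Set (EuclideanSpace ℝ (Fin d) → ℝ) :=
  {g | ∃ v, HasSobolevGradient D g v ∧ l2Norm D g ^ 2 + (1 / 2) * l2Norm D v ^ 2 = 1}

/-- `x ↦ ∫_D k(y - x) g(y)² dy` for a nonnegative kernel `k`. -/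
def smearedKernel {d : ℕ} (D : Set (EuclideanSpace ℝ (Fin d)))
    (k : EuclideanSpace ℝ (Fin d) → ℝ) (g : EuclideanSpace ℝ (Fin d) → ℝ)
    (x : EuclideanSpace ℝ (Fin d)) : ℝ≥0∞ :=
  ∫⁻ y in D, ENNReal.ofReal (k (y - x) * g y ^ 2)

/-- A smooth truncation function on `[0, ∞)`. -/
structure IsSmoothTruncation (α : ℝ → ℝ) : Prop where
  smooth : ContDiffOn ℝ ∞ α (Ici 0)
  mem_Icc : ∀ s, 0 ≤ s → α s ∈ Icc (0 : ℝ) 1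
  eq_one : ∀ s ∈ Icc (0 : ℝ) 1, α s = 1
  eq_zero : ∀ s, 3 ≤ s → α s = 0
  deriv_mem : ∀ s, 0 < s → deriv α s ∈ Icc (-1 : ℝ) 0

/-- The shape function `|x|^{-p}`. -/
def rieszKernel {d : ℕ} (p : ℝ) (x : EuclideanSpace ℝ (Fin d)) : ℝ :=
  1 / ‖x‖ ^ p

/-- `α(a⁻¹ ε^{(2+d-p)/(d(d-p))} |x|)`. -/
def cutoff {d : ℕ} (α : ℝ → ℝ) (p a ε : ℝ) (x : EuclideanSpace ℝ (Fin d)) : ℝ :=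
  α (a⁻¹ * ε ^ ((2 + (d : ℝ) - p) / ((d : ℝ) * ((d : ℝ) - p))) * ‖x‖)

/-- The truncated shape function `K^{(0)}_{a,ε}`. -/
def nearKernel {d : ℕ} (α : ℝ → ℝ) (p a ε : ℝ) (x : EuclideanSpace ℝ (Fin d)) : ℝ :=
  1 / ‖x‖ ^ p * cutoff α p a ε x

/-- The remainder `L^{(0)}_{a,ε}`. -/
def farKernel {d : ℕ} (α : ℝ → ℝ) (p a ε : ℝ) (x : EuclideanSpace ℝ (Fin d)) : ℝ :=
  1 / ‖x‖ ^ p * (1 - cutoff α p a ε x)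

/-- `ζ_ε(g)`, for the realization `ν` of the Poisson field. -/
def zetaFun {d : ℕ} (D : Set (EuclideanSpace ℝ (Fin d))) (p ε : ℝ)
    (ν : Measure (EuclideanSpace ℝ (Fin d))) (g : EuclideanSpace ℝ (Fin d) → ℝ) : EReal :=
  compensatedIntegral ε ν (smearedKernel D (rieszKernel p) g)

/-- `G^{(0)}_{a,ε}(g)`, for the realization `ν` of the Poisson field. -/
def nearFun {d : ℕ} (D : Set (EuclideanSpace ℝ (Fin d))) (α : ℝ → ℝ) (p a ε : ℝ)
    (ν : Measure (EuclideanSpace ℝ (Fin d))) (g : EuclideanSpace ℝ (Fin d) → ℝ) : EReal :=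
  compensatedIntegral ε ν (smearedKernel D (nearKernel α p a ε) g)

/-- `F^{(0)}_{a,ε}(g)`, for the realization `ν` of the Poisson field. -/
def farFun {d : ℕ} (D : Set (EuclideanSpace ℝ (Fin d))) (α : ℝ → ℝ) (p a ε : ℝ)
    (ν : Measure (EuclideanSpace ℝ (Fin d))) (g : EuclideanSpace ℝ (Fin d) → ℝ) : EReal :=
  compensatedIntegral ε ν (smearedKernel D (farKernel α p a ε) g)

/-- The volume `ω_d` of the unit ball of `ℝᵈ`. -/
def unitBallVolume (d : ℕ) : ℝ :=
  (volume (Metric.ball (0 : EuclideanSpace ℝ (Fin d)) 1)).toReal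

/-- The rate function `I_D(γ)`. -/
def rateFunction {d : ℕ} (D : Set (EuclideanSpace ℝ (Fin d))) (p γ : ℝ) : ℝ :=
  (γ * ((d : ℝ) - p) / (d : ℝ)) ^ ((d : ℝ) / ((d : ℝ) - p)) *
    (unitBallVolume d * Real.Gamma ((2 * p - (d : ℝ)) / p)) ^ (-(p / ((d : ℝ) - p))) *
    (sSup ((fun g => l2Norm D g) '' sobolevSphere D)) ^ (-(2 * (d : ℝ) / ((d : ℝ) - p)))

/-- `ε^{2/(d-p)} log P(A)`, with `log 0 = -∞`. -/
def scaledLogProb {Ω : Type*} [MeasurableSpace Ω] (P : Measure Ω) (d : ℕ) (p ε : ℝ)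
    (A : Set Ω) : EReal :=
  ((ε ^ (2 / ((d : ℝ) - p)) : ℝ) : EReal) * ENNReal.log (P A)

/-- The deviation level `γ ε^{-(2-p)/d}`. -/
def deviationLevel (d : ℕ) (p γ ε : ℝ) : ℝ :=
  γ * ε ^ (-((2 - p) / (d : ℝ)))

end

/-!
Fix `R` with `D ⊆ closedBall 0 R`. Write `n = ε^{-2/(d-p)}` (`speed`) and
`ρ = ε^{-(2+d-p)/(d(d-p))}` (`lengthScale`). Then `ε ρ^d = n`, and the deviation level is
`γ n ρ^{-p}`. The kernels are cut off at radius of order `a ρ`, which tends to infinity, so that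
`D` looks like a point: up to lower order terms the near part `G(g)` is `‖g‖²` times one compensated
Poisson integral, that of the truncated Riesz kernel itself. By the exponential formula for Poisson
measures the logarithm of its Laplace transform is `n Λ(λ)`, where in the limit `a → ∞`
`Λ(λ) = ∫ (e^{-λ|u|^{-p}} - 1 + λ|u|^{-p}) du = λ^{d/p} ω_d Γ((2p-d)/p) / (d/p-1)`
(`rieszCumulant_eq_rpow_mul`, `rieszCumulant_one`). The lower tail of the integral has the Legendre
transform of `Λ` as its rate (`exists_dual_point`), evaluated at `γ / sup ‖g‖²`; this is `I_D(γ)`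
(`rateFunction_eq_rieszRate`).

*Near part.* For `y ∈ D` the kernel at `y - x` lies between the truncated kernels with `‖x‖` replaced
by `‖x‖ + R` and by `‖x‖ - R` (`shiftedRiesz`). The first gives the upper bound, by Chernoff's
inequality (`measure_compInt_shiftedRiesz_le`, `le_nearFun`). For the lower bound the second one only
helps if there are no obstacles in the ball of radius `2R`; a large multiple of the indicator of that
ball is added to it (`guardedRiesz`), so that a negative value of the compensated integral excludes
such obstacles (`nearFun_le_of_compInt_guardedRiesz_le`). Its lower tail is bounded below by
exponential tilting, in the non-asymptotic form `exp_mul_le_measureReal_le`, which only involves three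
values of the moment generating function.

*Far part and convergence.* Suprema over `g` are handled without chaining. The Riesz kernel at
`y - x` has, for large `x`, an expansion into finitely many products `φ_i(y) c_i(x)` with
`|c_i(x)| ≤ C |x|^{-p}`, up to an error of order `|x|^{-p-d}` (`exists_riesz_expansion`). Hence all
`F(g)` are controlled by the finitely many compensated integrals of the `c_i`, which do not depend on
`g`, and by an absolutely convergent error (`KernelExpansion.tendsto_partial`). Since `2p > d`, the
integrals of the `c_i` converge along balls, by exponential bounds and the Borel–Cantelli lemma
(`ae_tendsto_compLim`); this also gives that the limits exist for all `g` at once. The far kernel is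
of order `(aρ)^{-p}`, and Chernoff's inequality with parameter `λ ρ^p` shows that the tails of the
coefficients decay like `exp (-B n)` with `B` arbitrarily large when `a` is large
(`eventually_exists_far_exceptional`). So the far part does not contribute, and `ζ = G + F` has the
same asymptotics as `G`.
-/

/-! ### Poisson random measures -/

/-- A Poisson random measure with intensity `μ`: a random measure whose value on a set `A` with
`μ A < ∞` is Poisson with parameter `μ A`, and whose values on disjoint sets are independent. -/
structure IsPoissonMeasure {Ω E : Type*} [MeasurableSpace Ω] [MeasurableSpace E] (P : Measure Ω)
    (M : Ω → Measure E) (μ : Measure E) : Prop where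
  measurable : Measurable M
  count_law : ∀ A : Set E, MeasurableSet A → μ A ≠ ⊤ →
    P.map (fun w => M w A) = (poissonMeasure (μ A).toNNReal).map (fun n : ℕ => (n : ℝ≥0∞))
  indep : ∀ (m : ℕ) (A : Fin m → Set E), (∀ i, MeasurableSet (A i)) →
    Pairwise (fun i j => Disjoint (A i) (A j)) → iIndepFun (fun i w => M w (A i)) P

/-- A bounded measurable function that vanishes off a set of finite measure. -/
structure IsTame {E : Type*} [MeasurableSpace E] (μ : Measure E) (f : E → ℝ) : Prop where
  measurable : Measurable f
  bounded : ∃ C, ∀ x, |f x| ≤ C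
  support_ne_top : μ (Function.support f) ≠ ⊤

/-- The compensated integral `∫ f d(M - μ)`, meaningful where `f` is integrable against both
measures. -/
noncomputable def compInt {Ω E : Type*} [MeasurableSpace E] (M : Ω → Measure E) (μ : Measure E)
    (f : E → ℝ) (w : Ω) : ℝ :=
  ∫ x, f x ∂(M w) - ∫ x, f x ∂μ

/-- The contracted field is Poisson with intensity `ε dx`. -/
theorem isPoissonMeasure_contractedField {Ω : Type*} [MeasurableSpace Ω] {P : Measure Ω} {d : ℕ}
    (hd : d ≠ 0) {N : Ω → Measure (EuclideanSpace ℝ (Fin d))} (hN : IsPoissonField P N) {ε : ℝ}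
    (hε : 0 < ε) :
    IsPoissonMeasure P (fun w => contractedField ε (N w)) (ENNReal.ofReal ε • volume) := by
  have hmeas : Measurable
      (fun x : EuclideanSpace ℝ (Fin d) => (ε ^ (-(1 / (d : ℝ)))) • x) := by fun_prop
  have hc : (ε ^ (-(1 / (d : ℝ)))) ≠ 0 := (Real.rpow_pos_of_pos hε _).ne'
  have hvol : ∀ A : Set (EuclideanSpace ℝ (Fin d)),
      volume ((fun x : EuclideanSpace ℝ (Fin d) => (ε ^ (-(1 / (d : ℝ)))) • x) ⁻¹' A)
        = ENNReal.ofReal ε * volume A := by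
    intro A
    rw [Measure.addHaar_preimage_smul _ hc]
    congr 2
    rw [finrank_euclideanSpace, Fintype.card_fin, ← Real.rpow_natCast, ← Real.rpow_mul hε.le]
    have : -(1 / (d : ℝ)) * d = -1 := by field_simp
    rw [this, Real.rpow_neg_one, inv_inv, abs_of_pos hε]
  refine ⟨?_, ?_, ?_⟩
  · exact (Measure.measurable_map _ hmeas).comp hN.measurable
  · intro A hA hfin
    have h1 := hN.count_law _ (hmeas hA) (by rw [hvol A]; simpa using hfin)
    simp only [contractedField, Measure.map_apply hmeas hA]
    rw [h1, hvol]; rfl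
  · intro m A hA hdisj
    have := hN.indep m (fun i => _ ⁻¹' (A i)) (fun i => hmeas (hA i))
      (fun i j hij => (hdisj hij).preimage _)
    simpa only [contractedField, Measure.map_apply hmeas (hA _)] using this

namespace IsPoissonMeasure

variable {Ω E : Type*} [MeasurableSpace Ω] [MeasurableSpace E] {P : Measure Ω}
  {M : Ω → Measure E} {μ : Measure E}

theorem measurable_apply (hM : IsPoissonMeasure P M μ) {A : Set E} (hA : MeasurableSet A) :
    Measurable fun w => M w A :=
  (Measure.measurable_coe hA).comp hM.measurable

theorem ae_lt_top (hM : IsPoissonMeasure P M μ) {A : Set E} (hA : MeasurableSet A)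
    (hf : μ A ≠ ⊤) : ∀ᵐ w ∂P, M w A < ⊤ := by
  have h : ∀ᵐ x ∂(P.map fun w => M w A), x < ⊤ := by
    rw [hM.count_law A hA hf]
    refine (ae_map_iff (by fun_prop) measurableSet_Iio).2 (ae_of_all _ fun n => ?_)
    exact ENNReal.natCast_lt_top n
  exact ae_of_ae_map (hM.measurable_apply hA).aemeasurable h

theorem lintegral_count (hM : IsPoissonMeasure P M μ) {A : Set E} (hA : MeasurableSet A)
    (hf : μ A ≠ ⊤) : ∫⁻ w, M w A ∂P = μ A := by
  have h1 : ∫⁻ w, M w A ∂P = ∫⁻ x, x ∂(P.map fun w => M w A) :=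
    (lintegral_map measurable_id (hM.measurable_apply hA)).symm
  rw [h1, hM.count_law A hA hf, lintegral_map (by fun_prop) (by fun_prop), poissonMeasure,
    lintegral_sum_measure]
  simp only [lintegral_smul_measure, lintegral_dirac, smul_eq_mul]
  set r := (μ A).toNNReal
  have h0 := hasSum_one_poissonMeasure r
  rw [tsum_eq_zero_add' ENNReal.summable]
  have : ∀ n : ℕ, ENNReal.ofReal (rexp (-r) * r ^ (n + 1) / (n + 1).factorial) * ((n + 1 : ℕ) : ℝ≥0∞)
      = r * ENNReal.ofReal (rexp (-r) * r ^ n / n.factorial) := by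
    intro n
    rw [← ENNReal.ofReal_natCast, ← ENNReal.ofReal_mul (by positivity), ← ENNReal.ofReal_coe_nnreal,
      ← ENNReal.ofReal_mul (by positivity)]
    congr 1
    rw [Nat.factorial_succ]
    push_cast
    field_simp
    ring
  simp only [this, ENNReal.tsum_mul_left]
  rw [← ENNReal.ofReal_tsum_of_nonneg (fun n => by positivity) h0.summable, h0.tsum_eq]
  simp [r, ENNReal.coe_toNNReal hf]

/-- The intensity of a Poisson random measure is its mean. -/
theorem bind_eq [SigmaFinite μ] (hM : IsPoissonMeasure P M μ) : P.bind M = μ := by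
  refine (Measure.ext_iff_of_iUnion_eq_univ (iUnion_spanningSets μ)).2 fun i => ?_
  ext A hA
  rw [Measure.restrict_apply hA, Measure.restrict_apply hA,
    Measure.bind_apply (hA.inter (measurableSet_spanningSets μ i)) hM.measurable.aemeasurable]
  exact hM.lintegral_count (hA.inter (measurableSet_spanningSets μ i))
    ((measure_mono inter_subset_right).trans_lt (measure_spanningSets_lt_top μ i)).ne

/-- Campbell's formula. -/
theorem lintegral_lintegral [SigmaFinite μ] (hM : IsPoissonMeasure P M μ) {f : E → ℝ≥0∞}
    (hf : Measurable f) : ∫⁻ w, ∫⁻ x, f x ∂(M w) ∂P = ∫⁻ x, f x ∂μ := by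
  rw [← Measure.lintegral_bind hM.measurable.aemeasurable hf.aemeasurable, hM.bind_eq]

theorem ae_lintegral_lt_top [SigmaFinite μ] (hM : IsPoissonMeasure P M μ) {f : E → ℝ≥0∞}
    (hf : Measurable f) (hfin : ∫⁻ x, f x ∂μ ≠ ⊤) : ∀ᵐ w ∂P, ∫⁻ x, f x ∂(M w) < ⊤ := by
  refine MeasureTheory.ae_lt_top ((Measure.measurable_lintegral hf).comp hM.measurable) ?_
  simpa [Function.comp_def, hM.lintegral_lintegral hf] using hfin

theorem map_real_count (hM : IsPoissonMeasure P M μ) {A : Set E} (hA : MeasurableSet A)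
    (hf : μ A ≠ ⊤) :
    P.map (fun w => (M w).real A) = (poissonMeasure (μ A).toNNReal).map (fun n : ℕ => (n : ℝ)) := by
  have h1 : (fun w => (M w).real A) = ENNReal.toReal ∘ fun w => M w A := rfl
  rw [h1, ← Measure.map_map ENNReal.measurable_toReal (hM.measurable_apply hA),
    hM.count_law A hA hf, Measure.map_map ENNReal.measurable_toReal (by fun_prop)]
  rfl

theorem integrable_exp_count (hM : IsPoissonMeasure P M μ) {A : Set E} (hA : MeasurableSet A)
    (hf : μ A ≠ ⊤) (t : ℝ) : Integrable (fun w => rexp (t * (M w).real A)) P := by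
  have hm : Measurable fun w => (M w).real A := (hM.measurable_apply hA).ennreal_toReal
  have : Integrable (fun x => rexp (t * x)) (P.map fun w => (M w).real A) := by
    rw [hM.map_real_count hA hf]
    refine (integrable_map_measure (by fun_prop) (by fun_prop)).2 ?_
    rw [integrable_poissonMeasure_iff]
    have := (NormedSpace.expSeries_div_summable (((μ A).toNNReal : ℝ) * rexp t)).mul_left
      (rexp (-((μ A).toNNReal : ℝ)))
    refine this.congr fun n => ?_
    simp only [Function.comp, Real.norm_eq_abs, Real.abs_exp, mul_pow, ← Real.exp_nat_mul]
    rw [mul_comm t]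
    ring
  exact this.comp_measurable hm

theorem mgf_count (hM : IsPoissonMeasure P M μ) {A : Set E} (hA : MeasurableSet A)
    (hf : μ A ≠ ⊤) (t : ℝ) :
    mgf (fun w => (M w).real A) P t = rexp (μ.real A * (rexp t - 1)) := by
  have hm : Measurable fun w => (M w).real A := (hM.measurable_apply hA).ennreal_toReal
  have h1 : mgf (fun w => (M w).real A) P t = ∫ x, rexp (t * x) ∂(P.map fun w => (M w).real A) := by
    rw [integral_map hm.aemeasurable (by fun_prop)]; rfl
  rw [h1, hM.map_real_count hA hf, integral_map (by fun_prop) (by fun_prop), integral_poissonMeasure]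
  have h2 : ((μ A).toNNReal : ℝ) = μ.real A := rfl
  rw [h2]
  set r := μ.real A
  have : ∀ n : ℕ, (rexp (-r) * r ^ n / n.factorial) • rexp (t * n)
      = rexp (-r) * ((r * rexp t) ^ n / n.factorial) := by
    intro n
    rw [smul_eq_mul, mul_pow, ← Real.exp_nat_mul, mul_comm t]
    ring
  simp only [this]
  rw [tsum_mul_left, (NormedSpace.expSeries_div_hasSum_exp (r * rexp t)).tsum_eq, ← exp_eq_exp_ℝ,
    ← Real.exp_add]
  congr 1
  ring

end IsPoissonMeasure

/-! ### Exponential moments of Poisson integrals -/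

theorem abs_exp_sub_one_sub_id_le_sq_mul_exp (x : ℝ) :
    |rexp x - 1 - x| ≤ x ^ 2 * rexp |x| := by
  have h := Complex.norm_exp_sub_sum_le_norm_mul_exp (x : ℂ) 2
  simp only [Finset.sum_range_succ, Finset.sum_range_zero] at h
  have h2 : Complex.exp x - (0 + (x : ℂ) ^ 0 / (Nat.factorial 0 : ℂ) +
      (x : ℂ) ^ 1 / (Nat.factorial 1 : ℂ)) = ((rexp x - 1 - x : ℝ) : ℂ) := by
    push_cast
    simp
    ring
  rw [h2, Complex.norm_real, Complex.norm_real] at h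
  simpa using h

theorem abs_exp_sub_one_le_abs_mul_exp (x : ℝ) : |rexp x - 1| ≤ |x| * rexp |x| := by
  have h := Complex.norm_exp_sub_sum_le_norm_mul_exp (x : ℂ) 1
  simp only [Finset.sum_range_succ, Finset.sum_range_zero] at h
  have h2 : Complex.exp x - (0 + (x : ℂ) ^ 0 / (Nat.factorial 0 : ℂ))
      = ((rexp x - 1 : ℝ) : ℂ) := by
    push_cast
    simp
  rw [h2, Complex.norm_real, Complex.norm_real] at h
  simpa using h

namespace IsTame

variable {E : Type*} [MeasurableSpace E] {μ : Measure E} {f g : E → ℝ}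

theorem measurableSet_support (hf : IsTame μ f) : MeasurableSet (Function.support f) :=
  _root_.measurableSet_support hf.measurable

/-- A tame function is integrable against every measure that is finite on its support. -/
theorem integrable_of_support (hf : IsTame μ f) {ν : Measure E}
    (hν : ν (Function.support f) ≠ ⊤) : Integrable f ν := by
  obtain ⟨C, hC⟩ := hf.bounded
  rw [← integrableOn_iff_integrable_of_support_subset (Subset.refl (Function.support f))]
  exact Measure.integrableOn_of_bounded (M := C) hν hf.measurable.aestronglyMeasurable
    (ae_of_all _ fun x => by simpa using hC x)

theorem integrable (hf : IsTame μ f) : Integrable f μ := hf.integrable_of_support hf.support_ne_top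

theorem const_mul (hf : IsTame μ f) (c : ℝ) : IsTame μ (fun x => c * f x) := by
  obtain ⟨C, hC⟩ := hf.bounded
  refine ⟨hf.measurable.const_mul c, ⟨|c| * C, fun x => ?_⟩, ?_⟩
  · rw [abs_mul]; exact mul_le_mul_of_nonneg_left (hC x) (abs_nonneg c)
  · refine ne_top_of_le_ne_top hf.support_ne_top (measure_mono fun x hx => ?_)
    simp only [Function.mem_support] at hx ⊢
    exact right_ne_zero_of_mul hx

theorem add (hf : IsTame μ f) (hg : IsTame μ g) : IsTame μ (fun x => f x + g x) := by
  obtain ⟨C, hC⟩ := hf.bounded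
  obtain ⟨C', hC'⟩ := hg.bounded
  refine ⟨hf.measurable.add hg.measurable,
    ⟨C + C', fun x => (abs_add_le _ _).trans (add_le_add (hC x) (hC' x))⟩, ?_⟩
  refine ne_top_of_le_ne_top ?_ (measure_mono (Function.support_add f g))
  exact ((measure_union_le _ _).trans_lt
    (ENNReal.add_lt_top.2 ⟨hf.support_ne_top.lt_top, hg.support_ne_top.lt_top⟩)).ne

theorem comp (hf : IsTame μ f) {φ : ℝ → ℝ} (hφ : Continuous φ) (h0 : φ 0 = 0) :
    IsTame μ (fun x => φ (f x)) := by
  obtain ⟨C, hC⟩ := hf.bounded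
  obtain ⟨K, hK⟩ := (isCompact_Icc (a := -C) (b := C)).exists_bound_of_continuousOn hφ.continuousOn
  refine ⟨hφ.measurable.comp hf.measurable, ⟨K, fun x => hK _ (abs_le.1 (hC x))⟩, ?_⟩
  refine ne_top_of_le_ne_top hf.support_ne_top (measure_mono fun x hx => ?_)
  simp only [Function.mem_support] at hx ⊢
  intro h
  exact hx (by rw [h, h0])

end IsTame

namespace IsPoissonMeasure

variable {Ω E : Type*} [MeasurableSpace Ω] [MeasurableSpace E] {P : Measure Ω}
  {M : Ω → Measure E} {μ : Measure E} {f : E → ℝ}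

theorem ae_integrable (hM : IsPoissonMeasure P M μ) (hf : IsTame μ f) :
    ∀ᵐ w ∂P, Integrable f (M w) := by
  filter_upwards [hM.ae_lt_top hf.measurableSet_support hf.support_ne_top] with w hw
  exact hf.integrable_of_support hw.ne

open Classical in
/-- The exponential formula for simple functions, from the independence of the values of `M` on
the level sets. -/
theorem simpleFunc_exp [IsProbabilityMeasure P] (hM : IsPoissonMeasure P M μ) (f : SimpleFunc E ℝ)
    (hf : IsTame μ f) :
    Integrable (fun w => rexp (∫ x, f x ∂(M w))) P ∧
      ∫ w, rexp (∫ x, f x ∂(M w)) ∂P = rexp (∫ x, (rexp (f x) - 1) ∂μ) := by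
  set s := f.range.filter (fun x => x ≠ 0) with hs
  have hsub : ∀ c ∈ s, f ⁻¹' {c} ⊆ Function.support f := by
    intro c hc x hx
    rw [Function.mem_support, show f x = c from hx]
    exact (Finset.mem_filter.1 hc).2
  have hfin : ∀ c ∈ s, μ (f ⁻¹' {c}) ≠ ⊤ := fun c hc =>
    ne_top_of_le_ne_top hf.support_ne_top (measure_mono (hsub c hc))
  have hmeas : ∀ c, MeasurableSet (f ⁻¹' {c}) := fun c => f.measurableSet_preimage _
  -- the values of `M` on the level sets, multiplied by the levels
  let X : s → Ω → ℝ := fun c w => (c : ℝ) * (M w).real (f ⁻¹' {(c : ℝ)})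
  have hXm : ∀ c, Measurable (X c) := fun c =>
    ((hM.measurable_apply (hmeas _)).ennreal_toReal).const_mul _
  have hind : iIndepFun X P := by
    let e := s.equivFin
    have h1 := hM.indep s.card (fun i => f ⁻¹' {((e.symm i : s) : ℝ)}) (fun i => hmeas _)
      (fun i j hij => by
        refine Disjoint.preimage _ (disjoint_singleton.2 fun h => hij ?_)
        exact e.symm.injective (Subtype.ext h))
    have h2 := h1.precomp e.injective
    have h3 := h2.comp (fun (c : s) (y : ℝ≥0∞) => (c : ℝ) * y.toReal)
      (fun c => ENNReal.measurable_toReal.const_mul _)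
    convert h3 using 2 with c
    ext w
    simp [X, Measure.real]
  have hsum : ∀ᵐ w ∂P, ∫ x, f x ∂(M w) = (∑ c ∈ (Finset.univ : Finset s), X c) w := by
    filter_upwards [hM.ae_integrable hf] with w hw
    rw [← SimpleFunc.integral_eq_integral _ hw, SimpleFunc.integral_eq_sum_filter, Finset.sum_apply,
      ← Finset.sum_coe_sort]
    exact Finset.sum_congr rfl fun c _ => by simp [X, mul_comm]
  have hint1 : ∀ c : s, Integrable (fun w => rexp (1 * X c w)) P := fun c => by
    simpa [X] using hM.integrable_exp_count (hmeas c) (hfin c c.2) (c : ℝ)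
  have hint : Integrable (fun w => rexp (1 * (∑ c ∈ (Finset.univ : Finset s), X c) w)) P :=
    hind.integrable_exp_mul_sum hXm (fun c _ => hint1 c)
  have hae : (fun w => rexp (1 * (∑ c ∈ (Finset.univ : Finset s), X c) w)) =ᵐ[P]
      (fun w => rexp (∫ x, f x ∂(M w))) := by
    filter_upwards [hsum] with w hw
    rw [hw, one_mul]
  refine ⟨hint.congr hae, ?_⟩
  rw [← integral_congr_ae hae]
  have h4 := hind.mgf_sum (t := 1) hXm Finset.univ
  rw [mgf] at h4
  rw [h4]
  have h5 : ∀ c : s, mgf (X c) P 1 = rexp (μ.real (f ⁻¹' {(c : ℝ)}) * (rexp c - 1)) := by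
    intro c
    rw [← hM.mgf_count (hmeas c) (hfin c c.2) c]
    simp [mgf, X]
  simp only [h5]
  rw [← Real.exp_sum]
  congr 1
  have h6 : Integrable (fun x => rexp (f x) - 1) μ :=
    (hf.comp (φ := fun t => rexp t - 1) (by fun_prop) (by simp)).integrable
  have h7 : (fun x => rexp (f x) - 1) = (f.map (fun t => rexp t - 1)) := by ext; simp
  rw [h7] at h6 ⊢
  rw [← SimpleFunc.integral_eq_integral _ h6, SimpleFunc.map_integral]
  · rw [Finset.sum_coe_sort s (fun c => μ.real (f ⁻¹' {c}) * (rexp c - 1)), hs, Finset.sum_filter]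
    refine Finset.sum_congr rfl fun c _ => ?_
    by_cases hc : c = 0 <;> simp [hc]
  · exact hf.integrable
  · simp

/-- The exponential formula for Poisson random measures. -/
theorem exp_integral [IsProbabilityMeasure P] (hM : IsPoissonMeasure P M μ) (hf : IsTame μ f) :
    Integrable (fun w => rexp (∫ x, f x ∂(M w))) P ∧
      ∫ w, rexp (∫ x, f x ∂(M w)) ∂P = rexp (∫ x, (rexp (f x) - 1) ∂μ) := by
  obtain ⟨C, hC⟩ := hf.bounded
  set B := Function.support f with hB
  have hBm : MeasurableSet B := hf.measurableSet_support
  let F : ℕ → SimpleFunc E ℝ := fun n =>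
    SimpleFunc.approxOn f hf.measurable univ 0 (mem_univ _) n
  have hFle : ∀ n x, |F n x| ≤ 2 * |f x| := fun n x => by
    have := SimpleFunc.norm_approxOn_zero_le hf.measurable (mem_univ (0 : ℝ)) x n
    simp only [Real.norm_eq_abs] at this
    linarith
  have hFC : ∀ n x, |F n x| ≤ 2 * C := fun n x => (hFle n x).trans (by linarith [hC x])
  have hFsupp : ∀ n, Function.support (F n) ⊆ B := fun n x hx hfx => hx (by
    have := hFle n x
    rw [hfx, abs_zero, mul_zero] at this
    exact abs_eq_zero.1 (le_antisymm this (abs_nonneg _)))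
  have hFt : ∀ n, IsTame μ (F n) := fun n => ⟨(F n).measurable, ⟨2 * C, hFC n⟩,
    ne_top_of_le_ne_top hf.support_ne_top (measure_mono (hFsupp n))⟩
  have hlim : ∀ x, Tendsto (fun n => F n x) atTop (𝓝 (f x)) := fun x =>
    SimpleFunc.tendsto_approxOn hf.measurable (mem_univ _) (by simp)
  have hS := fun n => hM.simpleFunc_exp (F n) (hFt n)
  -- the approximations are dominated by the exponential of a multiple of the number of points in
  -- the support of `f`
  have hfinB := hM.ae_lt_top hBm hf.support_ne_top
  have hlimM : ∀ᵐ w ∂P, Tendsto (fun n => ∫ x, F n x ∂(M w)) atTop (𝓝 (∫ x, f x ∂(M w))) := by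
    filter_upwards [hfinB] with w hw
    refine tendsto_integral_of_dominated_convergence (fun x => 2 * |f x|)
      (fun n => (F n).aestronglyMeasurable) ?_ (fun n => ae_of_all _ fun x => hFle n x)
      (ae_of_all _ hlim)
    exact ((hf.integrable_of_support hw.ne).abs).const_mul 2
  have hbound : ∀ n, ∀ᵐ w ∂P, ‖rexp (∫ x, F n x ∂(M w))‖ ≤ rexp (2 * C * (M w).real B) := by
    intro n
    filter_upwards [hfinB] with w hw
    rw [Real.norm_eq_abs, Real.abs_exp]
    refine Real.exp_le_exp.2 ((le_abs_self _).trans ?_)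
    rw [← setIntegral_eq_integral_of_forall_compl_eq_zero (s := B)
      (fun x hx => by_contra fun h => hx (hFsupp n h))]
    exact norm_setIntegral_le_of_norm_le_const (f := F n) hw (fun x _ => hFC n x)
  have hexpint := hM.integrable_exp_count hBm hf.support_ne_top (2 * C)
  have hlimE : ∀ᵐ w ∂P, Tendsto (fun n => rexp (∫ x, F n x ∂(M w))) atTop
      (𝓝 (rexp (∫ x, f x ∂(M w)))) := by
    filter_upwards [hlimM] with w hw using (Real.continuous_exp.tendsto _).comp hw
  have hconv := tendsto_integral_of_dominated_convergence _ (fun n => (hS n).1.aestronglyMeasurable)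
    hexpint hbound hlimE
  refine ⟨?_, ?_⟩
  · refine hexpint.mono' (aestronglyMeasurable_of_tendsto_ae atTop
      (fun n => (hS n).1.aestronglyMeasurable) hlimE) ?_
    filter_upwards [hlimE, ae_all_iff.2 hbound] with w hw hw2
    exact le_of_tendsto' hw.norm hw2
  · refine tendsto_nhds_unique hconv ?_
    simp only [(hS _).2]
    refine (Real.continuous_exp.tendsto _).comp ?_
    refine tendsto_integral_of_dominated_convergence (fun x => 2 * |f x| * rexp (2 * C))
      (fun n => ((F n).measurable.exp.sub measurable_const).aestronglyMeasurable)
      ((hf.integrable.abs.const_mul 2).mul_const _) (fun n => ae_of_all _ fun x => ?_)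
      (ae_of_all _ fun x => ((Real.continuous_exp.tendsto _).comp (hlim x)).sub_const 1)
    refine (abs_exp_sub_one_le_abs_mul_exp _).trans ?_
    gcongr
    · exact hFle n x
    · exact hFC n x

/-- The exponential moment of a compensated Poisson integral. -/
theorem exp_compInt [IsProbabilityMeasure P] (hM : IsPoissonMeasure P M μ) (hf : IsTame μ f)
    (t : ℝ) :
    Integrable (fun w => rexp (t * compInt M μ f w)) P ∧
      ∫ w, rexp (t * compInt M μ f w) ∂P = rexp (∫ x, (rexp (t * f x) - 1 - t * f x) ∂μ) := by
  have h := hM.exp_integral (hf.const_mul t)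
  have he : (fun w => rexp (t * compInt M μ f w)) =
      fun w => rexp (-∫ x, t * f x ∂μ) * rexp (∫ x, t * f x ∂(M w)) := by
    ext w
    rw [← Real.exp_add, compInt, integral_const_mul, integral_const_mul]
    ring_nf
  rw [he]
  refine ⟨h.1.const_mul _, ?_⟩
  rw [integral_const_mul, h.2, ← Real.exp_add]
  congr 1
  have h1 : Integrable (fun x => rexp (t * f x) - 1) μ :=
    (hf.comp (φ := fun s => rexp (t * s) - 1) (by fun_prop) (by simp)).integrable
  rw [integral_sub h1 (hf.const_mul t).integrable]
  ring

/-- The exponential Chebyshev inequality for the lower tail of a compensated Poisson integral. -/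
theorem measure_compInt_le [IsProbabilityMeasure P] (hM : IsPoissonMeasure P M μ)
    (hf : IsTame μ f) {t : ℝ} (ht : 0 ≤ t) (x : ℝ) :
    P {w | compInt M μ f w ≤ -x} ≤
      ENNReal.ofReal (rexp (-(t * x) + ∫ y, (rexp (-(t * f y)) - 1 + t * f y) ∂μ)) := by
  have h := hM.exp_compInt hf (-t)
  have h2 := measure_le_le_exp_mul_mgf (X := compInt M μ f) (t := -t) (-x) (by linarith) h.1
  rw [← ofReal_measureReal]
  refine ENNReal.ofReal_le_ofReal (h2.trans_eq ?_)
  rw [mgf, h.2, ← Real.exp_add]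
  congr 2
  · ring
  · refine integral_congr_ae (ae_of_all _ fun y => ?_)
    simp only
    ring_nf

/-- A Chernoff bound for both tails: the exponential of the cumulant is bounded through the second
moment, which is effective as long as `t * |f|` stays bounded. -/
theorem measure_le_abs_compInt [IsProbabilityMeasure P] (hM : IsPoissonMeasure P M μ)
    (hf : IsTame μ f) {C t B : ℝ} (ht : 0 ≤ t) (hC : ∀ x, t * |f x| ≤ C)
    (hB : t ^ 2 * rexp C * ∫ y, f y ^ 2 ∂μ ≤ B) (x : ℝ) :
    P {w | x ≤ |compInt M μ f w|} ≤ ENNReal.ofReal (2 * rexp (-(t * x) + B)) := by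
  have hsq : Integrable (fun y => f y ^ 2) μ :=
    (hf.comp (φ := fun s => s ^ 2) (by fun_prop) (by simp)).integrable
  have key : ∀ s : ℝ, |s| = t → ∫ y, (rexp (s * f y) - 1 - s * f y) ∂μ ≤ B := by
    intro s hs
    refine le_trans ?_ hB
    rw [← integral_const_mul]
    refine integral_mono ?_ (hsq.const_mul _) fun y => ?_
    · exact (hf.comp (φ := fun u => rexp (s * u) - 1 - s * u) (by fun_prop) (by simp)).integrable
    · refine (le_abs_self _).trans ((abs_exp_sub_one_sub_id_le_sq_mul_exp _).trans ?_)
      have h1 : |s * f y| ≤ C := by rw [abs_mul, hs]; exact hC y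
      have h2 : (s * f y) ^ 2 = t ^ 2 * f y ^ 2 := by rw [mul_pow, ← hs, sq_abs]
      rw [h2]
      calc t ^ 2 * f y ^ 2 * rexp |s * f y| ≤ t ^ 2 * f y ^ 2 * rexp C := by gcongr
        _ = _ := by ring
  have h1 := hM.exp_compInt hf (-t)
  have h2 := measure_le_le_exp_mul_mgf (X := compInt M μ f) (t := -t) (-x) (by linarith) h1.1
  have h3 := hM.exp_compInt hf t
  have h4 := measure_ge_le_exp_mul_mgf (X := compInt M μ f) (t := t) x ht h3.1
  rw [mgf, h1.2, ← Real.exp_add] at h2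
  rw [mgf, h3.2, ← Real.exp_add] at h4
  have hsub : {w | x ≤ |compInt M μ f w|} ⊆
      {w | compInt M μ f w ≤ -x} ∪ {w | x ≤ compInt M μ f w} := by
    intro w hw
    rcases le_abs.1 (show x ≤ |compInt M μ f w| from hw) with h | h
    · exact Or.inr h
    · exact Or.inl (show compInt M μ f w ≤ -x by linarith)
  refine (measure_mono hsub).trans ((measure_union_le _ _).trans ?_)
  rw [← ofReal_measureReal, ← ofReal_measureReal, ← ENNReal.ofReal_add (by positivity) (by positivity)]
  refine ENNReal.ofReal_le_ofReal ?_
  have e1 := Real.exp_le_exp.2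
    (add_le_add_right (key (-t) (by rw [abs_neg, abs_of_nonneg ht])) (-(t * x)))
  have e2 := Real.exp_le_exp.2 (add_le_add_right (key t (abs_of_nonneg ht)) (-(t * x)))
  rw [show - -t * -x = -(t * x) by ring] at h2
  rw [show -t * x = -(t * x) by ring] at h4
  linarith

end IsPoissonMeasure

/-! ### Tilting and dyadic blocks -/

/-- A lower bound for the probability of a lower deviation in terms of three exponential moments.
It is the change of measure argument of Cramér's theorem: under the density proportional to
`exp (-θ X)`, the variable `X` is close to `-x` unless one of the two subtracted terms is large. -/
theorem exp_mul_le_measureReal_le {Ω : Type*} [MeasurableSpace Ω] {P : Measure Ω}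
    [IsProbabilityMeasure P] {X : Ω → ℝ} (hX : ∀ t : ℝ, Integrable (fun w => rexp (t * X w)) P)
    {θ s x δ : ℝ} (hθ : 0 ≤ θ) (hs : 0 ≤ s) :
    rexp (-(θ * (x + δ))) * (mgf X P (-θ) - rexp (-(s * (x + δ))) * mgf X P (-(θ + s))
      - rexp (s * (x - δ)) * mgf X P (-(θ - s))) ≤ P.real {w | X w ≤ -(x - δ)} := by
  -- the event need not be measurable when `X` is only known through its exponential moments
  set A := toMeasurable P {w | X w ≤ -(x - δ)} with hA
  have hAm : MeasurableSet A := measurableSet_toMeasurable _ _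
  have hPA : P.real A = P.real {w | X w ≤ -(x - δ)} := by
    rw [Measure.real, Measure.real, hA, measure_toMeasurable]
  rw [← hPA]
  have h1 : rexp (-(θ * (x + δ))) * (mgf X P (-θ) - rexp (-(s * (x + δ))) * mgf X P (-(θ + s))
      - rexp (s * (x - δ)) * mgf X P (-(θ - s)))
      = ∫ w, rexp (-(θ * (x + δ))) * (rexp (-θ * X w)
        - rexp (-(s * (x + δ))) * rexp (-(θ + s) * X w)
        - rexp (s * (x - δ)) * rexp (-(θ - s) * X w)) ∂P := by
    rw [integral_const_mul, integral_sub, integral_sub, integral_const_mul, integral_const_mul]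
    · rfl
    · exact hX _
    · exact (hX _).const_mul _
    · exact (hX _).sub ((hX _).const_mul _)
    · exact (hX _).const_mul _
  have h2 : P.real A = ∫ w, A.indicator (fun _ => (1 : ℝ)) w ∂P := by
    rw [integral_indicator hAm]; simp
  rw [h1, h2]
  refine integral_mono ?_ ((integrable_const _).indicator hAm) fun w => ?_
  · exact (((hX _).sub ((hX _).const_mul _)).sub ((hX _).const_mul _)).const_mul _
  · simp only
    have e1 : rexp (-(s * (x + δ))) * rexp (-(θ + s) * X w)
        = rexp (-θ * X w) * rexp (-s * (X w + x + δ)) := by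
      rw [← Real.exp_add, ← Real.exp_add]; ring_nf
    have e2 : rexp (s * (x - δ)) * rexp (-(θ - s) * X w)
        = rexp (-θ * X w) * rexp (s * (X w + x - δ)) := by
      rw [← Real.exp_add, ← Real.exp_add]; ring_nf
    rw [e1, e2]
    have e3 : rexp (-θ * X w) - rexp (-θ * X w) * rexp (-s * (X w + x + δ))
        - rexp (-θ * X w) * rexp (s * (X w + x - δ)) = rexp (-θ * X w) *
        (1 - rexp (-s * (X w + x + δ)) - rexp (s * (X w + x - δ))) := by ring
    rw [e3]
    have p1 := Real.exp_pos (-s * (X w + x + δ))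
    have p2 := Real.exp_pos (s * (X w + x - δ))
    have nonpos : ∀ {y : ℝ}, y ≤ 0 →
        rexp (-(θ * (x + δ))) * (rexp (-θ * X w) * y) ≤ A.indicator (fun _ => (1 : ℝ)) w := by
      intro y hy
      refine le_trans ?_ (indicator_nonneg (fun _ _ => zero_le_one) w)
      exact mul_nonpos_of_nonneg_of_nonpos (Real.exp_pos _).le
        (mul_nonpos_of_nonneg_of_nonpos (Real.exp_pos _).le hy)
    -- outside `|X + x| < δ` one of the two subtracted terms exceeds the first
    by_cases hw1 : X w + x + δ ≤ 0
    · refine nonpos ?_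
      have : 1 ≤ rexp (-s * (X w + x + δ)) := Real.one_le_exp (by nlinarith)
      linarith
    by_cases hw2 : 0 ≤ X w + x - δ
    · refine nonpos ?_
      have : 1 ≤ rexp (s * (X w + x - δ)) := Real.one_le_exp (by nlinarith)
      linarith
    push Not at hw1 hw2
    have hwA : w ∈ A := subset_toMeasurable P _ (show X w ≤ -(x - δ) by linarith)
    rw [indicator_of_mem hwA, ← mul_assoc, ← Real.exp_add]
    have e4 : rexp (-(θ * (x + δ)) + -θ * X w) ≤ 1 := Real.exp_le_one_iff.2 (by nlinarith)
    have := Real.exp_pos (-(θ * (x + δ)) + -θ * X w)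
    nlinarith

/-- A sequence whose oscillation over dyadic blocks decays geometrically converges. -/
theorem exists_tendsto_of_dyadic {y : ℕ → ℝ} {r : ℝ} (hr0 : 0 ≤ r) (hr : r < 1)
    (h : ∀ᶠ k : ℕ in atTop, ∀ n ∈ Finset.Icc (2 ^ k) (2 ^ (k + 1)), |y n - y (2 ^ k)| ≤ r ^ k) :
    ∃ l, Tendsto y atTop (𝓝 l) := by
  obtain ⟨K, hK⟩ := eventually_atTop.1 h
  have hc : CauchySeq fun k => y (2 ^ (k + K)) := by
    refine cauchySeq_of_le_geometric r (r ^ K) hr fun k => ?_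
    rw [dist_comm, Real.dist_eq, ← pow_add, add_comm K k, show k + 1 + K = k + K + 1 by ring]
    exact hK (k + K) (Nat.le_add_left _ _) _
      (Finset.mem_Icc.2 ⟨Nat.pow_le_pow_right two_pos (Nat.le_succ _), le_rfl⟩)
  obtain ⟨l, hl⟩ := cauchySeq_tendsto_of_complete hc
  have hl' : Tendsto (fun k => y (2 ^ k)) atTop (𝓝 l) := (tendsto_add_atTop_iff_nat K).1 hl
  have hlog : Tendsto (fun n : ℕ => Nat.log 2 n) atTop atTop :=
    tendsto_atTop.2 fun b => by
      filter_upwards [eventually_ge_atTop (2 ^ b)] with n hn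
      exact (Nat.le_log_iff_pow_le (by norm_num) (by have := Nat.two_pow_pos b; omega)).2 hn
  refine ⟨l, ?_⟩
  have hd : Tendsto (fun n => y n - y (2 ^ Nat.log 2 n)) atTop (𝓝 0) := by
    refine squeeze_zero_norm' ?_ ((tendsto_pow_atTop_nhds_zero_of_lt_one hr0 hr).comp hlog)
    filter_upwards [hlog.eventually_ge_atTop K, eventually_ge_atTop 1] with n hn hn1
    exact hK _ hn n (Finset.mem_Icc.2 ⟨Nat.pow_log_le_self 2 (by omega),
      (Nat.lt_pow_succ_log_self (by norm_num) n).le⟩)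
  simpa using hd.add (hl'.comp hlog)

/-! ### The capped Riesz kernel -/

/-- `x ↦ max(r, |x|)^{-p}`, the Riesz kernel truncated at height `r^{-p}`. -/
noncomputable def cappedRiesz {d : ℕ} (p r : ℝ) (x : EuclideanSpace ℝ (Fin d)) : ℝ :=
  max r ‖x‖ ^ (-p)

section Capped

variable {d : ℕ} {p : ℝ}

local notation "𝔼" => EuclideanSpace ℝ (Fin d)

theorem measurable_cappedRiesz (r : ℝ) : Measurable (cappedRiesz (d := d) p r) := by
  unfold cappedRiesz; fun_prop

theorem cappedRiesz_nonneg {r : ℝ} (hr : 0 ≤ r) (x : 𝔼) : 0 ≤ cappedRiesz p r x :=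
  Real.rpow_nonneg (le_max_of_le_left hr) _

theorem cappedRiesz_le {r : ℝ} (hr : 0 < r) (hp : 0 ≤ p) (x : 𝔼) :
    cappedRiesz p r x ≤ r ^ (-p) :=
  Real.rpow_le_rpow_of_nonpos hr (le_max_left _ _) (by linarith)

theorem cappedRiesz_scale {r : ℝ} (hr : 0 < r) (x : 𝔼) :
    cappedRiesz p r (r • x) = r ^ (-p) * cappedRiesz p 1 x := by
  unfold cappedRiesz
  rw [norm_smul, Real.norm_of_nonneg hr.le, ← Real.mul_rpow hr.le (by positivity),
    mul_max_of_nonneg _ _ hr.le, mul_one]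

theorem integrable_cappedRiesz_rpow {q : ℝ} (hq : (d : ℝ) < q) :
    Integrable (cappedRiesz (d := d) q 1) := by
  have h := integrable_one_add_norm (E := 𝔼) (μ := volume) (r := q) (by simpa using hq)
  have hd : (0 : ℝ) ≤ q := (Nat.cast_nonneg d).trans hq.le
  refine (h.const_mul (2 ^ q)).mono' (measurable_cappedRiesz 1).aestronglyMeasurable
    (ae_of_all _ fun x => ?_)
  rw [Real.norm_of_nonneg (cappedRiesz_nonneg zero_le_one x), cappedRiesz]
  have h1 : (1 + ‖x‖) / 2 ≤ max 1 ‖x‖ := by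
    rcases le_total 1 ‖x‖ with h | h
    · rw [max_eq_right h]; linarith
    · rw [max_eq_left h]; linarith
  calc max 1 ‖x‖ ^ (-q) ≤ ((1 + ‖x‖) / 2) ^ (-q) :=
        Real.rpow_le_rpow_of_nonpos (by positivity) h1 (by linarith)
    _ = 2 ^ q * (1 + ‖x‖) ^ (-q) := by
        rw [Real.div_rpow (by positivity) (by norm_num), Real.rpow_neg (by norm_num : (0 : ℝ) ≤ 2)]
        field_simp

theorem integrable_cappedRiesz {q r : ℝ} (hq : (d : ℝ) < q) (hr : 0 < r) :
    Integrable (cappedRiesz (d := d) q r) := by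
  have h := ((integrable_cappedRiesz_rpow hq).const_mul (r ^ (-q))).comp_smul
    (inv_ne_zero hr.ne')
  refine h.congr (ae_of_all _ fun x => ?_)
  simp only
  rw [← cappedRiesz_scale hr, smul_inv_smul₀ hr.ne']

theorem integral_cappedRiesz {q r : ℝ} (hr : 0 < r) :
    ∫ x : 𝔼, cappedRiesz q r x = r ^ ((d : ℝ) - q) * ∫ x : 𝔼, cappedRiesz q 1 x := by
  have h := Measure.integral_comp_smul volume (fun x : 𝔼 => cappedRiesz q r x) r
  simp only [cappedRiesz_scale hr, integral_const_mul] at h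
  rw [finrank_euclideanSpace, Fintype.card_fin, abs_of_pos (by positivity), smul_eq_mul] at h
  rw [sub_eq_add_neg, Real.rpow_add hr, Real.rpow_natCast]
  field_simp at h
  linarith

theorem cappedRiesz_sq {r : ℝ} (hr : 0 ≤ r) (x : 𝔼) :
    cappedRiesz p r x ^ 2 = cappedRiesz (2 * p) r x := by
  unfold cappedRiesz
  rw [← Real.rpow_natCast, ← Real.rpow_mul (le_max_of_le_left hr)]
  congr 1
  push_cast
  ring

end Capped

/-! ### Conditionally convergent Poisson integrals -/

section CompLim

variable {Ω : Type*} [MeasurableSpace Ω] {P : Measure Ω} {d : ℕ} {p : ℝ}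

local notation "𝔼" => EuclideanSpace ℝ (Fin d)

/-- The limit of the compensated integrals of `f` over the balls of radius `n` about the origin
(a junk value where there is no limit). -/
noncomputable def compLim (M : Ω → Measure 𝔼) (μ : Measure 𝔼) (f : 𝔼 → ℝ) (w : Ω) : ℝ :=
  limUnder atTop fun n : ℕ => compInt M μ ((Metric.ball 0 (n : ℝ)).indicator f) w

theorem isTame_indicator {μ : Measure 𝔼} {f : 𝔼 → ℝ} (hf : Measurable f) {A : Set 𝔼}
    (hA : MeasurableSet A) (hμA : μ A ≠ ⊤) {C : ℝ} (hC : ∀ x ∈ A, |f x| ≤ C) :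
    IsTame μ (A.indicator f) := by
  refine ⟨hf.indicator hA, ⟨max C 0, fun x => ?_⟩,
    ne_top_of_le_ne_top hμA (measure_mono support_indicator_subset)⟩
  by_cases hx : x ∈ A
  · rw [indicator_of_mem hx]; exact (hC x hx).trans (le_max_left _ _)
  · rw [indicator_of_notMem hx, abs_zero]; exact le_max_right _ _

theorem smul_volume_ball_ne_top (ε : ℝ) (n : ℝ) :
    (ENNReal.ofReal ε • volume : Measure 𝔼) (Metric.ball 0 n) ≠ ⊤ := by
  simp only [Measure.smul_apply, smul_eq_mul]
  exact ENNReal.mul_ne_top ENNReal.ofReal_ne_top measure_ball_lt_top.ne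

theorem isTame_ball_indicator {ε : ℝ} {f : 𝔼 → ℝ} (hf : Measurable f) {C : ℝ}
    (hC : ∀ x, |f x| ≤ C) (n : ℕ) :
    IsTame (ENNReal.ofReal ε • volume) ((Metric.ball 0 (n : ℝ)).indicator f) :=
  isTame_indicator hf measurableSet_ball (smul_volume_ball_ne_top ε n) fun x _ => hC x

theorem abs_le_of_le_cappedRiesz {f : 𝔼 → ℝ} {C r : ℝ} (hr : 0 < r) (hp : 0 ≤ p) (hC0 : 0 ≤ C)
    (hC : ∀ x, |f x| ≤ C * cappedRiesz p r x) (x : 𝔼) : |f x| ≤ C * r ^ (-p) :=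
  (hC x).trans (mul_le_mul_of_nonneg_left (cappedRiesz_le hr hp x) hC0)

theorem integral_sq_le_of_le_cappedRiesz {ε : ℝ} (hε : 0 ≤ ε) {f : 𝔼 → ℝ} {C r : ℝ} (hr : 0 < r)
    (hp : (d : ℝ) < 2 * p) (hC : ∀ x, |f x| ≤ C * cappedRiesz p r x) :
    ∫ x, f x ^ 2 ∂(ENNReal.ofReal ε • volume) ≤
      ε * C ^ 2 * r ^ ((d : ℝ) - 2 * p) * ∫ x : 𝔼, cappedRiesz (2 * p) 1 x := by
  rw [integral_smul_measure, ENNReal.toReal_ofReal hε, smul_eq_mul, mul_assoc, mul_assoc]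
  refine mul_le_mul_of_nonneg_left ?_ hε
  rw [← integral_cappedRiesz hr, ← integral_const_mul]
  refine integral_mono_of_nonneg (ae_of_all _ fun x => sq_nonneg _)
    ((integrable_cappedRiesz hp hr).const_mul _) (ae_of_all _ fun x => ?_)
  simp only
  rw [← cappedRiesz_sq hr.le, ← mul_pow, ← sq_abs]
  exact pow_le_pow_left₀ (abs_nonneg _) (hC x) 2

/-- The tail of compensated integrals of functions dominated by a capped Riesz kernel. -/
theorem measure_le_abs_compInt_of_le_cappedRiesz [IsProbabilityMeasure P] {M : Ω → Measure 𝔼}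
    {ε : ℝ} (hε : 0 ≤ ε) (hM : IsPoissonMeasure P M (ENNReal.ofReal ε • volume)) {f : 𝔼 → ℝ}
    (hf : IsTame (ENNReal.ofReal ε • volume) f) {C r : ℝ} (hr : 0 < r) (hp0 : 0 ≤ p)
    (hp : (d : ℝ) < 2 * p) (hC0 : 0 ≤ C) (hC : ∀ x, |f x| ≤ C * cappedRiesz p r x) {t : ℝ}
    (ht : 0 ≤ t) (x : ℝ) :
    P {w | x ≤ |compInt M (ENNReal.ofReal ε • volume) f w|} ≤
      ENNReal.ofReal (2 * rexp (-(t * x) + t ^ 2 * rexp (t * (C * r ^ (-p))) *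
        (ε * C ^ 2 * r ^ ((d : ℝ) - 2 * p) * ∫ x : 𝔼, cappedRiesz (2 * p) 1 x))) := by
  refine hM.measure_le_abs_compInt hf ht (C := t * (C * r ^ (-p)))
    (fun x => mul_le_mul_of_nonneg_left (abs_le_of_le_cappedRiesz hr hp0 hC0 hC x) ht) ?_ x
  exact mul_le_mul_of_nonneg_left (integral_sq_le_of_le_cappedRiesz hε hr hp hC) (by positivity)

theorem compInt_sub_compInt {Ω' : Type*} {M : Ω' → Measure 𝔼} {μ : Measure 𝔼} {f g : 𝔼 → ℝ} {w : Ω'}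
    (hf : Integrable f μ) (hg : Integrable g μ) (hf' : Integrable f (M w))
    (hg' : Integrable g (M w)) :
    compInt M μ f w - compInt M μ g w = compInt M μ (fun x => f x - g x) w := by
  rw [compInt, compInt, compInt, integral_sub hf hg, integral_sub hf' hg']; ring

/-- The factor `4^{-k}` beats the `2^k` radii of a dyadic block. -/
theorem exp_neg_pow_le (b : ℝ) (hb : 1 < b) :
    ∃ K : ℝ, 0 ≤ K ∧ ∀ k : ℕ, rexp (-(b ^ k)) ≤ K * (1 / 4) ^ k := by
  obtain ⟨m, hm⟩ := pow_unbounded_of_one_lt (4 : ℝ) hb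
  refine ⟨m.factorial, by positivity, fun k => ?_⟩
  have hb0 : 0 < b := by linarith
  have h1 : (b ^ k) ^ m / m.factorial ≤ rexp (b ^ k) :=
    Real.pow_div_factorial_le_exp _ (by positivity) m
  have h2 : (4 : ℝ) ^ k ≤ (b ^ k) ^ m := by
    rw [← pow_mul, mul_comm, pow_mul]; exact pow_le_pow_left₀ (by norm_num) hm.le k
  rw [Real.exp_neg, one_div, inv_pow, ← div_eq_mul_inv, inv_le_comm₀ (Real.exp_pos _) (by positivity)]
  refine le_trans ?_ h1
  rw [inv_div]
  gcongr

/-- Compensated integrals of functions of order `|x|^{-p}`, `2p > d`, converge conditionally: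
exponential tail bounds and the Borel–Cantelli lemma control all radii of a dyadic block at once. -/
theorem ae_tendsto_compLim [IsProbabilityMeasure P] {M : Ω → Measure 𝔼} {ε : ℝ} (hε : 0 ≤ ε)
    (hM : IsPoissonMeasure P M (ENNReal.ofReal ε • volume)) {f : 𝔼 → ℝ} (hf : Measurable f)
    {C r : ℝ} (hr : 0 < r) (hp0 : 0 ≤ p) (hp : (d : ℝ) < 2 * p) (hC0 : 0 ≤ C)
    (hC : ∀ x, |f x| ≤ C * cappedRiesz p r x) :
    ∀ᵐ w ∂P, Tendsto (fun n : ℕ => compInt M (ENNReal.ofReal ε • volume)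
      ((Metric.ball 0 (n : ℝ)).indicator f) w) atTop
      (𝓝 (compLim M (ENNReal.ofReal ε • volume) f w)) := by
  set μ : Measure 𝔼 := ENNReal.ofReal ε • volume with hμ
  set y : ℕ → Ω → ℝ := fun n w => compInt M μ ((Metric.ball 0 (n : ℝ)).indicator f) w with hy
  set I : ℝ := ∫ x : 𝔼, cappedRiesz (2 * p) 1 x with hI
  have hI0 : 0 ≤ I := integral_nonneg fun x => cappedRiesz_nonneg zero_le_one x
  have hfC := abs_le_of_le_cappedRiesz hr hp0 hC0 hC
  have htame : ∀ n : ℕ, IsTame μ ((Metric.ball 0 (n : ℝ)).indicator f) :=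
    isTame_ball_indicator hf hfC
  -- on the block of radius `2^k` the parameter `2^{kη}` in the Chernoff bound keeps the second
  -- moment term bounded; the threshold `b^{-k}`, with `b = 2^{η/2}`, is then summable and exceeded
  -- with probability of order `exp (-b^k)`
  set η : ℝ := p - d / 2 with hη
  have hη0 : 0 < η := by rw [hη]; linarith
  have hηp : η ≤ p := by rw [hη]; linarith [(Nat.cast_nonneg d : (0 : ℝ) ≤ d)]
  set b : ℝ := 2 ^ (η / 2) with hb
  have hb1 : 1 < b := Real.one_lt_rpow (by norm_num) (by positivity)
  have hb0 : 0 < b := by linarith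
  set B : ℝ := rexp C * (ε * C ^ 2 * I) with hB
  have hB0 : 0 ≤ B := by positivity
  -- the tail bound for a single radius in a dyadic block
  have key : ∀ k : ℕ, r ≤ 2 ^ k → ∀ n ∈ Finset.Icc (2 ^ k) (2 ^ (k + 1)),
      P {w | (b⁻¹) ^ k ≤ |y n w - y (2 ^ k) w|} ≤ ENNReal.ofReal (2 * rexp (-(b ^ k) + B)) := by
    intro k hk n hn
    have hn1 := (Finset.mem_Icc.1 hn).1
    have hn1' : ((2 ^ k : ℕ) : ℝ) ≤ n := by exact_mod_cast hn1
    set g : 𝔼 → ℝ := (Metric.ball 0 (n : ℝ) \ Metric.ball 0 ((2 ^ k : ℕ) : ℝ)).indicator f with hg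
    have hgt : IsTame μ g := isTame_indicator hf (measurableSet_ball.diff measurableSet_ball)
      (ne_top_of_le_ne_top (smul_volume_ball_ne_top ε n) (measure_mono sdiff_subset))
      fun x _ => hfC x
    have hae : ∀ᵐ w ∂P, y n w - y (2 ^ k) w = compInt M μ g w := by
      filter_upwards [hM.ae_integrable (htame n), hM.ae_integrable (htame (2 ^ k))] with w h1 h2
      rw [hy]
      simp only
      rw [compInt_sub_compInt (htame n).integrable (htame (2 ^ k)).integrable h1 h2]
      congr 1
      rw [hg, indicator_sdiff (Metric.ball_subset_ball hn1')]
      rfl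
    have h2k : (0 : ℝ) < 2 ^ k := by positivity
    have h2k1 : (1 : ℝ) ≤ 2 ^ k := one_le_pow₀ (by norm_num)
    have hgC : ∀ x, |g x| ≤ C * cappedRiesz p (2 ^ k) x := by
      intro x
      by_cases hx : x ∈ Metric.ball (0 : 𝔼) (n : ℝ) \ Metric.ball 0 ((2 ^ k : ℕ) : ℝ)
      · rw [hg, indicator_of_mem hx]
        refine (hC x).trans_eq ?_
        have hx2 : (2 : ℝ) ^ k ≤ ‖x‖ := by
          have := hx.2
          simp only [Metric.mem_ball, dist_zero_right, not_lt] at this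
          exact_mod_cast this
        rw [cappedRiesz, cappedRiesz, max_eq_right hx2, max_eq_right (hk.trans hx2)]
      · rw [hg, indicator_of_notMem hx, abs_zero]
        exact mul_nonneg hC0 (cappedRiesz_nonneg h2k.le x)
    have h3 := measure_le_abs_compInt_of_le_cappedRiesz hε hM hgt h2k hp0 hp hC0 hgC
      (t := (2 ^ k : ℝ) ^ η) (by positivity) ((b⁻¹) ^ k)
    have hset : P {w | (b⁻¹) ^ k ≤ |y n w - y (2 ^ k) w|} = P {w | (b⁻¹) ^ k ≤ |compInt M μ g w|} := by
      refine measure_congr ?_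
      filter_upwards [hae] with w hw
      change (_ ≤ _) = (_ ≤ _)
      rw [hw]
    rw [hset]
    refine h3.trans (ENNReal.ofReal_le_ofReal ?_)
    have e1 : (2 ^ k : ℝ) ^ η * b⁻¹ ^ k = b ^ k := by
      have : (2 ^ k : ℝ) ^ η = b ^ k * b ^ k := by
        rw [← mul_pow, hb, ← Real.rpow_add (by norm_num), add_halves, ← Real.rpow_natCast,
          ← Real.rpow_mul (by norm_num), mul_comm, Real.rpow_mul (by norm_num), Real.rpow_natCast]
      rw [this, inv_pow]
      field_simp
    have e2 : (2 ^ k : ℝ) ^ η * (C * (2 ^ k : ℝ) ^ (-p)) ≤ C := by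
      have : (2 ^ k : ℝ) ^ η * (2 ^ k : ℝ) ^ (-p) ≤ 1 := by
        rw [← Real.rpow_add h2k]
        exact Real.rpow_le_one_of_one_le_of_nonpos h2k1 (by linarith)
      calc _ = C * ((2 ^ k : ℝ) ^ η * (2 ^ k : ℝ) ^ (-p)) := by ring
        _ ≤ C * 1 := by gcongr
        _ = C := mul_one C
    have e3 : ((2 ^ k : ℝ) ^ η) ^ 2 * (2 ^ k : ℝ) ^ ((d : ℝ) - 2 * p) = 1 := by
      rw [← Real.rpow_natCast, ← Real.rpow_mul h2k.le, ← Real.rpow_add h2k]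
      have : η * (2 : ℕ) + ((d : ℝ) - 2 * p) = 0 := by rw [hη]; push_cast; ring
      rw [this, Real.rpow_zero]
    rw [e1]
    refine mul_le_mul_of_nonneg_left (Real.exp_le_exp.2 (add_le_add_right ?_ _)) (by norm_num)
    calc _ = rexp ((2 ^ k : ℝ) ^ η * (C * (2 ^ k : ℝ) ^ (-p))) *
          ((((2 ^ k : ℝ) ^ η) ^ 2 * (2 ^ k : ℝ) ^ ((d : ℝ) - 2 * p)) * (ε * C ^ 2 * I)) := by ring
      _ ≤ rexp C * (1 * (ε * C ^ 2 * I)) := by rw [e3]; gcongr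
      _ = B := by rw [one_mul]
  obtain ⟨K, hK0, hK⟩ := exp_neg_pow_le b hb1
  obtain ⟨k0, hk0⟩ := pow_unbounded_of_one_lt r (one_lt_two)
  let A : ℕ → Set Ω := fun k => ⋃ n ∈ Finset.Icc (2 ^ (k + k0)) (2 ^ (k + k0 + 1)),
    {w | (b⁻¹) ^ (k + k0) ≤ |y n w - y (2 ^ (k + k0)) w|}
  have hA : ∀ k, P (A k) ≤ ENNReal.ofReal (4 * K * rexp B * (1 / 2) ^ (k + k0)) := by
    intro k
    refine (measure_biUnion_finset_le _ _).trans ?_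
    refine (Finset.sum_le_card_nsmul _ _ _ (key (k + k0) ?_)).trans ?_
    · exact hk0.le.trans (pow_le_pow_right₀ one_le_two (Nat.le_add_left _ _))
    rw [nsmul_eq_mul, ← ENNReal.ofReal_natCast, ← ENNReal.ofReal_mul (by positivity)]
    refine ENNReal.ofReal_le_ofReal ?_
    set j := k + k0
    have hcard : ((Finset.Icc (2 ^ j) (2 ^ (j + 1))).card : ℝ) ≤ 2 * 2 ^ j := by
      rw [Nat.card_Icc]
      have : 2 ^ (j + 1) + 1 - 2 ^ j ≤ 2 * 2 ^ j := by have := Nat.one_le_two_pow (n := j); omega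
      exact_mod_cast this
    rw [Real.exp_add]
    calc _ ≤ (2 * 2 ^ j) * (2 * ((K * (1 / 4) ^ j) * rexp B)) := by gcongr; exact hK j
      _ = 4 * K * rexp B * (2 ^ j * (1 / 4) ^ j) := by ring
      _ = _ := by rw [← mul_pow]; norm_num
  have hsum : ∑' k, P (A k) ≠ ⊤ := by
    refine ne_top_of_le_ne_top ?_ (ENNReal.tsum_le_tsum hA)
    rw [← ENNReal.ofReal_tsum_of_nonneg (fun k => by positivity)]
    · exact ENNReal.ofReal_ne_top
    · exact ((summable_nat_add_iff k0).2
        (summable_geometric_of_lt_one (by norm_num) (by norm_num : (1 / 2 : ℝ) < 1))).mul_left _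
  filter_upwards [ae_eventually_notMem hsum] with w hw
  refine tendsto_nhds_limUnder (exists_tendsto_of_dyadic (r := b⁻¹) (by positivity)
    (inv_lt_one_of_one_lt₀ hb1) ?_)
  obtain ⟨k1, hk1⟩ := eventually_atTop.1 hw
  filter_upwards [eventually_ge_atTop (k1 + k0)] with k hk n hn
  have h4 := hk1 (k - k0) (by omega)
  simp only [A, show k - k0 + k0 = k by omega, mem_iUnion, not_exists, mem_ofPred_eq, not_le] at h4
  exact (h4 n hn).le

/-- Tail bounds pass to almost sure limits. -/
theorem measure_lt_abs_le_of_tendsto {y : ℕ → Ω → ℝ} {Y : Ω → ℝ}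
    (h : ∀ᵐ w ∂P, Tendsto (fun n => y n w) atTop (𝓝 (Y w))) {x : ℝ} {b : ℝ≥0∞}
    (hb : ∀ n, P {w | x ≤ |y n w|} ≤ b) : P {w | x < |Y w|} ≤ b := by
  let A : ℕ → Set Ω := fun n => ⋂ m ≥ n, {w | x ≤ |y m w|}
  have hsub : {w | x < |Y w|} ≤ᵐ[P] ⋃ n, A n := by
    filter_upwards [h] with w hw hx
    obtain ⟨n, hn⟩ := eventually_atTop.1 (hw.abs.eventually (lt_mem_nhds (show x < |Y w| from hx)))
    exact mem_iUnion.2 ⟨n, mem_iInter₂.2 fun m hm => (hn m hm).le⟩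
  refine (measure_mono_ae hsub).trans ?_
  have hmono : Monotone A := fun n m hnm w hw =>
    mem_iInter₂.2 fun k hk => mem_iInter₂.1 hw k (hnm.trans hk)
  rw [hmono.measure_iUnion]
  exact iSup_le fun n => (measure_mono (iInter₂_subset n le_rfl)).trans (hb n)

/-- The tail of limits of compensated integrals of functions dominated by a capped Riesz kernel. -/
theorem measure_lt_abs_compLim_of_le_cappedRiesz [IsProbabilityMeasure P] {M : Ω → Measure 𝔼}
    {ε : ℝ} (hε : 0 ≤ ε) (hM : IsPoissonMeasure P M (ENNReal.ofReal ε • volume)) {f : 𝔼 → ℝ}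
    (hf : Measurable f) {C r : ℝ} (hr : 0 < r) (hp0 : 0 ≤ p)
    (hp : (d : ℝ) < 2 * p) (hC0 : 0 ≤ C) (hC : ∀ x, |f x| ≤ C * cappedRiesz p r x) {t : ℝ}
    (ht : 0 ≤ t) (x : ℝ) :
    P {w | x < |compLim M (ENNReal.ofReal ε • volume) f w|} ≤
      ENNReal.ofReal (2 * rexp (-(t * x) + t ^ 2 * rexp (t * (C * r ^ (-p))) *
        (ε * C ^ 2 * r ^ ((d : ℝ) - 2 * p) * ∫ x : 𝔼, cappedRiesz (2 * p) 1 x))) := by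
  refine measure_lt_abs_le_of_tendsto (ae_tendsto_compLim hε hM hf hr hp0 hp hC0 hC) fun n => ?_
  refine measure_le_abs_compInt_of_le_cappedRiesz hε hM
    (isTame_ball_indicator hf (abs_le_of_le_cappedRiesz hr hp0 hC0 hC) n) hr hp0 hp hC0
    (fun y => ?_) ht x
  by_cases hy : y ∈ Metric.ball (0 : 𝔼) (n : ℝ)
  · rw [indicator_of_mem hy]; exact hC y
  · rw [indicator_of_notMem hy, abs_zero]; exact mul_nonneg hC0 (cappedRiesz_nonneg hr.le y)

end CompLim

/-! ### Expansion of the Riesz kernel at infinity -/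

section Taylor

variable {d : ℕ} {p : ℝ}

local notation "𝔼" => EuclideanSpace ℝ (Fin d)

/-- `H y x` is a finite sum of products of a function of `y` that is bounded for `|y| ≤ R` and a
function of `x` that is bounded for `|x| ≥ 1`. -/
def IsFiniteRank (R : ℝ) (H : 𝔼 → 𝔼 → ℝ) : Prop :=
  ∃ (ι : Type) (_ : Fintype ι) (φ c : ι → 𝔼 → ℝ) (C : ℝ), 0 ≤ C ∧
    (∀ i, Measurable (φ i)) ∧ (∀ i, Measurable (c i)) ∧ (∀ i y, ‖y‖ ≤ R → |φ i y| ≤ C) ∧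
    (∀ i x, 1 ≤ ‖x‖ → |c i x| ≤ C) ∧ ∀ y x, H y x = ∑ i, φ i y * c i x

theorem IsFiniteRank.mul_single {R : ℝ} {φ c : 𝔼 → ℝ} (hφ : Measurable φ) (hc : Measurable c)
    {C : ℝ} (hφC : ∀ y, ‖y‖ ≤ R → |φ y| ≤ C) (hcC : ∀ x, 1 ≤ ‖x‖ → |c x| ≤ C) (hC : 0 ≤ C) :
    IsFiniteRank R fun y x => φ y * c x :=
  ⟨Unit, inferInstance, fun _ => φ, fun _ => c, C, hC, fun _ => hφ, fun _ => hc, fun _ => hφC,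
    fun _ => hcC, fun y x => by simp⟩

theorem IsFiniteRank.const (R a : ℝ) : IsFiniteRank (d := d) R fun _ _ => a := by
  have := IsFiniteRank.mul_single (d := d) (R := R) (φ := fun _ => a) (c := fun _ => 1)
    measurable_const measurable_const (C := max |a| 1) (fun _ _ => le_max_left _ _)
    (fun _ _ => by simp) (by positivity)
  simpa using this

theorem IsFiniteRank.add {R : ℝ} {H K : 𝔼 → 𝔼 → ℝ} (hH : IsFiniteRank R H)
    (hK : IsFiniteRank R K) : IsFiniteRank R fun y x => H y x + K y x := by
  obtain ⟨ι, _, φ, c, C, hC, h1, h2, h3, h4, h5⟩ := hH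
  obtain ⟨κ, _, ψ, e, C', hC', k1, k2, k3, k4, k5⟩ := hK
  refine ⟨ι ⊕ κ, inferInstance, Sum.elim φ ψ, Sum.elim c e, max C C', le_max_of_le_left hC,
    ?_, ?_, ?_, ?_, ?_⟩
  · rintro (i | i); exacts [h1 i, k1 i]
  · rintro (i | i); exacts [h2 i, k2 i]
  · rintro (i | i) y hy
    exacts [(h3 i y hy).trans (le_max_left _ _), (k3 i y hy).trans (le_max_right _ _)]
  · rintro (i | i) x hx
    exacts [(h4 i x hx).trans (le_max_left _ _), (k4 i x hx).trans (le_max_right _ _)]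
  · intro y x; simp [h5, k5]

theorem IsFiniteRank.mul {R : ℝ} {H K : 𝔼 → 𝔼 → ℝ} (hH : IsFiniteRank R H)
    (hK : IsFiniteRank R K) : IsFiniteRank R fun y x => H y x * K y x := by
  obtain ⟨ι, _, φ, c, C, hC, h1, h2, h3, h4, h5⟩ := hH
  obtain ⟨κ, _, ψ, e, C', hC', k1, k2, k3, k4, k5⟩ := hK
  refine ⟨ι × κ, inferInstance, fun i y => φ i.1 y * ψ i.2 y, fun i x => c i.1 x * e i.2 x, C * C',
    mul_nonneg hC hC', fun i => (h1 _).mul (k1 _), fun i => (h2 _).mul (k2 _), fun i y hy => ?_,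
    fun i x hx => ?_, fun y x => ?_⟩
  · rw [abs_mul]; exact mul_le_mul (h3 _ y hy) (k3 _ y hy) (abs_nonneg _) hC
  · rw [abs_mul]; exact mul_le_mul (h4 _ x hx) (k4 _ x hx) (abs_nonneg _) hC
  · simp only [h5, k5]
    rw [Finset.sum_mul_sum, Fintype.sum_prod_type]
    exact Finset.sum_congr rfl fun i _ => Finset.sum_congr rfl fun j _ => by ring

theorem IsFiniteRank.pow {R : ℝ} {H : 𝔼 → 𝔼 → ℝ} (hH : IsFiniteRank R H) (k : ℕ) :
    IsFiniteRank R fun y x => H y x ^ k := by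
  induction k with
  | zero => simpa using IsFiniteRank.const R 1
  | succ k ih => simpa only [pow_succ] using ih.mul hH

theorem IsFiniteRank.sum {R : ℝ} {κ : Type*} (s : Finset κ) {H : κ → 𝔼 → 𝔼 → ℝ}
    (hH : ∀ k, IsFiniteRank R (H k)) : IsFiniteRank R fun y x => ∑ k ∈ s, H k y x := by
  classical
  induction s using Finset.induction_on with
  | empty => simpa using IsFiniteRank.const R 0
  | insert a s ha ih => simpa only [Finset.sum_insert ha] using (hH a).add ih

/-- The relative increment `(|y - x|² - |x|²) / |x|²`. -/
noncomputable def relIncr (y x : 𝔼) : ℝ :=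
  (‖y‖ ^ 2 - 2 * inner ℝ y x) * (‖x‖ ^ 2)⁻¹

theorem isFiniteRank_relIncr (R : ℝ) : IsFiniteRank (d := d) R relIncr := by
  have h1 : IsFiniteRank (d := d) R fun y x => ‖y‖ ^ 2 * (‖x‖ ^ 2)⁻¹ := by
    refine IsFiniteRank.mul_single (φ := fun y => ‖y‖ ^ 2) (c := fun x => (‖x‖ ^ 2)⁻¹)
      (by fun_prop) (by fun_prop) (C := max (R ^ 2) 1) (fun y hy => ?_) (fun x hx => ?_)
      (by positivity)
    · rw [abs_of_nonneg (by positivity)]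
      exact (pow_le_pow_left₀ (norm_nonneg _) hy 2).trans (le_max_left _ _)
    · rw [abs_of_nonneg (by positivity)]
      exact (inv_le_one_of_one_le₀ (one_le_pow₀ hx)).trans (le_max_right _ _)
  have h2 : ∀ k : Fin d, IsFiniteRank (d := d) R fun y x => (-2 * y k) * (x k * (‖x‖ ^ 2)⁻¹) := by
    intro k
    have hle : ∀ z : 𝔼, |z k| ≤ ‖z‖ := fun z => by
      simpa using PiLp.norm_apply_le z k
    refine IsFiniteRank.mul_single (φ := fun y => -2 * y k) (c := fun x => x k * (‖x‖ ^ 2)⁻¹)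
      (by fun_prop) (by fun_prop) (C := max (2 * R) 1) (fun y hy => ?_) (fun x hx => ?_)
      (by positivity)
    · rw [abs_mul, abs_neg, abs_two]
      exact (mul_le_mul_of_nonneg_left ((hle y).trans hy) (by norm_num)).trans (le_max_left _ _)
    · rw [abs_mul, abs_of_nonneg (a := (‖x‖ ^ 2)⁻¹) (by positivity)]
      refine le_trans ?_ (le_max_right _ _)
      rw [← div_eq_mul_inv]
      refine div_le_one_of_le₀ ((hle x).trans ?_) (by positivity)
      nlinarith
  have h3 := h1.add (IsFiniteRank.sum Finset.univ h2)
  convert h3 using 3 with y x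
  rw [relIncr, sub_mul, PiLp.inner_apply, Finset.mul_sum, Finset.sum_mul, sub_eq_add_neg,
    ← Finset.sum_neg_distrib]
  congr 1
  refine Finset.sum_congr rfl fun k _ => ?_
  simp
  ring

theorem abs_relIncr_le {R : ℝ} {y x : 𝔼} (hy : ‖y‖ ≤ R) (hx : 1 ≤ ‖x‖) :
    |relIncr y x| ≤ (R ^ 2 + 2 * R) * ‖x‖⁻¹ := by
  have hx0 : 0 < ‖x‖ := by linarith
  have hR : 0 ≤ R := (norm_nonneg y).trans hy
  rw [relIncr, abs_mul, abs_of_nonneg (a := (‖x‖ ^ 2)⁻¹) (by positivity)]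
  have h1 : |‖y‖ ^ 2 - 2 * inner ℝ y x| ≤ (R ^ 2 + 2 * R) * ‖x‖ := by
    refine (abs_sub _ _).trans ?_
    rw [abs_of_nonneg (a := ‖y‖ ^ 2) (by positivity), abs_mul, abs_two]
    have h2 := abs_real_inner_le_norm y x
    have h3 : ‖y‖ ^ 2 ≤ R ^ 2 := pow_le_pow_left₀ (norm_nonneg _) hy 2
    nlinarith [mul_le_mul_of_nonneg_right hy hx0.le, sq_nonneg R]
  calc _ ≤ (R ^ 2 + 2 * R) * ‖x‖ * (‖x‖ ^ 2)⁻¹ := by gcongr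
    _ = _ := by field_simp

theorem norm_sub_rpow_eq {y x : 𝔼} (hx : x ≠ 0) (p : ℝ) :
    ‖y - x‖ ^ (-p) = ‖x‖ ^ (-p) * (1 + relIncr y x) ^ (-p / 2) := by
  have hx0 : 0 < ‖x‖ := norm_pos_iff.2 hx
  have h1 : ‖y - x‖ ^ 2 = ‖x‖ ^ 2 * (1 + relIncr y x) := by
    rw [relIncr, norm_sub_sq_real]
    field_simp
    ring
  have h2 : 0 ≤ 1 + relIncr y x := by
    by_contra h
    push Not at h
    have : ‖x‖ ^ 2 * (1 + relIncr y x) < 0 := mul_neg_of_pos_of_neg (by positivity) h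
    rw [← h1] at this
    exact absurd this (not_lt.2 (by positivity))
  have h3 : ∀ z : 𝔼, ‖z‖ ^ (-p) = (‖z‖ ^ 2) ^ (-p / 2) := fun z => by
    rw [← Real.rpow_natCast, ← Real.rpow_mul (norm_nonneg _)]
    congr 1
    push_cast
    ring
  rw [h3, h1, Real.mul_rpow (by positivity) h2, ← h3]

/-- The expansion at infinity of the Riesz kernel: the binomial series in the relative increment
`(|y - x|² - |x|²) / |x|²`, every power of which has finite rank. -/
theorem exists_riesz_expansion (p : ℝ) {R : ℝ} (hR : 0 ≤ R) (m : ℕ) :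
    ∃ (ι : Type) (_ : Fintype ι) (φ c : ι → 𝔼 → ℝ) (C r : ℝ), 0 ≤ C ∧ 1 ≤ r ∧
      (∀ i, Measurable (φ i)) ∧ (∀ i, Measurable (c i)) ∧ (∀ i y, ‖y‖ ≤ R → |φ i y| ≤ C) ∧
      (∀ i x, r ≤ ‖x‖ → |c i x| ≤ C * ‖x‖ ^ (-p)) ∧
      ∀ y x, ‖y‖ ≤ R → r ≤ ‖x‖ →
        |‖y - x‖ ^ (-p) - ∑ i, φ i y * c i x| ≤ C * ‖x‖ ^ (-(p + m)) := by
  have hO := (Real.one_add_rpow_hasFPowerSeriesAt_zero (a := -p / 2)).isBigO_sub_partialSum_pow m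
  obtain ⟨C₁, hC₁⟩ := hO.bound
  obtain ⟨δ, hδ, hδC⟩ := Metric.eventually_nhds_iff.1 hC₁
  set b : ℕ → ℝ := fun k => (binomialSeries ℝ (-p / 2)).coeff k with hb
  have hfr : IsFiniteRank (d := d) R fun y x => ∑ k ∈ Finset.range m, b k * relIncr y x ^ k :=
    IsFiniteRank.sum _ fun k => (IsFiniteRank.const R (b k)).mul ((isFiniteRank_relIncr R).pow k)
  obtain ⟨ι, hι, φ, c, C, hC, h1, h2, h3, h4, h5⟩ := hfr
  set A := R ^ 2 + 2 * R with hA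
  have hA0 : 0 ≤ A := by positivity
  refine ⟨ι, hι, φ, fun i x => ‖x‖ ^ (-p) * c i x, max C (|C₁| * A ^ m), max 1 (A / δ + 1),
    le_max_of_le_left hC, le_max_left _ _, h1, fun i => (by fun_prop : Measurable _).mul (h2 i),
    fun i y hy => (h3 i y hy).trans (le_max_left _ _), fun i x hx => ?_, fun y x hy hx => ?_⟩
  · have hx1 := (le_max_left _ _).trans hx
    rw [abs_mul, abs_of_nonneg (by positivity : (0 : ℝ) ≤ ‖x‖ ^ (-p)), mul_comm]
    exact mul_le_mul_of_nonneg_right ((h4 i x hx1).trans (le_max_left _ _)) (by positivity)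
  · have hx1 := (le_max_left _ _).trans hx
    have hx0 : 0 < ‖x‖ := by linarith
    have hs := abs_relIncr_le hy hx1
    have hsδ : |relIncr y x| < δ := by
      refine hs.trans_lt ?_
      have hx2 := (le_max_right _ _).trans hx
      rw [← div_eq_mul_inv, div_lt_iff₀ hx0]
      have : A / δ < ‖x‖ := by linarith
      rw [div_lt_iff₀ hδ] at this
      linarith
    have h6 := hδC (y := relIncr y x) (by simpa [Real.dist_eq] using hsδ)
    have h7 : (binomialSeries ℝ (-p / 2)).partialSum m (relIncr y x)
        = ∑ k ∈ Finset.range m, b k * relIncr y x ^ k := by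
      rw [FormalMultilinearSeries.partialSum]
      refine Finset.sum_congr rfl fun k _ => ?_
      rw [FormalMultilinearSeries.apply_eq_pow_smul_coeff, smul_eq_mul, mul_comm]
    have h5' : ∑ k ∈ Finset.range m, b k * relIncr y x ^ k = ∑ i, φ i y * c i x := h5 y x
    rw [zero_add, h7, h5'] at h6
    have h8 : ∑ i, φ i y * (‖x‖ ^ (-p) * c i x) = ‖x‖ ^ (-p) * ∑ i, φ i y * c i x := by
      rw [Finset.mul_sum]; exact Finset.sum_congr rfl fun i _ => by ring
    rw [norm_sub_rpow_eq (norm_pos_iff.1 hx0), h8, ← mul_sub, abs_mul,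
      abs_of_nonneg (by positivity : (0 : ℝ) ≤ ‖x‖ ^ (-p))]
    have h9 : ‖x‖ ^ (-(p + m)) = ‖x‖ ^ (-p) * (‖x‖⁻¹) ^ m := by
      rw [neg_add, Real.rpow_add hx0, Real.rpow_neg hx0.le (m : ℝ), Real.rpow_natCast, inv_pow]
    rw [h9]
    have h10 : |(1 + relIncr y x) ^ (-p / 2) - ∑ i, φ i y * c i x| ≤ |C₁| * A ^ m * (‖x‖⁻¹) ^ m := by
      rw [← Real.norm_eq_abs]
      refine h6.trans ?_
      rw [Real.norm_eq_abs, abs_pow, abs_norm, Real.norm_eq_abs, mul_assoc, ← mul_pow]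
      exact mul_le_mul (le_abs_self _) (pow_le_pow_left₀ (abs_nonneg _) hs m) (by positivity)
        (abs_nonneg _)
    calc _ ≤ ‖x‖ ^ (-p) * (|C₁| * A ^ m * (‖x‖⁻¹) ^ m) := by gcongr
      _ = (|C₁| * A ^ m) * (‖x‖ ^ (-p) * (‖x‖⁻¹) ^ m) := by ring
      _ ≤ _ := by gcongr; exact le_max_right _ _

end Taylor

/-! ### Smeared kernels and simultaneous convergence -/

theorem coe_add_ofReal_sub_coe_add_ofReal (x : ℝ≥0∞) {y : ℝ≥0∞} (hy : y ≠ ⊤) {a b : ℝ}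
    (ha : 0 ≤ a) (hb : 0 ≤ b) :
    ((x + ENNReal.ofReal a : ℝ≥0∞) : EReal) - ((y + ENNReal.ofReal b : ℝ≥0∞) : EReal)
      = (x : EReal) - (y : EReal) + ((a - b : ℝ) : EReal) := by
  lift y to ℝ≥0 using hy
  have hy' : ((y : ℝ≥0∞) : EReal) = ((y : ℝ) : EReal) := rfl
  rw [EReal.coe_ennreal_add, EReal.coe_ennreal_add, EReal.coe_ennreal_ofReal,
    EReal.coe_ennreal_ofReal, max_eq_left ha, max_eq_left hb, hy']
  induction x using ENNReal.recTopCoe with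
  | top =>
    rw [EReal.coe_ennreal_top, EReal.top_add_coe, ← EReal.coe_add, EReal.top_sub_coe,
      EReal.top_sub_coe, EReal.top_add_coe]
  | coe x =>
    have hx' : ((x : ℝ≥0∞) : EReal) = ((x : ℝ) : EReal) := rfl
    rw [hx', ← EReal.coe_add, ← EReal.coe_add, ← EReal.coe_sub, ← EReal.coe_sub, ← EReal.coe_add]
    congr 1
    ring

theorem tendsto_add_coe {u v : ℕ → EReal} {L : EReal} {z : ℝ} (hu : Tendsto u atTop (𝓝 L))
    (hv : Tendsto v atTop (𝓝 (z : EReal))) :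
    Tendsto (fun n => u n + v n) atTop (𝓝 (L + z)) :=
  (EReal.continuousAt_add (p := (L, (z : EReal))) (Or.inr (EReal.coe_ne_bot z))
    (Or.inr (EReal.coe_ne_top z))).tendsto.comp (hu.prodMk_nhds hv)

section Expansion

variable {d : ℕ} {p : ℝ}

local notation "𝔼" => EuclideanSpace ℝ (Fin d)

/-- `x ↦ ∫ κ(y - x) m(dy)` for a nonnegative kernel `κ`. -/
noncomputable def smear (m : Measure 𝔼) (κ : 𝔼 → ℝ) (x : 𝔼) : ℝ≥0∞ :=
  ∫⁻ y, ENNReal.ofReal (κ (y - x)) ∂m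

theorem measurable_smear (m : Measure 𝔼) [SFinite m] {κ : 𝔼 → ℝ} (hκ : Measurable κ) :
    Measurable (smear m κ) := by
  unfold smear
  exact Measurable.lintegral_prod_right'
    (f := fun z : 𝔼 × 𝔼 => ENNReal.ofReal (κ (z.2 - z.1))) (by fun_prop)

theorem lintegral_smear (m : Measure 𝔼) [SFinite m] {κ : 𝔼 → ℝ} (hκ : Measurable κ) :
    ∫⁻ x, smear m κ x = m univ * ∫⁻ z, ENNReal.ofReal (κ z) := by
  unfold smear
  rw [lintegral_lintegral_swap (by fun_prop)]
  simp_rw [lintegral_sub_left_eq_self (fun z => ENNReal.ofReal (κ z))]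
  rw [lintegral_const, mul_comm]

/-- An approximation of the kernel `κ (y - x)`, for `y ∈ D` and `|x| ≥ N`, by a finite sum of
products `φ i y * c i x`, with an integrable error `e x`. All functions of `x` are of the order of
the Riesz kernel of exponent `p` capped at radius `s`. -/
structure KernelExpansion (D : Set 𝔼) (p : ℝ) (κ : 𝔼 → ℝ) (N : ℕ) {ι : Type} [Fintype ι]
    (φ c : ι → 𝔼 → ℝ) (e : 𝔼 → ℝ) (C s : ℝ) : Prop where
  pos : 0 < s
  nonneg : 0 ≤ C
  measurable_left : ∀ i, Measurable (φ i)
  abs_left_le : ∀ i, ∀ y ∈ D, |φ i y| ≤ C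
  measurable_right : ∀ i, Measurable (c i)
  abs_right_le : ∀ i x, |c i x| ≤ C * cappedRiesz p s x
  right_eq_zero : ∀ i, ∀ x ∈ Metric.ball (0 : 𝔼) N, c i x = 0
  measurable_error : Measurable e
  error_nonneg : ∀ x, 0 ≤ e x
  error_le : ∀ x, e x ≤ C * cappedRiesz p s x
  integrable_error : Integrable e
  approx : ∀ x ∉ Metric.ball (0 : 𝔼) N, ∀ y ∈ D, |κ (y - x) - ∑ i, φ i y * c i x| ≤ e x

theorem tendsto_integral_ball_indicator {ν : Measure 𝔼} {f : 𝔼 → ℝ} (hf : Integrable f ν) :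
    Tendsto (fun n : ℕ => ∫ x, (Metric.ball 0 (n : ℝ)).indicator f x ∂ν) atTop
      (𝓝 (∫ x, f x ∂ν)) := by
  refine tendsto_integral_of_dominated_convergence (fun x => ‖f x‖)
    (fun n => hf.aestronglyMeasurable.indicator measurableSet_ball) hf.norm
    (fun n => ae_of_all _ fun x => norm_indicator_le_norm_self _ _) (ae_of_all _ fun x => ?_)
  refine tendsto_const_nhds.congr' ?_
  obtain ⟨n, hn⟩ := exists_nat_gt ‖x‖
  filter_upwards [eventually_ge_atTop n] with k hk
  have hkn : (n : ℝ) ≤ k := by exact_mod_cast hk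
  rw [indicator_of_mem]
  simpa using hn.trans_le hkn

namespace KernelExpansion

variable {D : Set (EuclideanSpace ℝ (Fin d))} {κ : EuclideanSpace ℝ (Fin d) → ℝ} {N : ℕ}
  {ι : Type} [Fintype ι] {φ c : ι → EuclideanSpace ℝ (Fin d) → ℝ}
  {e : EuclideanSpace ℝ (Fin d) → ℝ} {C s : ℝ} {m : Measure (EuclideanSpace ℝ (Fin d))}
  [IsFiniteMeasure m]

theorem integrable_left (h : KernelExpansion D p κ N φ c e C s) (hm : ∀ᵐ y ∂m, y ∈ D) (i : ι) :
    Integrable (φ i) m :=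
  Integrable.of_bound (h.measurable_left i).aestronglyMeasurable C (by
    filter_upwards [hm] with y hy using h.abs_left_le i y hy)

theorem abs_integral_left_le (h : KernelExpansion D p κ N φ c e C s) (hm : ∀ᵐ y ∂m, y ∈ D)
    (i : ι) : |∫ y, φ i y ∂m| ≤ C * m.real univ :=
  norm_integral_le_of_norm_le_const (f := φ i) (by
    filter_upwards [hm] with y hy using h.abs_left_le i y hy)

theorem integrable_kernel (h : KernelExpansion D p κ N φ c e C s) (hκ : Measurable κ)
    (hm : ∀ᵐ y ∂m, y ∈ D) {x : 𝔼} (hx : x ∉ Metric.ball (0 : 𝔼) N) :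
    Integrable (fun y => κ (y - x)) m := by
  have h1 : Integrable (fun y => ∑ i, φ i y * c i x) m :=
    integrable_finsetSum _ fun i _ => (h.integrable_left hm i).mul_const _
  have h2 : Integrable (fun y => κ (y - x) - ∑ i, φ i y * c i x) m := by
    refine Integrable.of_bound ?_ (e x) (by
      filter_upwards [hm] with y hy using h.approx x hx y hy)
    exact (Measurable.aestronglyMeasurable (by fun_prop : Measurable fun y => κ (y - x))).sub
      h1.aestronglyMeasurable
  exact (h2.add h1).congr (ae_of_all _ fun y => by simp)

/-- The difference between the smeared kernel and its expansion. -/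
theorem abs_smear_sub_le (h : KernelExpansion D p κ N φ c e C s) (hκ : Measurable κ)
    (hκ0 : ∀ z, 0 ≤ κ z) (hm : ∀ᵐ y ∂m, y ∈ D) {x : 𝔼} (hx : x ∉ Metric.ball (0 : 𝔼) N) :
    smear m κ x ≠ ⊤ ∧
      |(smear m κ x).toReal - ∑ i, (∫ y, φ i y ∂m) * c i x| ≤ m.real univ * e x := by
  have h0 := h.integrable_kernel hκ hm hx
  have h1 : smear m κ x = ENNReal.ofReal (∫ y, κ (y - x) ∂m) :=
    (ofReal_integral_eq_lintegral_ofReal h0 (ae_of_all _ fun y => hκ0 _)).symm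
  refine ⟨h1 ▸ ENNReal.ofReal_ne_top, ?_⟩
  rw [h1, ENNReal.toReal_ofReal (integral_nonneg fun y => hκ0 _)]
  have h2 : ∑ i, (∫ y, φ i y ∂m) * c i x = ∫ y, ∑ i, φ i y * c i x ∂m := by
    rw [integral_finsetSum _ fun i _ => (h.integrable_left hm i).mul_const _]
    exact Finset.sum_congr rfl fun i _ => (integral_mul_const _ _).symm
  rw [h2, ← integral_sub h0
    (integrable_finsetSum _ fun i _ => (h.integrable_left hm i).mul_const _), mul_comm]
  exact norm_integral_le_of_norm_le_const (f := fun y => κ (y - x) - ∑ i, φ i y * c i x) (by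
    filter_upwards [hm] with y hy using h.approx x hx y hy)

/-- Convergence of the compensated integrals of `smear m κ` over balls, simultaneously for all
finite measures `m` on `D`, once the finitely many coefficients of an expansion of `κ` have
convergent compensated integrals. -/
theorem tendsto_partial (h : KernelExpansion D p κ N φ c e C s) (hp : 0 ≤ p) (hκ : Measurable κ)
    (hκ0 : ∀ z, 0 ≤ κ z) {ε : ℝ} {ν : Measure 𝔼}
    (hν : ∀ n : ℕ, ν (Metric.ball 0 (n : ℝ)) ≠ ⊤) {Y : ι → ℝ}
    (hY : ∀ i, Tendsto (fun n : ℕ => ∫ x, (Metric.ball 0 (n : ℝ)).indicator (c i) x ∂ν -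
      ∫ x, (Metric.ball 0 (n : ℝ)).indicator (c i) x ∂(ENNReal.ofReal ε • volume)) atTop
      (𝓝 (Y i)))
    (he : Integrable e ν) (hm : ∀ᵐ y ∂m, y ∈ D)
    (hloc : ∀ n : ℕ, ∫⁻ x in Metric.ball 0 (n : ℝ), smear m κ x ≠ ⊤) :
    ∃ z : ℝ, |z| ≤ m.real univ * (C * ∑ i, |Y i| + ∫ x, e x ∂ν +
        ∫ x, e x ∂(ENNReal.ofReal ε • volume)) ∧
      Tendsto (fun n : ℕ =>
        ((∫⁻ x in Metric.ball 0 (n : ℝ), smear m κ x ∂ν : ℝ≥0∞) : EReal) -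
          ((ENNReal.ofReal ε * ∫⁻ x in Metric.ball 0 (n : ℝ), smear m κ x : ℝ≥0∞) : EReal)) atTop
        (𝓝 (((∫⁻ x in Metric.ball 0 (N : ℝ), smear m κ x ∂ν : ℝ≥0∞) : EReal) -
          ((ENNReal.ofReal ε * ∫⁻ x in Metric.ball 0 (N : ℝ), smear m κ x : ℝ≥0∞) : EReal) +
          (z : EReal))) := by
  set μ : Measure 𝔼 := ENNReal.ofReal ε • volume with hμ
  have hμe : Integrable e μ := h.integrable_error.smul_measure ENNReal.ofReal_ne_top
  set B : ℕ → Set 𝔼 := fun n => Metric.ball 0 (n : ℝ) with hB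
  have hBm : ∀ n, MeasurableSet (B n) := fun n => measurableSet_ball
  have hμB : ∀ n : ℕ, μ (B n) ≠ ⊤ := fun n => smul_volume_ball_ne_top ε n
  set f := smear m κ with hf
  have hfm : Measurable f := measurable_smear m hκ
  -- the real-valued part `g` outside the ball of radius `N` is the finite sum `∑ Φ i * c i` plus
  -- a remainder `r` that is dominated by `e`
  set g : 𝔼 → ℝ := (B N)ᶜ.indicator fun x => (f x).toReal with hg
  have hgm : Measurable g := hfm.ennreal_toReal.indicator (hBm N).compl
  have hg0 : ∀ x, 0 ≤ g x := fun x => indicator_nonneg (fun _ _ => ENNReal.toReal_nonneg) x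
  have hgin : ∀ x ∈ B N, g x = 0 := fun x hx => indicator_of_notMem (not_not.2 hx) _
  have hgout : ∀ x ∉ B N, g x = (f x).toReal := fun x hx => indicator_of_mem (mem_compl hx) _
  set Φ : ι → ℝ := fun i => ∫ y, φ i y ∂m with hΦ
  set r : 𝔼 → ℝ := fun x => g x - ∑ i, Φ i * c i x with hr
  have hrm : Measurable r :=
    hgm.sub (Finset.measurable_sum _ fun i _ => (h.measurable_right i).const_mul _)
  have hre : ∀ x, |r x| ≤ m.real univ * e x := by
    intro x
    by_cases hx : x ∈ B N
    · have : r x = 0 := by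
        simp only [hr, hgin x hx, h.right_eq_zero _ x hx]
        simp
      rw [this, abs_zero]
      exact mul_nonneg measureReal_nonneg (h.error_nonneg x)
    · simp only [hr, hgout x hx]
      exact (h.abs_smear_sub_le hκ hκ0 hm hx).2
  have hcb : ∀ i x, |c i x| ≤ C * s ^ (-p) := fun i =>
    abs_le_of_le_cappedRiesz h.pos hp h.nonneg (h.abs_right_le i)
  have hcI : ∀ (ν' : Measure 𝔼), (∀ n : ℕ, ν' (B n) ≠ ⊤) → ∀ i n,
      Integrable ((B n).indicator (c i)) ν' := fun ν' hν' i n =>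
    (isTame_indicator (h.measurable_right i) (hBm n) (hν' n)
      (fun x _ => hcb i x)).integrable
  have hrI : ∀ (ν' : Measure 𝔼), Integrable e ν' → Integrable r ν' := fun ν' hν' =>
    (hν'.const_mul (m.real univ)).mono' hrm.aestronglyMeasurable (ae_of_all _ hre)
  have hgdec : ∀ n, (B n).indicator g =
      fun x => (∑ i, Φ i * (B n).indicator (c i) x) + (B n).indicator r x := by
    intro n
    ext x
    by_cases hx : x ∈ B n
    · simp only [indicator_of_mem hx, hr]; ring
    · simp only [indicator_of_notMem hx]; simp
  have hgI : ∀ (ν' : Measure 𝔼), (∀ n : ℕ, ν' (B n) ≠ ⊤) → Integrable e ν' → ∀ n,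
      Integrable ((B n).indicator g) ν' ∧ ∫ x, (B n).indicator g x ∂ν' =
        (∑ i, Φ i * ∫ x, (B n).indicator (c i) x ∂ν') + ∫ x, (B n).indicator r x ∂ν' := by
    intro ν' hν' he' n
    have i1 := fun i => (hcI ν' hν' i n).const_mul (Φ i)
    have i2 : Integrable (fun x => ∑ i, Φ i * (B n).indicator (c i) x) ν' :=
      integrable_finsetSum _ fun i _ => i1 i
    have i3 := (hrI ν' he').indicator (hBm n)
    rw [hgdec n]
    refine ⟨i2.add i3, ?_⟩
    rw [integral_add i2 i3, integral_finsetSum _ fun i _ => i1 i]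
    simp only [integral_const_mul]
  -- splitting off the ball of radius `N`
  have hsplit : ∀ (ν' : Measure 𝔼), (∀ n : ℕ, ν' (B n) ≠ ⊤) → Integrable e ν' → ∀ n, N ≤ n →
      ∫⁻ x in B n, f x ∂ν' = ∫⁻ x in B N, f x ∂ν' +
        ENNReal.ofReal (∫ x, (B n).indicator g x ∂ν') := by
    intro ν' hν' he' n hn
    have hsub : B N ⊆ B n := Metric.ball_subset_ball (by exact_mod_cast hn)
    rw [← lintegral_inter_add_sdiff f (B n) (hBm N), inter_eq_self_of_subset_right hsub]
    congr 1
    rw [ofReal_integral_eq_lintegral_ofReal (hgI ν' hν' he' n).1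
      (ae_of_all _ fun x => indicator_nonneg (fun x _ => hg0 x) x),
      ← lintegral_indicator ((hBm n).diff (hBm N))]
    refine lintegral_congr fun x => ?_
    by_cases hx : x ∈ B n
    · by_cases hx' : x ∈ B N
      · rw [indicator_of_notMem (fun hh => hh.2 hx'), indicator_of_mem hx, hgin x hx',
          ENNReal.ofReal_zero]
      · rw [indicator_of_mem (show x ∈ B n \ B N from ⟨hx, hx'⟩), indicator_of_mem hx, hgout x hx',
          ENNReal.ofReal_toReal (h.abs_smear_sub_le hκ hκ0 hm hx').1]
    · rw [indicator_of_notMem (fun hh => hx hh.1), indicator_of_notMem hx, ENNReal.ofReal_zero]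
  have hvol : ∀ n, ENNReal.ofReal ε * ∫⁻ x in B n, f x = ∫⁻ x in B n, f x ∂μ := by
    intro n
    rw [hμ, Measure.restrict_smul, lintegral_smul_measure, smul_eq_mul]
  refine ⟨(∑ i, Φ i * Y i) + (∫ x, r x ∂ν - ∫ x, r x ∂μ), ?_, ?_⟩
  · have b1 : |∑ i, Φ i * Y i| ≤ m.real univ * (C * ∑ i, |Y i|) := by
      refine (Finset.abs_sum_le_sum_abs _ _).trans ?_
      rw [Finset.mul_sum, Finset.mul_sum]
      refine Finset.sum_le_sum fun i _ => ?_
      rw [abs_mul]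
      have := mul_le_mul_of_nonneg_right (h.abs_integral_left_le hm i) (abs_nonneg (Y i))
      linarith
    have b2 : ∀ ν' : Measure 𝔼, Integrable e ν' →
        |∫ x, r x ∂ν'| ≤ m.real univ * ∫ x, e x ∂ν' := fun ν' he' => by
      rw [← integral_const_mul]
      exact norm_integral_le_of_norm_le (f := r) (he'.const_mul _) (ae_of_all _ hre)
    have b3 := b2 ν he
    have b4 := b2 μ hμe
    have b5 := abs_sub (∫ x, r x ∂ν) (∫ x, r x ∂μ)
    have b6 := abs_add_le (∑ i, Φ i * Y i) (∫ x, r x ∂ν - ∫ x, r x ∂μ)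
    linarith
  · have ht : Tendsto (fun n => ∫ x, (B n).indicator g x ∂ν - ∫ x, (B n).indicator g x ∂μ) atTop
        (𝓝 ((∑ i, Φ i * Y i) + (∫ x, r x ∂ν - ∫ x, r x ∂μ))) := by
      have t1 : Tendsto (fun n => ∑ i, Φ i * (∫ x, (B n).indicator (c i) x ∂ν -
          ∫ x, (B n).indicator (c i) x ∂μ)) atTop (𝓝 (∑ i, Φ i * Y i)) :=
        tendsto_finsetSum _ fun i _ => (hY i).const_mul _
      have t2 := (tendsto_integral_ball_indicator (hrI ν he)).sub
        (tendsto_integral_ball_indicator (hrI μ hμe))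
      refine (t1.add t2).congr fun n => ?_
      rw [(hgI ν hν he n).2, (hgI μ hμB hμe n).2]
      simp only [mul_sub, Finset.sum_sub_distrib]
      ring
    have ht' := tendsto_add_coe (tendsto_const_nhds (x := ((∫⁻ x in B N, f x ∂ν : ℝ≥0∞) : EReal) -
      ((ENNReal.ofReal ε * ∫⁻ x in B N, f x : ℝ≥0∞) : EReal)))
      ((continuous_coe_real_ereal.tendsto _).comp ht)
    refine ht'.congr' ?_
    filter_upwards [eventually_ge_atTop N] with n hn
    simp only [Function.comp]
    have e1 := hsplit ν hν he n hn
    have e2 := hsplit μ hμB hμe n hn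
    have e3 : ∫⁻ x in B N, f x ∂μ ≠ ⊤ := by
      rw [← hvol]; exact ENNReal.mul_ne_top ENNReal.ofReal_ne_top (hloc N)
    rw [e1, hvol, hvol, e2, coe_add_ofReal_sub_coe_add_ofReal _ e3]
    · exact integral_nonneg fun x => indicator_nonneg (fun x _ => hg0 x) x
    · exact integral_nonneg fun x => indicator_nonneg (fun x _ => hg0 x) x

end KernelExpansion

end Expansion

/-! ### Truncated Riesz kernels -/

namespace IsSmoothTruncation

variable {α : ℝ → ℝ}

theorem continuousOn (hα : IsSmoothTruncation α) : ContinuousOn α (Ici 0) := hα.smooth.continuousOn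

theorem differentiableOn (hα : IsSmoothTruncation α) :
    DifferentiableOn ℝ α (interior (Ici (0 : ℝ))) :=
  (hα.smooth.differentiableOn (by simp)).mono interior_subset

theorem antitoneOn (hα : IsSmoothTruncation α) : AntitoneOn α (Ici 0) :=
  antitoneOn_of_deriv_nonpos (convex_Ici 0) hα.continuousOn hα.differentiableOn fun x hx =>
    (hα.deriv_mem x (by simpa using hx)).2

theorem abs_sub_le (hα : IsSmoothTruncation α) {s t : ℝ} (hs : 0 ≤ s) (ht : 0 ≤ t) :
    |α s - α t| ≤ |s - t| := by
  have key : ∀ {s t : ℝ}, 0 ≤ s → 0 ≤ t → s ≤ t → |α s - α t| ≤ |s - t| := by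
    intro s t hs ht hst
    have h1 := (convex_Ici (0 : ℝ)).mul_sub_le_image_sub_of_le_deriv hα.continuousOn
      hα.differentiableOn (C := -1) (fun x hx => (hα.deriv_mem x (by simpa using hx)).1) s hs t ht hst
    have h2 := hα.antitoneOn hs ht hst
    rw [abs_of_nonneg (by linarith), abs_of_nonpos (by linarith)]
    linarith
  rcases le_total s t with h | h
  · exact key hs ht h
  · rw [abs_sub_comm, abs_sub_comm s]; exact key ht hs h

theorem continuous_comp (hα : IsSmoothTruncation α) {X : Type*} [TopologicalSpace X] {f : X → ℝ}
    (hf : Continuous f) (hf0 : ∀ x, 0 ≤ f x) : Continuous fun x => α (f x) :=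
  hα.continuousOn.comp_continuous hf hf0

end IsSmoothTruncation

section Kernels

variable {d : ℕ} {p : ℝ} {α : ℝ → ℝ}

local notation "𝔼" => EuclideanSpace ℝ (Fin d)

/-- The length scale `ε^{-(2+d-p)/(d(d-p))}` on which the obstacles matter. -/
noncomputable def lengthScale (d : ℕ) (p ε : ℝ) : ℝ :=
  ε ^ (-((2 + (d : ℝ) - p) / ((d : ℝ) * ((d : ℝ) - p))))

/-- The Riesz kernel multiplied by the truncation function at radius `l`. -/
noncomputable def nearRiesz {d : ℕ} (α : ℝ → ℝ) (p l : ℝ) (x : EuclideanSpace ℝ (Fin d)) : ℝ :=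
  ‖x‖ ^ (-p) * α (l⁻¹ * ‖x‖)

/-- The part of the Riesz kernel that the truncation at radius `l` removes. -/
noncomputable def farRiesz {d : ℕ} (α : ℝ → ℝ) (p l : ℝ) (x : EuclideanSpace ℝ (Fin d)) : ℝ :=
  ‖x‖ ^ (-p) * (1 - α (l⁻¹ * ‖x‖))

theorem lengthScale_pos {ε : ℝ} (hε : 0 < ε) : 0 < lengthScale d p ε := Real.rpow_pos_of_pos hε _

theorem rieszKernel_eq (p : ℝ) : rieszKernel (d := d) p = fun x => ‖x‖ ^ (-p) := by
  ext x
  rw [rieszKernel, one_div, Real.rpow_neg (norm_nonneg x)]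

theorem cutoff_eq {a ε : ℝ} (hε : 0 < ε) (x : 𝔼) :
    cutoff α p a ε x = α ((a * lengthScale d p ε)⁻¹ * ‖x‖) := by
  rw [cutoff, lengthScale, Real.rpow_neg hε.le, mul_inv, inv_inv]

theorem nearKernel_eq {a ε : ℝ} (hε : 0 < ε) :
    nearKernel (d := d) α p a ε = nearRiesz α p (a * lengthScale d p ε) := by
  ext x
  rw [nearKernel, nearRiesz, cutoff_eq hε, one_div, Real.rpow_neg (norm_nonneg x)]

theorem farKernel_eq {a ε : ℝ} (hε : 0 < ε) :
    farKernel (d := d) α p a ε = farRiesz α p (a * lengthScale d p ε) := by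
  ext x
  rw [farKernel, farRiesz, cutoff_eq hε, one_div, Real.rpow_neg (norm_nonneg x)]

theorem measurable_rpow_norm (q : ℝ) : Measurable fun x : 𝔼 => ‖x‖ ^ q := by fun_prop

theorem continuous_truncation (hα : IsSmoothTruncation α) {l : ℝ} (hl : 0 ≤ l) :
    Continuous fun x : 𝔼 => α (l⁻¹ * ‖x‖) :=
  hα.continuous_comp (by fun_prop) fun x => by positivity

theorem measurable_nearRiesz (hα : IsSmoothTruncation α) {l : ℝ} (hl : 0 ≤ l) :
    Measurable (nearRiesz (d := d) α p l) :=
  (measurable_rpow_norm _).mul (continuous_truncation hα hl).measurable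

theorem measurable_farRiesz (hα : IsSmoothTruncation α) {l : ℝ} (hl : 0 ≤ l) :
    Measurable (farRiesz (d := d) α p l) :=
  (measurable_rpow_norm _).mul ((continuous_truncation hα hl).measurable.const_sub 1)

theorem truncation_mem_Icc (hα : IsSmoothTruncation α) {l : ℝ} (hl : 0 ≤ l) (x : 𝔼) :
    α (l⁻¹ * ‖x‖) ∈ Icc (0 : ℝ) 1 :=
  hα.mem_Icc _ (by positivity)

theorem nearRiesz_nonneg (hα : IsSmoothTruncation α) {l : ℝ} (hl : 0 ≤ l) (x : 𝔼) :
    0 ≤ nearRiesz α p l x :=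
  mul_nonneg (by positivity) (truncation_mem_Icc hα hl x).1

theorem farRiesz_nonneg (hα : IsSmoothTruncation α) {l : ℝ} (hl : 0 ≤ l) (x : 𝔼) :
    0 ≤ farRiesz α p l x :=
  mul_nonneg (by positivity) (sub_nonneg.2 (truncation_mem_Icc hα hl x).2)

theorem nearRiesz_add_farRiesz (l : ℝ) (x : 𝔼) :
    nearRiesz α p l x + farRiesz α p l x = ‖x‖ ^ (-p) := by
  rw [nearRiesz, farRiesz]; ring

theorem nearRiesz_eq_zero (hα : IsSmoothTruncation α) {l : ℝ} (hl : 0 < l) {x : 𝔼}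
    (hx : 3 * l ≤ ‖x‖) : nearRiesz α p l x = 0 := by
  rw [nearRiesz, hα.eq_zero, mul_zero]
  rw [inv_mul_eq_div, le_div_iff₀ hl]
  exact hx

theorem farRiesz_eq (hα : IsSmoothTruncation α) {l : ℝ} (hl : 0 < l) {x : 𝔼}
    (hx : 3 * l ≤ ‖x‖) : farRiesz α p l x = ‖x‖ ^ (-p) := by
  have := nearRiesz_add_farRiesz (α := α) (p := p) l x
  rw [nearRiesz_eq_zero hα hl hx, zero_add] at this
  exact this

theorem farRiesz_eq_zero (hα : IsSmoothTruncation α) {l : ℝ} (hl : 0 < l) {x : 𝔼}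
    (hx : ‖x‖ ≤ l) : farRiesz α p l x = 0 := by
  rw [farRiesz, hα.eq_one, sub_self, mul_zero]
  refine ⟨by positivity, ?_⟩
  rw [inv_mul_eq_div, div_le_one hl]
  exact hx

theorem integrableOn_rpow_norm_ball (hd : d ≠ 0) (hpd : p < d) (r : ℝ) :
    IntegrableOn (fun x : 𝔼 => ‖x‖ ^ (-p)) (Metric.ball 0 r) := by
  have : Nonempty (Fin d) := ⟨⟨0, Nat.pos_of_ne_zero hd⟩⟩
  rcases le_or_gt r 0 with hr | hr
  · rw [Metric.ball_eq_empty.2 hr]; exact integrableOn_empty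
  refine (integrableOn_fun_norm_addHaar (E := 𝔼) volume (f := fun y : ℝ => y ^ (-p))).2 ?_
  rw [finrank_euclideanSpace, Fintype.card_fin]
  have h1 : IntegrableOn (fun y : ℝ => y ^ ((d : ℝ) - 1 - p)) (Ioo 0 r) :=
    (intervalIntegral.integrableOn_Ioo_rpow_iff hr).2 (by linarith)
  refine h1.congr_fun (fun y hy => ?_) measurableSet_Ioo
  simp only
  rw [smul_eq_mul, ← Real.rpow_natCast, ← Real.rpow_add hy.1,
    Nat.cast_sub (Nat.one_le_iff_ne_zero.2 hd)]
  push_cast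
  ring_nf

theorem sigmaFinite_smul_volume (ε : ℝ) :
    SigmaFinite (ENNReal.ofReal ε • volume : Measure 𝔼) := by
  have : IsLocallyFiniteMeasure (ENNReal.ofReal ε • volume : Measure 𝔼) :=
    (inferInstance : IsLocallyFiniteMeasure (ε.toNNReal • volume : Measure 𝔼))
  infer_instance

theorem lintegral_rpow_norm_ball_ne_top (hd : d ≠ 0) (hpd : p < d) (r : ℝ) :
    ∫⁻ x : 𝔼 in Metric.ball 0 r, ENNReal.ofReal (‖x‖ ^ (-p)) ≠ ⊤ := by
  have h := (integrableOn_rpow_norm_ball hd hpd r).lintegral_lt_top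
  exact h.ne

theorem lintegral_ball_smear_ne_top (hd : d ≠ 0) (hpd : p < d) {R : ℝ} {m : Measure 𝔼}
    [IsFiniteMeasure m] (hm : ∀ᵐ y ∂m, y ∈ Metric.closedBall 0 R) {κ : 𝔼 → ℝ} (hκ : Measurable κ)
    (hκp : ∀ z, κ z ≤ ‖z‖ ^ (-p)) (n : ℝ) : ∫⁻ x in Metric.ball 0 n, smear m κ x ≠ ⊤ := by
  unfold smear
  rw [lintegral_lintegral_swap (by fun_prop)]
  refine ne_top_of_le_ne_top (b := (∫⁻ x : 𝔼 in Metric.ball 0 (n + R),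
    ENNReal.ofReal (‖x‖ ^ (-p))) * m univ)
    (ENNReal.mul_ne_top (lintegral_rpow_norm_ball_ne_top hd hpd _) (measure_ne_top m _)) ?_
  rw [← lintegral_const]
  refine lintegral_mono_ae ?_
  filter_upwards [hm] with y hy
  rw [← lintegral_indicator measurableSet_ball, ← lintegral_indicator measurableSet_ball,
    ← lintegral_sub_left_eq_self ((Metric.ball (0 : 𝔼) (n + R)).indicator
      fun x => ENNReal.ofReal (‖x‖ ^ (-p))) y]
  refine lintegral_mono fun x => ?_
  by_cases hx : x ∈ Metric.ball (0 : 𝔼) n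
  · rw [indicator_of_mem hx, indicator_of_mem]
    · exact ENNReal.ofReal_le_ofReal (hκp _)
    · simp only [Metric.mem_ball, Metric.mem_closedBall, dist_zero_right] at hx hy ⊢
      exact (norm_sub_le _ _).trans_lt (by linarith)
  · rw [indicator_of_notMem hx]; exact zero_le

/-- The measure `g(y)² dy` on `D`. -/
noncomputable def sqMeasure {d : ℕ} (D : Set (EuclideanSpace ℝ (Fin d)))
    (g : EuclideanSpace ℝ (Fin d) → ℝ) : Measure (EuclideanSpace ℝ (Fin d)) :=
  (volume.restrict D).withDensity fun y => ENNReal.ofReal (g y ^ 2)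

theorem aemeasurable_ofReal_sq {D : Set 𝔼} {g : 𝔼 → ℝ} (hg : MemLp g 2 (volume.restrict D)) :
    AEMeasurable (fun y => ENNReal.ofReal (g y ^ 2)) (volume.restrict D) :=
  (hg.aestronglyMeasurable.aemeasurable.pow_const 2).ennreal_ofReal

/-- The total mass of `g(y)² dy` is the square of the norm of `g` in `L²(D)`. -/
theorem sqMeasure_univ {D : Set 𝔼} {g : 𝔼 → ℝ} (hg : MemLp g 2 (volume.restrict D)) :
    sqMeasure D g univ = ENNReal.ofReal (l2Norm D g ^ 2) := by
  rw [sqMeasure, withDensity_apply _ MeasurableSet.univ, Measure.restrict_univ, l2Norm,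
    ENNReal.ofReal_pow ENNReal.toReal_nonneg, ENNReal.ofReal_toReal hg.eLpNorm_ne_top,
    eLpNorm_eq_lintegral_rpow_enorm_toReal (by norm_num) (by norm_num)]
  simp only [ENNReal.toReal_ofNat]
  rw [← ENNReal.rpow_natCast, ← ENNReal.rpow_mul]
  norm_num
  refine lintegral_congr fun y => ?_
  rw [← sq_abs, ENNReal.ofReal_pow (abs_nonneg _), ← Real.norm_eq_abs, ofReal_norm]

theorem isFiniteMeasure_sqMeasure {D : Set 𝔼} {g : 𝔼 → ℝ} (hg : MemLp g 2 (volume.restrict D)) :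
    IsFiniteMeasure (sqMeasure D g) :=
  ⟨by rw [sqMeasure_univ hg]; exact ENNReal.ofReal_lt_top⟩

theorem sqMeasure_real_univ {D : Set 𝔼} {g : 𝔼 → ℝ} (hg : MemLp g 2 (volume.restrict D)) :
    (sqMeasure D g).real univ = l2Norm D g ^ 2 := by
  rw [Measure.real, sqMeasure_univ hg, ENNReal.toReal_ofReal (by positivity)]

theorem ae_mem_sqMeasure {D : Set 𝔼} (hD : MeasurableSet D) (g : 𝔼 → ℝ) :
    ∀ᵐ y ∂(sqMeasure D g), y ∈ D :=
  (withDensity_absolutelyContinuous _ _).ae_le (ae_restrict_mem hD)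

theorem sqMeasure_absolutelyContinuous (D : Set 𝔼) (g : 𝔼 → ℝ) : sqMeasure D g ≪ volume :=
  (withDensity_absolutelyContinuous _ _).trans Measure.restrict_le_self.absolutelyContinuous

theorem smearedKernel_eq_smear {D : Set 𝔼} {g : 𝔼 → ℝ} (hg : MemLp g 2 (volume.restrict D))
    {κ : 𝔼 → ℝ} (hκ : Measurable κ) (hκ0 : ∀ z, 0 ≤ κ z) :
    smearedKernel D κ g = smear (sqMeasure D g) κ := by
  ext x
  rw [smearedKernel, smear, sqMeasure,
    lintegral_withDensity_eq_lintegral_mul₀ (aemeasurable_ofReal_sq hg) (by fun_prop)]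
  refine lintegral_congr fun y => ?_
  rw [Pi.mul_apply, ENNReal.ofReal_mul (hκ0 _), mul_comm]

theorem memLp_of_mem_sobolevSphere {D : Set 𝔼} {g : 𝔼 → ℝ} (hg : g ∈ sobolevSphere D) :
    MemLp g 2 (volume.restrict D) := by
  obtain ⟨v, hv, -⟩ := hg
  exact hv.1

theorem l2Norm_sq_le_one {D : Set 𝔼} {g : 𝔼 → ℝ} (hg : g ∈ sobolevSphere D) :
    l2Norm D g ^ 2 ≤ 1 := by
  obtain ⟨v, -, hv⟩ := hg
  nlinarith [sq_nonneg (l2Norm D v)]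

/-- Expansion of a kernel that is the Riesz kernel far from the origin. With `d` terms of the
series the error `|x|^{-p-d}` is integrable. -/
theorem exists_kernelExpansion_of_eq_riesz (hp : 0 < p) {R : ℝ} (hR : 0 ≤ R) {κ : 𝔼 → ℝ} {r : ℝ}
    (hκ : ∀ z, r ≤ ‖z‖ → κ z = ‖z‖ ^ (-p)) :
    ∃ (N : ℕ) (ι : Type) (_ : Fintype ι) (φ c : ι → 𝔼 → ℝ) (e : 𝔼 → ℝ) (C s : ℝ),
      KernelExpansion (Metric.closedBall 0 R) p κ N φ c e C s := by
  obtain ⟨ι, hι, φ, c, C, r₀, hC, hr₀, h1, h2, h3, h4, h5⟩ := exists_riesz_expansion (d := d) p hR d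
  obtain ⟨N, hN⟩ := exists_nat_gt (max r₀ (r + R))
  have hN1 : r₀ < N := (le_max_left _ _).trans_lt hN
  have hN2 : r + R < N := (le_max_right _ _).trans_lt hN
  have hN0 : (0 : ℝ) < N := by linarith
  have hmem : ∀ {x : 𝔼}, x ∈ (Metric.ball (0 : 𝔼) N)ᶜ → (N : ℝ) ≤ ‖x‖ := fun {x} hx => by
    simpa using hx
  have hcap : ∀ {q : ℝ} {x : 𝔼}, x ∈ (Metric.ball (0 : 𝔼) N)ᶜ →
      cappedRiesz q N x = ‖x‖ ^ (-q) := fun hx => by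
    rw [cappedRiesz, max_eq_right (hmem hx)]
  have he0 : ∀ x : 𝔼, 0 ≤ (Metric.ball (0 : 𝔼) N)ᶜ.indicator (fun x => C * ‖x‖ ^ (-(p + d))) x :=
    fun x => indicator_nonneg (fun x _ => by positivity) x
  have hle : ∀ x : 𝔼, (Metric.ball (0 : 𝔼) N)ᶜ.indicator (fun x => C * ‖x‖ ^ (-(p + d))) x ≤
      C * cappedRiesz (p + d) N x := fun x => by
    by_cases hx : x ∈ (Metric.ball (0 : 𝔼) N)ᶜ
    · rw [indicator_of_mem hx, hcap hx]
    · rw [indicator_of_notMem hx]; exact mul_nonneg hC (cappedRiesz_nonneg hN0.le x)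
  refine ⟨N, ι, hι, φ, fun i => (Metric.ball (0 : 𝔼) N)ᶜ.indicator (c i),
    (Metric.ball (0 : 𝔼) N)ᶜ.indicator (fun x => C * ‖x‖ ^ (-(p + d))), C, N, hN0, hC, h1,
    fun i y hy => h3 i y (by simpa using hy), fun i => (h2 i).indicator measurableSet_ball.compl,
    fun i x => ?_, fun i x hx => indicator_of_notMem (not_not.2 hx) _,
    ((measurable_rpow_norm _).const_mul C).indicator measurableSet_ball.compl, he0, fun x => ?_, ?_,
    fun x hx y hy => ?_⟩
  · by_cases hx : x ∈ (Metric.ball (0 : 𝔼) N)ᶜ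
    · rw [indicator_of_mem hx, hcap hx]
      exact h4 i x (hN1.le.trans (hmem hx))
    · rw [indicator_of_notMem hx, abs_zero]; exact mul_nonneg hC (cappedRiesz_nonneg hN0.le x)
  · refine (hle x).trans (mul_le_mul_of_nonneg_left ?_ hC)
    refine Real.rpow_le_rpow_of_exponent_le ?_ (by linarith [(Nat.cast_nonneg d : (0 : ℝ) ≤ d)])
    exact le_max_of_le_left (by linarith)
  · refine ((integrable_cappedRiesz (d := d) (q := p + d) (by linarith) hN0).const_mul C).mono'
      (((measurable_rpow_norm _).const_mul C).indicator
        measurableSet_ball.compl).aestronglyMeasurable (ae_of_all _ fun x => ?_)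
    rw [Real.norm_of_nonneg (he0 x)]
    exact hle x
  · have hx' : x ∈ (Metric.ball (0 : 𝔼) N)ᶜ := hx
    have hy' : ‖y‖ ≤ R := by simpa using hy
    simp only [indicator_of_mem hx']
    rw [hκ]
    · exact h5 y x hy' (hN1.le.trans (hmem hx'))
    · have := norm_sub_norm_le x y
      rw [norm_sub_rev] at this
      linarith [hmem hx']

/-- Almost surely the compensated integrals of `smear m κ` over balls converge, for all finite
measures `m` on a ball at once. -/
theorem KernelExpansion.ae_forall_tendsto {Ω : Type*} [MeasurableSpace Ω] {P : Measure Ω}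
    [IsProbabilityMeasure P] {M : Ω → Measure 𝔼} {ε : ℝ} (hε : 0 ≤ ε)
    (hM : IsPoissonMeasure P M (ENNReal.ofReal ε • volume)) (hp0 : 0 < p) (hp : (d : ℝ) < 2 * p)
    (hpd : p < d) {R : ℝ} {κ : 𝔼 → ℝ} {N : ℕ} {ι : Type} [Fintype ι] {φ c : ι → 𝔼 → ℝ} {e : 𝔼 → ℝ}
    {C s : ℝ} (h : KernelExpansion (Metric.closedBall 0 R) p κ N φ c e C s) (hκ : Measurable κ)
    (hκ0 : ∀ z, 0 ≤ κ z) (hκp : ∀ z, κ z ≤ ‖z‖ ^ (-p)) :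
    ∀ᵐ w ∂P, ∀ m : Measure 𝔼, IsFiniteMeasure m → (∀ᵐ y ∂m, y ∈ Metric.closedBall 0 R) →
      ∃ z : ℝ, |z| ≤ m.real univ *
          (C * ∑ i, |compLim M (ENNReal.ofReal ε • volume) (c i) w| +
            |compLim M (ENNReal.ofReal ε • volume) e w| + 2 * (ε * ∫ x, e x)) ∧
      Tendsto (fun n : ℕ =>
        ((∫⁻ x in Metric.ball 0 (n : ℝ), smear m κ x ∂(M w) : ℝ≥0∞) : EReal) -
          ((ENNReal.ofReal ε * ∫⁻ x in Metric.ball 0 (n : ℝ), smear m κ x : ℝ≥0∞) : EReal)) atTop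
        (𝓝 (((∫⁻ x in Metric.ball 0 (N : ℝ), smear m κ x ∂(M w) : ℝ≥0∞) : EReal) -
          ((ENNReal.ofReal ε * ∫⁻ x in Metric.ball 0 (N : ℝ), smear m κ x : ℝ≥0∞) : EReal) +
          (z : EReal))) := by
  have hd : d ≠ 0 := by rintro rfl; simp at hpd; linarith
  have hμe : Integrable e (ENNReal.ofReal ε • volume) :=
    h.integrable_error.smul_measure ENNReal.ofReal_ne_top
  have heC : ∀ x, |e x| ≤ C * cappedRiesz p s x := fun x => by
    rw [abs_of_nonneg (h.error_nonneg x)]; exact h.error_le x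
  have := sigmaFinite_smul_volume (d := d) ε
  have hint : ∀ᵐ w ∂P, Integrable e (M w) := by
    filter_upwards [hM.ae_lintegral_lt_top h.measurable_error.ennreal_ofReal
      hμe.lintegral_lt_top.ne] with w hw
    refine ⟨h.measurable_error.aestronglyMeasurable, ?_⟩
    rwa [hasFiniteIntegral_iff_ofReal (ae_of_all _ h.error_nonneg)]
  have hball : ∀ᵐ w ∂P, ∀ n : ℕ, M w (Metric.ball 0 (n : ℝ)) < ⊤ :=
    ae_all_iff.2 fun n => hM.ae_lt_top measurableSet_ball (smul_volume_ball_ne_top ε n)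
  have hc : ∀ᵐ w ∂P, ∀ i, Tendsto (fun n : ℕ => compInt M (ENNReal.ofReal ε • volume)
      ((Metric.ball 0 (n : ℝ)).indicator (c i)) w) atTop
      (𝓝 (compLim M (ENNReal.ofReal ε • volume) (c i) w)) :=
    ae_all_iff.2 fun i => ae_tendsto_compLim hε hM (h.measurable_right i) h.pos hp0.le hp h.nonneg
      (h.abs_right_le i)
  filter_upwards [hint, hball, hc,
    ae_tendsto_compLim hε hM h.measurable_error h.pos hp0.le hp h.nonneg heC] with w h1 h2 h3 h4
  intro m hmf hm
  obtain ⟨z, hz1, hz2⟩ := h.tendsto_partial hp0.le hκ hκ0 (fun n => (h2 n).ne) h3 h1 hm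
    (fun n => lintegral_ball_smear_ne_top hd hpd hm hκ hκp n)
  refine ⟨z, hz1.trans (mul_le_mul_of_nonneg_left ?_ measureReal_nonneg), hz2⟩
  have h5 := tendsto_nhds_unique h4
    ((tendsto_integral_ball_indicator h1).sub (tendsto_integral_ball_indicator hμe))
  have h6 : ∫ x, e x ∂(ENNReal.ofReal ε • volume) = ε * ∫ x, e x := by
    rw [integral_smul_measure, ENNReal.toReal_ofReal hε, smul_eq_mul]
  rw [h6] at h5 ⊢
  have h7 := le_abs_self (compLim M (ENNReal.ofReal ε • volume) e w)
  linarith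

end Kernels

/-! ### Existence of the compensated integrals -/

section WellDefined

variable {d : ℕ} {p : ℝ} {α : ℝ → ℝ}

local notation "𝔼" => EuclideanSpace ℝ (Fin d)

theorem compensatedIntegral_eq_of_tendsto {ε : ℝ} {ν : Measure 𝔼} {f : 𝔼 → ℝ≥0∞} {L : EReal}
    (h : Tendsto (compensatedPartial ε ν f) atTop (𝓝 L)) : compensatedIntegral ε ν f = L :=
  h.limsup_eq

theorem compensatedIntegralConverges_of_tendsto {ε : ℝ} {ν : Measure 𝔼} {f : 𝔼 → ℝ≥0∞} {L : EReal}
    (h : Tendsto (compensatedPartial ε ν f) atTop (𝓝 L)) : CompensatedIntegralConverges ε ν f := by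
  rw [CompensatedIntegralConverges, compensatedIntegral_eq_of_tendsto h]
  exact h

/-- For a function supported in a ball there is nothing to compensate at infinity. -/
theorem tendsto_compensatedPartial_of_support {ε : ℝ} {ν : Measure 𝔼} {f : 𝔼 → ℝ≥0∞} {r : ℝ}
    (hf : ∀ x, r ≤ ‖x‖ → f x = 0) :
    Tendsto (compensatedPartial ε ν f) atTop
      (𝓝 (((∫⁻ x, f x ∂(contractedField ε ν) : ℝ≥0∞) : EReal) -
        ((ENNReal.ofReal ε * ∫⁻ x, f x : ℝ≥0∞) : EReal))) := by
  refine tendsto_const_nhds.congr' ?_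
  obtain ⟨N, hN⟩ := exists_nat_gt r
  filter_upwards [eventually_ge_atTop N] with n hn
  have hr : r ≤ n := hN.le.trans (by exact_mod_cast hn)
  have hsupp : Function.support f ⊆ Metric.ball 0 (n : ℝ) := fun x hx => by
    by_contra h
    exact hx (hf x (hr.trans (by simpa using h)))
  rw [compensatedPartial, setLIntegral_eq_of_support_subset hsupp,
    setLIntegral_eq_of_support_subset hsupp]

theorem smear_eq_zero {m : Measure 𝔼} {R r : ℝ} (hm : ∀ᵐ y ∂m, y ∈ Metric.closedBall 0 R)
    {κ : 𝔼 → ℝ} (hκ : ∀ z, r ≤ ‖z‖ → κ z = 0) {x : 𝔼} (hx : r + R ≤ ‖x‖) : smear m κ x = 0 := by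
  rw [smear, lintegral_congr_ae (g := fun _ => 0), lintegral_zero]
  filter_upwards [hm] with y hy
  rw [hκ, ENNReal.ofReal_zero]
  have h1 := norm_sub_norm_le x y
  rw [norm_sub_rev] at h1
  have h2 : ‖y‖ ≤ R := by simpa using hy
  linarith

theorem smear_add {m : Measure 𝔼} {κ κ' κ'' : 𝔼 → ℝ} (hκ : Measurable κ) (hκ0 : ∀ z, 0 ≤ κ z)
    (hκ'0 : ∀ z, 0 ≤ κ' z) (h : ∀ z, κ z + κ' z = κ'' z) (x : 𝔼) :
    smear m κ'' x = smear m κ x + smear m κ' x := by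
  rw [smear, smear, smear, ← lintegral_add_left (by fun_prop)]
  refine lintegral_congr fun y => ?_
  rw [← h, ENNReal.ofReal_add (hκ0 _) (hκ'0 _)]

theorem rieszKernel_nonneg (z : 𝔼) : 0 ≤ rieszKernel p z := by
  rw [rieszKernel_eq]; positivity

theorem measurable_rieszKernel : Measurable (rieszKernel (d := d) p) := by
  rw [rieszKernel_eq]; exact measurable_rpow_norm _

theorem farRiesz_le (hα : IsSmoothTruncation α) {l : ℝ} (hl : 0 < l) (z : 𝔼) :
    farRiesz α p l z ≤ ‖z‖ ^ (-p) :=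
  mul_le_of_le_one_right (by positivity) (by linarith [(truncation_mem_Icc hα hl.le z).1])

theorem nearRiesz_le (hα : IsSmoothTruncation α) {l : ℝ} (hl : 0 < l) (z : 𝔼) :
    nearRiesz α p l z ≤ ‖z‖ ^ (-p) :=
  mul_le_of_le_one_right (by positivity) (truncation_mem_Icc hα hl.le z).2

theorem farRiesz_le_cappedRiesz (hα : IsSmoothTruncation α) {l : ℝ} (hl : 0 < l) (z : 𝔼) :
    farRiesz α p l z ≤ cappedRiesz p l z := by
  rcases le_total ‖z‖ l with h | h
  · rw [farRiesz_eq_zero hα hl h]; exact cappedRiesz_nonneg hl.le z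
  · rw [cappedRiesz, max_eq_right h]; exact farRiesz_le hα hl z

theorem lintegral_ball_smear_farRiesz_ne_top (hα : IsSmoothTruncation α) (hp : 0 ≤ p) {l : ℝ}
    (hl : 0 < l) (m : Measure 𝔼) [IsFiniteMeasure m] {ν : Measure 𝔼} {n : ℝ}
    (hν : ν (Metric.ball 0 n) ≠ ⊤) :
    ∫⁻ x in Metric.ball 0 n, smear m (farRiesz α p l) x ∂ν ≠ ⊤ := by
  have h1 : ∀ x, smear m (farRiesz α p l) x ≤ ENNReal.ofReal (l ^ (-p)) * m univ := fun x => by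
    rw [smear, ← lintegral_const]
    exact lintegral_mono fun y => ENNReal.ofReal_le_ofReal
      ((farRiesz_le_cappedRiesz hα hl _).trans (cappedRiesz_le hl hp _))
  refine ne_top_of_le_ne_top ?_ (lintegral_mono h1)
  rw [lintegral_const, Measure.restrict_apply_univ]
  exact ENNReal.mul_ne_top (ENNReal.mul_ne_top ENNReal.ofReal_ne_top (measure_ne_top m _)) hν

/-- Decomposition of the compensated integral into its near and far parts, where the far part
has a real limit. -/
theorem zetaFun_eq_add (hα : IsSmoothTruncation α) (hp : 0 < p) (hpd : p < d) {R : ℝ} {D : Set 𝔼}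
    (hD : MeasurableSet D) (hDR : D ⊆ Metric.closedBall 0 R) {a ε : ℝ} (ha : 0 < a) (hε : 0 < ε)
    {ν : Measure 𝔼} (hν : ∀ n : ℕ, contractedField ε ν (Metric.ball 0 (n : ℝ)) < ⊤) {g : 𝔼 → ℝ}
    (hg : MemLp g 2 (volume.restrict D)) {z : ℝ}
    (hz : Tendsto (compensatedPartial ε ν (smearedKernel D (farKernel α p a ε) g)) atTop
      (𝓝 (z : EReal))) :
    zetaFun D p ε ν g = nearFun D α p a ε ν g + farFun D α p a ε ν g := by
  have hd : d ≠ 0 := by rintro rfl; simp at hpd; linarith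
  set l := a * lengthScale d p ε with hl
  have hl0 : 0 < l := mul_pos ha (lengthScale_pos hε)
  have := isFiniteMeasure_sqMeasure hg
  have hm : ∀ᵐ y ∂(sqMeasure D g), y ∈ Metric.closedBall 0 R := by
    filter_upwards [ae_mem_sqMeasure hD g] with y hy using hDR hy
  have hfm := measurable_farRiesz (d := d) (p := p) hα hl0.le
  have hnm := measurable_nearRiesz (d := d) (p := p) hα hl0.le
  rw [farFun, nearFun, zetaFun]
  rw [farKernel_eq hε, ← hl, smearedKernel_eq_smear hg hfm (farRiesz_nonneg hα hl0.le)] at hz ⊢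
  rw [nearKernel_eq hε, ← hl, smearedKernel_eq_smear hg hnm (nearRiesz_nonneg hα hl0.le),
    smearedKernel_eq_smear hg measurable_rieszKernel rieszKernel_nonneg]
  have hn := tendsto_compensatedPartial_of_support (ε := ε) (ν := ν)
    (f := smear (sqMeasure D g) (nearRiesz α p l)) (r := 3 * l + R)
    fun x hx => smear_eq_zero hm (fun z hz => nearRiesz_eq_zero hα hl0 hz) hx
  rw [compensatedIntegral_eq_of_tendsto hz, compensatedIntegral_eq_of_tendsto hn]
  refine compensatedIntegral_eq_of_tendsto ?_
  refine (tendsto_add_coe hn hz).congr fun n => ?_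
  have hadd : smear (sqMeasure D g) (rieszKernel p) =
      fun x => smear (sqMeasure D g) (nearRiesz α p l) x + smear (sqMeasure D g) (farRiesz α p l) x :=
    funext fun x => smear_add hnm (nearRiesz_nonneg hα hl0.le) (farRiesz_nonneg hα hl0.le)
      (fun z => by rw [nearRiesz_add_farRiesz, rieszKernel_eq]) x
  have f1 := lintegral_ball_smear_farRiesz_ne_top hα hp.le hl0 (sqMeasure D g) (hν n).ne
  have f2 := lintegral_ball_smear_ne_top hd hpd hm hfm (farRiesz_le hα hl0) n
  have f3 := lintegral_ball_smear_ne_top hd hpd hm hnm (nearRiesz_le hα hl0) n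
  have f4 := ENNReal.mul_ne_top ENNReal.ofReal_ne_top f2 (a := ENNReal.ofReal ε)
  have f5 := ENNReal.mul_ne_top ENNReal.ofReal_ne_top f3 (a := ENNReal.ofReal ε)
  simp only [compensatedPartial]
  rw [hadd, lintegral_add_left (measurable_smear _ hnm), lintegral_add_left (measurable_smear _ hnm),
    mul_add, ← ENNReal.ofReal_toReal f1, ← ENNReal.ofReal_toReal f4,
    coe_add_ofReal_sub_coe_add_ofReal _ f5 ENNReal.toReal_nonneg ENNReal.toReal_nonneg]
  congr 1
  rw [EReal.coe_sub, EReal.coe_ennreal_ofReal, EReal.coe_ennreal_ofReal,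
    max_eq_left ENNReal.toReal_nonneg, max_eq_left ENNReal.toReal_nonneg]

/-- The compensated integrals for a kernel that is the Riesz kernel or zero far from the origin
are well defined. -/
theorem ae_converges_of_expansion {Ω : Type*} [MeasurableSpace Ω] {P : Measure Ω}
    [IsProbabilityMeasure P] (hp0 : 0 < p) (hp : (d : ℝ) < 2 * p) (hpd : p < d)
    {N : Ω → Measure 𝔼} (hN : IsPoissonField P N) {R : ℝ} {D : Set 𝔼} (hD : MeasurableSet D)
    (hDR : D ⊆ Metric.closedBall 0 R) {ε : ℝ} (hε : 0 < ε) {κ : 𝔼 → ℝ} (hκ : Measurable κ)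
    (hκ0 : ∀ z, 0 ≤ κ z) (hκp : ∀ z, κ z ≤ ‖z‖ ^ (-p))
    (hexp : ∃ (N : ℕ) (ι : Type) (_ : Fintype ι) (φ c : ι → 𝔼 → ℝ) (e : 𝔼 → ℝ) (C s : ℝ),
      KernelExpansion (Metric.closedBall 0 R) p κ N φ c e C s) :
    (∀ᵐ w ∂P, ∀ g ∈ sobolevSphere D,
        CompensatedIntegralConverges ε (N w) (smearedKernel D κ g)) ∧
      ∀ g ∈ sobolevSphere D, ∀ᵐ w ∂P,
        compensatedIntegral ε (N w) (smearedKernel D κ g) ≠ ⊥ ∧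
          compensatedIntegral ε (N w) (smearedKernel D κ g) ≠ ⊤ := by
  have hd : d ≠ 0 := by rintro rfl; simp at hpd; linarith
  have hM := isPoissonMeasure_contractedField hd hN hε
  obtain ⟨n₀, ι, _, φ, c, e, C, s, h⟩ := hexp
  have key := h.ae_forall_tendsto hε.le hM hp0 hp hpd hκ hκ0 hκp
  have hm : ∀ g, ∀ᵐ y ∂(sqMeasure D g), y ∈ Metric.closedBall 0 R := fun g => by
    filter_upwards [ae_mem_sqMeasure hD g] with y hy using hDR hy
  refine ⟨?_, fun g hg => ?_⟩
  · filter_upwards [key] with w hw g hg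
    have hg2 := memLp_of_mem_sobolevSphere hg
    obtain ⟨z, -, hz⟩ := hw (sqMeasure D g) (isFiniteMeasure_sqMeasure hg2) (hm g)
    rw [smearedKernel_eq_smear hg2 hκ hκ0]
    exact compensatedIntegralConverges_of_tendsto hz
  · have hg2 := memLp_of_mem_sobolevSphere hg
    have := isFiniteMeasure_sqMeasure hg2
    have := sigmaFinite_smul_volume (d := d) ε
    have hfin := lintegral_ball_smear_ne_top hd hpd (hm g) hκ hκp n₀
    have hae := hM.ae_lintegral_lt_top
      (f := (Metric.ball 0 (n₀ : ℝ)).indicator (smear (sqMeasure D g) κ))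
      ((measurable_smear _ hκ).indicator measurableSet_ball) (by
        rw [lintegral_indicator measurableSet_ball, Measure.restrict_smul, lintegral_smul_measure]
        exact ENNReal.mul_ne_top ENNReal.ofReal_ne_top hfin)
    filter_upwards [key, hae] with w hw hw2
    rw [lintegral_indicator measurableSet_ball] at hw2
    obtain ⟨z, -, hz⟩ := hw (sqMeasure D g) (isFiniteMeasure_sqMeasure hg2) (hm g)
    rw [smearedKernel_eq_smear hg2 hκ hκ0, compensatedIntegral_eq_of_tendsto hz,
      ← ENNReal.ofReal_toReal hw2.ne,
      ← ENNReal.ofReal_toReal (ENNReal.mul_ne_top ENNReal.ofReal_ne_top hfin (a := ENNReal.ofReal ε)),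
      EReal.coe_ennreal_ofReal, EReal.coe_ennreal_ofReal, max_eq_left ENNReal.toReal_nonneg,
      max_eq_left ENNReal.toReal_nonneg, ← EReal.coe_sub, ← EReal.coe_add]
    exact ⟨EReal.coe_ne_bot _, EReal.coe_ne_top _⟩

/-- Expansion of a kernel of bounded support. -/
theorem exists_kernelExpansion_of_eq_zero {R : ℝ} {κ : 𝔼 → ℝ} {r : ℝ}
    (hκ : ∀ z, r ≤ ‖z‖ → κ z = 0) :
    ∃ (N : ℕ) (ι : Type) (_ : Fintype ι) (φ c : ι → 𝔼 → ℝ) (e : 𝔼 → ℝ) (C s : ℝ),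
      KernelExpansion (Metric.closedBall 0 R) p κ N φ c e C s := by
  obtain ⟨N, hN⟩ := exists_nat_gt (r + R)
  refine ⟨N, Empty, inferInstance, fun i => i.elim, fun i => i.elim, fun _ => 0, 0, 1, one_pos,
    le_rfl, fun i => i.elim, fun i => i.elim, fun i => i.elim, fun i => i.elim, fun i => i.elim,
    measurable_const, fun _ => le_rfl, fun x => by simp, integrable_zero _ _ _, fun x hx y hy => ?_⟩
  have hy' : ‖y‖ ≤ R := by simpa using hy
  have hx' : (N : ℝ) ≤ ‖x‖ := by simpa using hx
  rw [hκ]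
  · simp
  · have := norm_sub_norm_le x y
    rw [norm_sub_rev] at this
    linarith

/-- The three compensated integrals are almost surely well defined for all `g` at once, and almost
surely finite for each `g`. -/
theorem ae_wellDefined {Ω : Type*} [MeasurableSpace Ω] {P : Measure Ω}
    [IsProbabilityMeasure P] (hp0 : 0 < p) (hp : (d : ℝ) < 2 * p) (hpd : p < d)
    {N : Ω → Measure 𝔼} (hN : IsPoissonField P N) {D : Set 𝔼} (hD : MeasurableSet D) {R : ℝ}
    (hR : 0 ≤ R) (hDR : D ⊆ Metric.closedBall 0 R) (hα : IsSmoothTruncation α) {a ε : ℝ}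
    (ha : 0 < a) (hε : 0 < ε) :
    (∀ᵐ w ∂P, ∀ g ∈ sobolevSphere D,
        CompensatedIntegralConverges ε (N w) (smearedKernel D (rieszKernel p) g) ∧
        CompensatedIntegralConverges ε (N w) (smearedKernel D (nearKernel α p a ε) g) ∧
        CompensatedIntegralConverges ε (N w) (smearedKernel D (farKernel α p a ε) g)) ∧
      (∀ g ∈ sobolevSphere D, ∀ᵐ w ∂P,
        (zetaFun D p ε (N w) g ≠ ⊥ ∧ zetaFun D p ε (N w) g ≠ ⊤) ∧
        (nearFun D α p a ε (N w) g ≠ ⊥ ∧ nearFun D α p a ε (N w) g ≠ ⊤) ∧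
        (farFun D α p a ε (N w) g ≠ ⊥ ∧ farFun D α p a ε (N w) g ≠ ⊤)) := by
  have hl0 : 0 < a * lengthScale d p ε := mul_pos ha (lengthScale_pos hε)
  have h1 := ae_converges_of_expansion hp0 hp hpd hN hD hDR hε measurable_rieszKernel
    rieszKernel_nonneg (fun z => (congrFun (rieszKernel_eq p) z).le)
    (exists_kernelExpansion_of_eq_riesz hp0 hR (r := 0) fun z _ => congrFun (rieszKernel_eq p) z)
  have h2 := ae_converges_of_expansion hp0 hp hpd hN hD hDR hε (measurable_nearRiesz hα hl0.le)
    (nearRiesz_nonneg hα hl0.le) (nearRiesz_le hα hl0)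
    (exists_kernelExpansion_of_eq_zero fun z hz => nearRiesz_eq_zero hα hl0 hz)
  have h3 := ae_converges_of_expansion hp0 hp hpd hN hD hDR hε (measurable_farRiesz hα hl0.le)
    (farRiesz_nonneg hα hl0.le) (farRiesz_le hα hl0)
    (exists_kernelExpansion_of_eq_riesz hp0 hR fun z hz => farRiesz_eq hα hl0 hz)
  rw [← nearKernel_eq hε] at h2
  rw [← farKernel_eq hε] at h3
  refine ⟨?_, fun g hg => ?_⟩
  · filter_upwards [h1.1, h2.1, h3.1] with w w1 w2 w3 g hg
    exact ⟨w1 g hg, w2 g hg, w3 g hg⟩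
  · filter_upwards [h1.2 g hg, h2.2 g hg, h3.2 g hg] with w w1 w2 w3
    exact ⟨w1, w2, w3⟩

end WellDefined

/-! ### The far kernel -/

section Far

variable {d : ℕ} {p : ℝ} {α : ℝ → ℝ}

local notation "𝔼" => EuclideanSpace ℝ (Fin d)

/-- The large deviation speed `ε^{-2/(d-p)}`, the expected number of obstacles in a cube of side
`lengthScale d p ε`. -/
noncomputable def speed (d : ℕ) (p ε : ℝ) : ℝ :=
  ε ^ (-(2 / ((d : ℝ) - p)))

theorem speed_pos {ε : ℝ} (hε : 0 < ε) : 0 < speed d p ε := Real.rpow_pos_of_pos hε _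

/-- `ε ρ^d = n`. -/
theorem mul_lengthScale_rpow (hd : d ≠ 0) (hpd : p < d) {ε : ℝ} (hε : 0 < ε) :
    ε * lengthScale d p ε ^ (d : ℝ) = speed d p ε := by
  have hd' : (d : ℝ) ≠ 0 := by exact_mod_cast hd
  have hdp : (d : ℝ) - p ≠ 0 := by linarith
  rw [lengthScale, speed, ← Real.rpow_mul hε.le]
  nth_rewrite 1 [← Real.rpow_one ε]
  rw [← Real.rpow_add hε]
  congr 1
  field_simp
  ring

theorem deviationLevel_eq (hd : d ≠ 0) (hpd : p < d) (γ : ℝ) {ε : ℝ} (hε : 0 < ε) :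
    deviationLevel d p γ ε = γ * (speed d p ε * lengthScale d p ε ^ (-p)) := by
  have hd' : (d : ℝ) ≠ 0 := by exact_mod_cast hd
  have hdp : (d : ℝ) - p ≠ 0 := by linarith
  rw [deviationLevel, lengthScale, speed, ← Real.rpow_mul hε.le, ← Real.rpow_add hε]
  congr 2
  field_simp
  ring

theorem tendsto_speed (hpd : p < d) : Tendsto (speed d p) (𝓝[>] 0) atTop := by
  have hdp : 0 < (d : ℝ) - p := by linarith
  exact tendsto_rpow_neg_nhdsGT_zero (neg_neg_of_pos (by positivity))

theorem tendsto_lengthScale (hd : d ≠ 0) (hpd : p < d) :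
    Tendsto (lengthScale d p) (𝓝[>] 0) atTop := by
  have hdp : 0 < (d : ℝ) - p := by linarith
  have hd' : 0 < (d : ℝ) := by positivity
  exact tendsto_rpow_neg_nhdsGT_zero (neg_neg_of_pos (div_pos (by linarith) (by positivity)))

theorem abs_rpow_neg_sub_le (hp : 0 ≤ p) {l s t : ℝ} (hl : 0 < l) (hs : l ≤ s) (ht : l ≤ t) :
    |s ^ (-p) - t ^ (-p)| ≤ p * l ^ (-p - 1) * |s - t| := by
  have h := (convex_Ici l).norm_image_sub_le_of_norm_hasDerivWithin_le (f := fun x : ℝ => x ^ (-p))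
    (f' := fun x => -p * x ^ (-p - 1)) (C := p * l ^ (-p - 1)) (fun x hx => ?_) (fun x hx => ?_)
    (show t ∈ Ici l from ht) (show s ∈ Ici l from hs)
  · simpa [Real.norm_eq_abs] using h
  · exact (Real.hasDerivAt_rpow_const (Or.inl (hl.trans_le hx).ne')).hasDerivWithinAt
  · rw [norm_mul, norm_neg, Real.norm_of_nonneg hp,
      Real.norm_of_nonneg (Real.rpow_nonneg (hl.le.trans hx) _)]
    exact mul_le_mul_of_nonneg_left (Real.rpow_le_rpow_of_nonpos hl hx (by linarith)) hp

/-- The far kernel is Lipschitz, with a constant that decays faster than its size. -/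
theorem abs_farRiesz_sub_le (hα : IsSmoothTruncation α) (hp : 0 ≤ p) {l : ℝ} (hl : 0 < l)
    (x y : 𝔼) :
    |farRiesz α p l x - farRiesz α p l y| ≤ (p + 1) * l ^ (-p - 1) * ‖x - y‖ := by
  -- the radial profile only depends on the radius through its maximum with `l`
  set h : ℝ → ℝ := fun t => (max t l) ^ (-p) * (1 - α (l⁻¹ * max t l)) with hh
  have hfar : ∀ z : 𝔼, farRiesz α p l z = h ‖z‖ := by
    intro z
    rcases le_total ‖z‖ l with hz | hz
    · rw [farRiesz_eq_zero hα hl hz, hh]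
      simp only
      rw [max_eq_right hz, inv_mul_cancel₀ hl.ne', hα.eq_one 1 ⟨zero_le_one, le_rfl⟩]
      simp
    · rw [hh]; simp only; rw [max_eq_left hz, farRiesz]
  have hmax : ∀ s t : ℝ, |max s l - max t l| ≤ |s - t| := fun s t => abs_max_sub_max_le_abs s t l
  have key : ∀ s t : ℝ, l ≤ s → l ≤ t → |s ^ (-p) * (1 - α (l⁻¹ * s)) - t ^ (-p) * (1 - α (l⁻¹ * t))|
      ≤ (p + 1) * l ^ (-p - 1) * |s - t| := by
    intro s t hs ht
    have hs0 : 0 ≤ l⁻¹ * s := mul_nonneg (by positivity) (hl.le.trans hs)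
    have ht0 : 0 ≤ l⁻¹ * t := mul_nonneg (by positivity) (hl.le.trans ht)
    have e : s ^ (-p) * (1 - α (l⁻¹ * s)) - t ^ (-p) * (1 - α (l⁻¹ * t)) =
        (s ^ (-p) - t ^ (-p)) * (1 - α (l⁻¹ * s)) + t ^ (-p) * (α (l⁻¹ * t) - α (l⁻¹ * s)) := by
      ring
    have h1 : |1 - α (l⁻¹ * s)| ≤ 1 := by
      have := hα.mem_Icc _ hs0
      rw [abs_of_nonneg (by linarith [this.2])]
      linarith [this.1]
    have h2 : |α (l⁻¹ * t) - α (l⁻¹ * s)| ≤ l⁻¹ * |s - t| := by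
      refine (hα.abs_sub_le ht0 hs0).trans_eq ?_
      rw [← mul_sub, abs_mul, abs_of_pos (inv_pos.2 hl), abs_sub_comm]
    have h3 : |t ^ (-p)| ≤ l ^ (-p) := by
      rw [abs_of_nonneg (Real.rpow_nonneg (hl.le.trans ht) _)]
      exact Real.rpow_le_rpow_of_nonpos hl ht (by linarith)
    rw [e]
    refine (abs_add_le _ _).trans ?_
    rw [abs_mul, abs_mul]
    calc _ ≤ (p * l ^ (-p - 1) * |s - t|) * 1 + l ^ (-p) * (l⁻¹ * |s - t|) := by
          gcongr
          exact abs_rpow_neg_sub_le hp hl hs ht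
      _ = _ := by rw [Real.rpow_sub_one hl.ne']; ring
  rw [hfar, hfar]
  refine (key _ _ (le_max_right _ _) (le_max_right _ _)).trans ?_
  exact mul_le_mul_of_nonneg_left ((hmax _ _).trans (abs_norm_sub_norm_le x y)) (by positivity)

/-- Expansion of the far kernel, valid everywhere, with a number of terms and constants that do not
depend on the truncation radius `l`. The error has a compensator of order `l^{d-p-1}`, which is
smaller than the typical size `l^{d-p}` by the factor `1/l`. -/
theorem exists_farRiesz_expansion (hα : IsSmoothTruncation α) (hd : d ≠ 0) (hp : 0 < p) {R : ℝ}
    (hR : 0 ≤ R) :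
    ∃ (ι : Type) (_ : Fintype ι) (C l₀ : ℝ), 0 ≤ C ∧ 0 < l₀ ∧ ∀ l, l₀ ≤ l →
      ∃ (φ c : ι → 𝔼 → ℝ) (e : 𝔼 → ℝ),
        KernelExpansion (Metric.closedBall 0 R) p (farRiesz α p l) 0 φ c e C l ∧
        ∫ x, e x ≤ C * l ^ ((d : ℝ) - 1 - p) := by
  obtain ⟨ι, hι, φ, c, C, r₀, hC, hr₀, h1, h2, h3, h4, h5⟩ := exists_riesz_expansion (d := d) p hR d
  set I : ℝ := ∫ x : 𝔼, cappedRiesz (p + d) 1 x with hI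
  have hI0 : 0 ≤ I := integral_nonneg fun x => cappedRiesz_nonneg zero_le_one x
  set C₁ := (p + 1) * R * 4 ^ p with hC₁
  have hC₁0 : 0 ≤ C₁ := by positivity
  set C₂ := ((p + 1) * R * 4 ^ (p + d) + C) * I with hC₂
  have hC₂0 : 0 ≤ C₂ := by positivity
  have hd1 : (1 : ℝ) ≤ d := by exact_mod_cast Nat.one_le_iff_ne_zero.2 hd
  refine ⟨Option ι, inferInstance, 1 + C + C₁ + C₂, r₀ + R, by positivity, by positivity,
    fun l hl => ?_⟩
  have hl0 : 0 < l := by linarith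
  have hl1 : 1 ≤ l := by linarith
  -- on the ball of radius `4 l`, beyond which the far kernel at `y - x` is the Riesz kernel, the
  -- kernel is approximated by its value at `y = 0`
  set A : Set 𝔼 := Metric.ball 0 (4 * l) with hA
  have hAm : MeasurableSet A := measurableSet_ball
  have hAmem : ∀ {x : 𝔼}, x ∈ A → ‖x‖ < 4 * l := fun {x} hx => by simpa [hA] using hx
  have hAc : ∀ {x : 𝔼}, x ∉ A → 4 * l ≤ ‖x‖ := fun {x} hx => by simpa [hA] using hx
  have hcapA : ∀ {q : ℝ} {x : 𝔼}, 0 ≤ q → x ∈ A → 1 ≤ 4 ^ q * l ^ q * cappedRiesz q l x := by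
    intro q x hq hx
    have h6 : (4 * l) ^ (-q) ≤ cappedRiesz q l x :=
      Real.rpow_le_rpow_of_nonpos (lt_max_of_lt_left hl0)
        (max_le (by linarith) (hAmem hx).le) (by linarith)
    rw [Real.mul_rpow (by norm_num) hl0.le, Real.rpow_neg (by norm_num), Real.rpow_neg hl0.le] at h6
    calc (1 : ℝ) = 4 ^ q * l ^ q * ((4 ^ q)⁻¹ * (l ^ q)⁻¹) := by field_simp
      _ ≤ _ := by gcongr
  have hcapAc : ∀ {q : ℝ} {x : 𝔼}, x ∉ A → cappedRiesz q l x = ‖x‖ ^ (-q) := by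
    intro q x hx
    rw [cappedRiesz, max_eq_right (by linarith [hAc hx])]
  set e : 𝔼 → ℝ := fun x =>
    A.indicator (fun _ => (p + 1) * l ^ (-p - 1) * R) x + Aᶜ.indicator (fun x => C * ‖x‖ ^ (-(p + d))) x
    with he
  have heA : ∀ {x}, x ∈ A → e x = (p + 1) * l ^ (-p - 1) * R := fun {x} hx => by
    simp [he, hx]
  have heAc : ∀ {x}, x ∉ A → e x = C * ‖x‖ ^ (-(p + d)) := fun {x} hx => by
    simp [he, hx]
  have hem : Measurable e := (measurable_const.indicator hAm).add
    (((measurable_rpow_norm _).const_mul C).indicator hAm.compl)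
  have he0 : ∀ x, 0 ≤ e x := fun x => by
    by_cases hx : x ∈ A
    · rw [heA hx]; positivity
    · rw [heAc hx]; positivity
  have he2 : ∀ x, e x ≤ ((p + 1) * R * 4 ^ (p + d) + C) * l ^ ((d : ℝ) - 1) *
      cappedRiesz (p + d) l x := fun x => by
    have hcap0 := cappedRiesz_nonneg (p := p + d) hl0.le x
    have hld : 1 ≤ l ^ ((d : ℝ) - 1) := Real.one_le_rpow hl1 (by linarith)
    by_cases hx : x ∈ A
    · rw [heA hx]
      have h7 := hcapA (q := p + d) (by positivity) hx
      calc (p + 1) * l ^ (-p - 1) * R = (p + 1) * R * l ^ (-p - 1) * 1 := by ring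
        _ ≤ (p + 1) * R * l ^ (-p - 1) * (4 ^ (p + d) * l ^ (p + d) * cappedRiesz (p + d) l x) := by
          gcongr
        _ = (p + 1) * R * 4 ^ (p + d) * l ^ ((d : ℝ) - 1) * cappedRiesz (p + d) l x := by
          have : l ^ ((d : ℝ) - 1) = l ^ (-p - 1) * l ^ (p + d) := by
            rw [← Real.rpow_add hl0]; congr 1; ring
          rw [this]; ring
        _ ≤ _ := by gcongr; linarith
    · rw [heAc hx, hcapAc hx]
      have : (0 : ℝ) ≤ ‖x‖ ^ (-(p + d)) := by positivity
      refine mul_le_mul_of_nonneg_right ?_ this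
      calc C = C * 1 := (mul_one C).symm
        _ ≤ C * l ^ ((d : ℝ) - 1) := by gcongr
        _ ≤ _ := by
          refine mul_le_mul_of_nonneg_right ?_ (by positivity)
          have : 0 ≤ (p + 1) * R * 4 ^ (p + d) := by positivity
          linarith
  have hei : Integrable (fun x : 𝔼 => ((p + 1) * R * 4 ^ (p + d) + C) * l ^ ((d : ℝ) - 1) *
      cappedRiesz (p + d) l x) :=
    (integrable_cappedRiesz (by linarith) hl0).const_mul _
  refine ⟨fun i => i.elim (fun _ => 1) φ,
    fun i => i.elim (A.indicator (farRiesz α p l)) fun i => Aᶜ.indicator (c i), e,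
    ⟨hl0, by positivity, ?_, ?_, ?_, ?_, ?_, hem, he0, fun x => ?_, ?_, ?_⟩, ?_⟩
  · rintro (_ | i)
    · exact measurable_const
    · exact h1 i
  · rintro (_ | i) y hy
    · simp only [Option.elim, abs_one]; linarith
    · exact (h3 i y (by simpa using hy)).trans (by linarith)
  · rintro (_ | i)
    · exact (measurable_farRiesz hα hl0.le).indicator hAm
    · exact (h2 i).indicator hAm.compl
  · have hcap0 : ∀ x : 𝔼, 0 ≤ cappedRiesz p l x := fun x => cappedRiesz_nonneg hl0.le x
    rintro (_ | i) x
    · simp only [Option.elim]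
      refine le_trans ?_ (le_mul_of_one_le_left (hcap0 x) (by linarith))
      by_cases hx : x ∈ A
      · rw [indicator_of_mem hx, abs_of_nonneg (farRiesz_nonneg hα hl0.le x)]
        exact farRiesz_le_cappedRiesz hα hl0 x
      · rw [indicator_of_notMem hx, abs_zero]; exact hcap0 x
    · simp only [Option.elim]
      refine le_trans ?_ (mul_le_mul_of_nonneg_right (show C ≤ _ by linarith) (hcap0 x))
      by_cases hx : x ∈ A
      · rw [indicator_of_notMem (not_not.2 hx), abs_zero]; exact mul_nonneg hC (hcap0 x)
      · rw [indicator_of_mem (mem_compl hx), hcapAc hx]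
        exact h4 i x (by linarith [hAc hx])
  · intro i x hx; simp at hx
  · have hcap0 := cappedRiesz_nonneg (p := p) hl0.le x
    by_cases hx : x ∈ A
    · rw [heA hx]
      have h7 := hcapA (q := p) hp.le hx
      have h8 : l ^ (-p - 1) ≤ l ^ (-p) := Real.rpow_le_rpow_of_exponent_le hl1 (by linarith)
      calc (p + 1) * l ^ (-p - 1) * R ≤ (p + 1) * l ^ (-p) * R := by gcongr
        _ = (p + 1) * R * l ^ (-p) * 1 := by ring
        _ ≤ (p + 1) * R * l ^ (-p) * (4 ^ p * l ^ p * cappedRiesz p l x) := by gcongr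
        _ = C₁ * cappedRiesz p l x := by
          rw [Real.rpow_neg hl0.le, hC₁]; field_simp
        _ ≤ _ := by gcongr; linarith
    · rw [heAc hx, hcapAc hx]
      refine mul_le_mul (by linarith) ?_ (by positivity) (by positivity)
      exact Real.rpow_le_rpow_of_exponent_le (by linarith [hAc hx]) (by linarith)
  · refine hei.mono' hem.aestronglyMeasurable (ae_of_all _ fun x => ?_)
    rw [Real.norm_of_nonneg (he0 x)]
    exact he2 x
  · intro x _ y hy
    have hy' : ‖y‖ ≤ R := by simpa using hy
    rw [Fintype.sum_option]
    simp only [Option.elim, one_mul]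
    by_cases hx : x ∈ A
    · simp only [indicator_of_mem hx, indicator_of_notMem (show x ∉ Aᶜ from not_not.2 hx), mul_zero,
        Finset.sum_const_zero, add_zero]
      have hsymm : farRiesz α p l x = farRiesz α p l (-x) := by simp [farRiesz]
      rw [heA hx, hsymm]
      refine (abs_farRiesz_sub_le hα hp.le hl0 _ _).trans ?_
      rw [sub_neg_eq_add, sub_add_cancel]
      exact mul_le_mul_of_nonneg_left hy' (by positivity)
    · simp only [indicator_of_notMem hx, indicator_of_mem (mem_compl hx), zero_add]
      rw [heAc hx, farRiesz_eq hα hl0]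
      · exact h5 y x hy' (by linarith [hAc hx])
      · have := norm_sub_norm_le x y
        rw [norm_sub_rev] at this
        linarith [hAc hx]
  · refine (integral_mono_of_nonneg (ae_of_all _ he0) hei (ae_of_all _ he2)).trans ?_
    rw [integral_const_mul, integral_cappedRiesz hl0, ← hI]
    have : l ^ ((d : ℝ) - 1) * l ^ ((d : ℝ) - (p + d)) = l ^ ((d : ℝ) - 1 - p) := by
      rw [← Real.rpow_add hl0]; congr 1; ring
    calc _ = C₂ * (l ^ ((d : ℝ) - 1) * l ^ ((d : ℝ) - (p + d))) := by rw [hC₂]; ring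
      _ ≤ _ := by rw [this]; gcongr; linarith

end Far

section FarTail

variable {d : ℕ} {p : ℝ} {α : ℝ → ℝ}

local notation "𝔼" => EuclideanSpace ℝ (Fin d)

/-- Outside an event of probability `exp (-B n)`, with `B` as large as desired if the truncation
radius `a` is large, all far parts are smaller than the deviation level. -/
theorem eventually_exists_far_exceptional {Ω : Type*} [MeasurableSpace Ω] {P : Measure Ω}
    [IsProbabilityMeasure P] (hp0 : 0 < p) (hp : (d : ℝ) < 2 * p) (hpd : p < d)
    {N : Ω → Measure 𝔼} (hN : IsPoissonField P N) {D : Set 𝔼} (hD : MeasurableSet D) {R : ℝ}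
    (hR : 0 ≤ R) (hDR : D ⊆ Metric.closedBall 0 R) (hα : IsSmoothTruncation α) {γ B : ℝ}
    (hγ : 0 < γ) (hB : 0 ≤ B) :
    ∀ᶠ a in atTop, ∀ᶠ ε in 𝓝[>] (0 : ℝ), ∃ S : Set Ω,
      P S ≤ ENNReal.ofReal (rexp (-B * speed d p ε)) ∧
      ∀ w ∉ S, (∀ n : ℕ, contractedField ε (N w) (Metric.ball 0 (n : ℝ)) < ⊤) ∧
        ∃ b < deviationLevel d p γ ε, ∀ g ∈ sobolevSphere D, ∃ z : ℝ, |z| ≤ b ∧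
          Tendsto (compensatedPartial ε (N w) (smearedKernel D (farKernel α p a ε) g)) atTop
            (𝓝 (z : EReal)) := by
  have hd : d ≠ 0 := by rintro rfl; simp at hpd; linarith
  obtain ⟨ι, _, C, l₀, hC, hl₀, hexp⟩ := exists_farRiesz_expansion (p := p) hα hd hp0 hR
  set I : ℝ := ∫ x : 𝔼, cappedRiesz (2 * p) 1 x with hI
  have hI0 : 0 ≤ I := integral_nonneg fun x => cappedRiesz_nonneg zero_le_one x
  set k : ℝ := (Fintype.card ι : ℝ) with hk
  have hk0 : 0 ≤ k := Nat.cast_nonneg _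
  -- `δ` is the share of the level granted to each of the `k + 1` functions; with `lam * δ = B + 2`
  -- Chernoff's bound gives `exp (-(B + 1) n)`, as its quadratic term is at most `n` for large `a`,
  -- and the remaining factor `exp (-n)` pays for the number of functions
  set δ : ℝ := γ / (4 * (C + 1) * (k + 1)) with hδ
  have hδ0 : 0 < δ := by positivity
  have hδ1 : C * (k * δ) + δ ≤ γ / 2 := by
    have e1 : (C + 1) * (k + 1) * δ = γ / 4 := by rw [hδ]; field_simp
    nlinarith [mul_nonneg hC hk0, mul_nonneg hC hδ0.le, mul_nonneg hk0 hδ0.le]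
  set lam : ℝ := (B + 2) / δ with hlam
  have hlam0 : 0 < lam := by positivity
  have hlamδ : lam * δ = B + 2 := by rw [hlam]; field_simp
  have hlim : Tendsto (fun a : ℝ => lam ^ 2 * rexp (lam * C) * (C ^ 2 * I) * a ^ (-(2 * p - d)))
      atTop (𝓝 (lam ^ 2 * rexp (lam * C) * (C ^ 2 * I) * 0)) :=
    (tendsto_rpow_neg_atTop (by linarith)).const_mul _
  rw [mul_zero] at hlim
  filter_upwards [hlim.eventually (ge_mem_nhds one_pos), eventually_ge_atTop 1] with a ha1 ha2
  have ha0 : 0 < a := by linarith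
  have hρ := tendsto_lengthScale (p := p) hd hpd
  filter_upwards [self_mem_nhdsWithin, hρ.eventually_ge_atTop (l₀ / a),
    hρ.eventually_gt_atTop (4 * C * a ^ ((d : ℝ) - 1 - p) / γ),
    (tendsto_exp_atTop.comp (tendsto_speed hpd)).eventually_ge_atTop (2 * (k + 1))]
    with ε hε h1 h2 h3
  have hε0 : 0 < ε := hε
  set ρ := lengthScale d p ε with hρdef
  set n := speed d p ε with hn
  have hρ0 : 0 < ρ := lengthScale_pos hε0
  have hn0 : 0 < n := speed_pos hε0
  set l := a * ρ with hl
  have hl0 : 0 < l := mul_pos ha0 hρ0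
  obtain ⟨φ, c, e, h, he⟩ := hexp l (by rw [div_le_iff₀ ha0] at h1; rw [hl]; linarith)
  have hM := isPoissonMeasure_contractedField hd hN hε0
  set M := fun w => contractedField ε (N w) with hMdef
  set μ : Measure 𝔼 := ENNReal.ofReal ε • volume with hμ
  set lev := n * ρ ^ (-p) with hlev
  have hlev0 : 0 < lev := by positivity
  have hnρ : ε * ρ ^ (d : ℝ) = n := mul_lengthScale_rpow hd hpd hε0
  -- the compensator of the error is smaller than the level by the factor `1 / ρ`
  have hcomp : 2 * (ε * ∫ x, e x) < γ / 2 * lev := by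
    have e1 : ε * (C * l ^ ((d : ℝ) - 1 - p)) = C * a ^ ((d : ℝ) - 1 - p) * ρ⁻¹ * lev := by
      have : ρ ^ ((d : ℝ) - 1 - p) = ρ ^ (d : ℝ) * ρ⁻¹ * ρ ^ (-p) := by
        rw [← Real.rpow_neg_one, ← Real.rpow_add hρ0, ← Real.rpow_add hρ0]; congr 1
      rw [hl, Real.mul_rpow ha0.le hρ0.le, this, hlev, ← hnρ]
      ring
    have e2 : ε * ∫ x, e x ≤ C * a ^ ((d : ℝ) - 1 - p) * ρ⁻¹ * lev := by
      rw [← e1]; exact mul_le_mul_of_nonneg_left he hε0.le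
    have e3 : 2 * (C * a ^ ((d : ℝ) - 1 - p) * ρ⁻¹) < γ / 2 := by
      rw [div_lt_iff₀ hγ] at h2
      rw [← div_eq_mul_inv, ← mul_div_assoc, div_lt_iff₀ hρ0]
      linarith
    calc 2 * (ε * ∫ x, e x) ≤ 2 * (C * a ^ ((d : ℝ) - 1 - p) * ρ⁻¹) * lev := by linarith
      _ < _ := mul_lt_mul_of_pos_right e3 hlev0
  -- the tail of each coefficient
  have htail : ∀ f : 𝔼 → ℝ, Measurable f → (∀ x, |f x| ≤ C * cappedRiesz p l x) →
      P {w | δ * lev < |compLim M μ f w|} ≤ ENNReal.ofReal (2 * rexp (-(B + 1) * n)) := by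
    intro f hf hfC
    refine (measure_lt_abs_compLim_of_le_cappedRiesz hε0.le hM hf hl0 hp0.le hp hC hfC
      (t := lam * ρ ^ p) (by positivity) (δ * lev)).trans (ENNReal.ofReal_le_ofReal ?_)
    refine mul_le_mul_of_nonneg_left (Real.exp_le_exp.2 ?_) (by norm_num)
    have hρp : ρ ^ p * ρ ^ (-p) = 1 := by rw [← Real.rpow_add hρ0, add_neg_cancel, Real.rpow_zero]
    have e1 : lam * ρ ^ p * (δ * lev) = (B + 2) * n := by
      rw [← hlamδ, hlev]
      calc _ = lam * δ * n * (ρ ^ p * ρ ^ (-p)) := by ring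
        _ = _ := by rw [hρp, mul_one]
    have e2 : lam * ρ ^ p * (C * l ^ (-p)) ≤ lam * C := by
      rw [hl, Real.mul_rpow ha0.le hρ0.le]
      have : a ^ (-p) ≤ 1 := Real.rpow_le_one_of_one_le_of_nonpos ha2 (by linarith)
      calc _ = lam * C * a ^ (-p) * (ρ ^ p * ρ ^ (-p)) := by ring
        _ ≤ lam * C * 1 * 1 := by rw [hρp]; gcongr
        _ = _ := by ring
    have e3 : (lam * ρ ^ p) ^ 2 * (ε * C ^ 2 * l ^ ((d : ℝ) - 2 * p) * I) =
        lam ^ 2 * (C ^ 2 * I) * a ^ (-(2 * p - d)) * n := by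
      have : ρ ^ (d : ℝ) = (ρ ^ p) ^ 2 * ρ ^ ((d : ℝ) - 2 * p) := by
        rw [← Real.rpow_natCast, ← Real.rpow_mul hρ0.le, ← Real.rpow_add hρ0]
        congr 1; push_cast; ring
      rw [hl, Real.mul_rpow ha0.le hρ0.le, ← hnρ, this, neg_sub]
      ring
    have e4 : (lam * ρ ^ p) ^ 2 * rexp (lam * ρ ^ p * (C * l ^ (-p))) *
        (ε * C ^ 2 * l ^ ((d : ℝ) - 2 * p) * I) ≤ n := by
      calc _ ≤ (lam * ρ ^ p) ^ 2 * rexp (lam * C) * (ε * C ^ 2 * l ^ ((d : ℝ) - 2 * p) * I) := by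
            gcongr
        _ = rexp (lam * C) * ((lam * ρ ^ p) ^ 2 * (ε * C ^ 2 * l ^ ((d : ℝ) - 2 * p) * I)) := by
            ring
        _ = (lam ^ 2 * rexp (lam * C) * (C ^ 2 * I) * a ^ (-(2 * p - d))) * n := by rw [e3]; ring
        _ ≤ 1 * n := by gcongr
        _ = n := one_mul n
    rw [e1]
    linarith
  have hball : ∀ᵐ w ∂P, ∀ n : ℕ, M w (Metric.ball 0 (n : ℝ)) < ⊤ :=
    ae_all_iff.2 fun n => hM.ae_lt_top measurableSet_ball (smul_volume_ball_ne_top ε n)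
  have hconv := h.ae_forall_tendsto hε0.le hM hp0 hp hpd (measurable_farRiesz hα hl0.le)
    (farRiesz_nonneg hα hl0.le) (farRiesz_le hα hl0)
  -- the exceptional event is the failure of the claim, so that no measurability is needed
  set S : Set Ω := {w | ¬ ((∀ n : ℕ, contractedField ε (N w) (Metric.ball 0 (n : ℝ)) < ⊤) ∧
        ∃ b < deviationLevel d p γ ε, ∀ g ∈ sobolevSphere D, ∃ z : ℝ, |z| ≤ b ∧
          Tendsto (compensatedPartial ε (N w) (smearedKernel D (farKernel α p a ε) g)) atTop
            (𝓝 (z : EReal)))} with hS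
  refine ⟨S, ?_, fun w hw => not_not.1 hw⟩
  set T : Set Ω := (⋃ i, {w | δ * lev < |compLim M μ (c i) w|}) ∪
    {w | δ * lev < |compLim M μ e w|} with hT
  have hsub : S ≤ᵐ[P] T := by
    filter_upwards [hball, hconv] with w hw1 hw2 hwS
    by_contra hnot
    apply hwS
    refine ⟨hw1, C * ∑ i, |compLim M μ (c i) w| + |compLim M μ e w| + 2 * (ε * ∫ x, e x), ?_,
      fun g hg => ?_⟩
    · change ¬ (_ ∨ _) at hnot
      rw [not_or] at hnot
      have n1 : ∀ i, |compLim M μ (c i) w| ≤ δ * lev := fun i => by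
        by_contra hi
        exact hnot.1 (mem_iUnion.2 ⟨i, not_le.1 hi⟩)
      have n2 : |compLim M μ e w| ≤ δ * lev := not_lt.1 hnot.2
      have n3 : ∑ i, |compLim M μ (c i) w| ≤ k * (δ * lev) := by
        refine (Finset.sum_le_card_nsmul _ _ _ fun i _ => n1 i).trans_eq ?_
        rw [nsmul_eq_mul, Finset.card_univ]
      rw [deviationLevel_eq hd hpd γ hε0]
      have n4 := mul_le_mul_of_nonneg_left n3 hC
      have n5 := mul_le_mul_of_nonneg_right hδ1 hlev0.le
      nlinarith
    · have hg2 := memLp_of_mem_sobolevSphere hg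
      have hm : ∀ᵐ y ∂(sqMeasure D g), y ∈ Metric.closedBall 0 R := by
        filter_upwards [ae_mem_sqMeasure hD g] with y hy using hDR hy
      obtain ⟨z, hz1, hz2⟩ := hw2 (sqMeasure D g) (isFiniteMeasure_sqMeasure hg2) hm
      refine ⟨z, hz1.trans ?_, ?_⟩
      · rw [sqMeasure_real_univ hg2]
        refine mul_le_of_le_one_left ?_ (l2Norm_sq_le_one hg)
        have : 0 ≤ ∫ x, e x := integral_nonneg h.error_nonneg
        positivity
      · rw [farKernel_eq hε0, smearedKernel_eq_smear hg2 (measurable_farRiesz hα hl0.le)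
          (farRiesz_nonneg hα hl0.le)]
        have h0 : (Metric.ball (0 : 𝔼) ((0 : ℕ) : ℝ)) = ∅ := by
          rw [Nat.cast_zero, Metric.ball_zero]
        simp only [h0, Measure.restrict_empty, lintegral_zero_measure, mul_zero,
          EReal.coe_ennreal_zero, sub_zero, zero_add] at hz2
        exact hz2
  refine (measure_mono_ae hsub).trans ((measure_union_le _ _).trans ?_)
  have hU : P (⋃ i, {w | δ * lev < |compLim M μ (c i) w|}) ≤
      ENNReal.ofReal (k * (2 * rexp (-(B + 1) * n))) := by
    refine (measure_iUnion_fintype_le _ _).trans ((Finset.sum_le_card_nsmul _ _ _ fun i _ =>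
      htail (c i) (h.measurable_right i) (h.abs_right_le i)).trans_eq ?_)
    rw [nsmul_eq_mul, Finset.card_univ, ENNReal.ofReal_mul hk0, hk, ENNReal.ofReal_natCast]
  have hE := htail e h.measurable_error fun x => by
    rw [abs_of_nonneg (h.error_nonneg x)]; exact h.error_le x
  refine (add_le_add hU hE).trans ?_
  rw [← ENNReal.ofReal_add (by positivity) (by positivity)]
  refine ENNReal.ofReal_le_ofReal ?_
  have e5 : rexp (-(B + 1) * n) * rexp n = rexp (-B * n) := by rw [← Real.exp_add]; ring_nf
  rw [← e5]
  have h3' : 2 * (k + 1) ≤ rexp n := h3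
  have := Real.exp_pos (-(B + 1) * n)
  nlinarith

end FarTail

/-! ### The limiting cumulant function -/

/-- The cumulant function `e^{-s} - 1 + s` of a compensated unit jump. -/
noncomputable def expGap (s : ℝ) : ℝ :=
  rexp (-s) - 1 + s

theorem continuous_expGap : Continuous expGap := by unfold expGap; fun_prop

theorem expGap_zero : expGap 0 = 0 := by simp [expGap]

theorem expGap_nonneg (s : ℝ) : 0 ≤ expGap s := by
  have := Real.add_one_le_exp (-s)
  rw [expGap]; linarith

theorem expGap_le_self {s : ℝ} (hs : 0 ≤ s) : expGap s ≤ s := by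
  have := Real.exp_le_one_iff.2 (neg_nonpos.2 hs)
  rw [expGap]; linarith

theorem one_sub_exp_neg_nonneg {s : ℝ} (hs : 0 ≤ s) : 0 ≤ 1 - rexp (-s) := by
  have := Real.exp_le_one_iff.2 (neg_nonpos.2 hs)
  linarith

theorem one_sub_exp_neg_le (s : ℝ) : 1 - rexp (-s) ≤ s := by
  have := Real.add_one_le_exp (-s)
  linarith

theorem hasDerivAt_expGap (s : ℝ) : HasDerivAt expGap (1 - rexp (-s)) s := by
  have h := (((hasDerivAt_neg s).exp).sub_const 1).add (hasDerivAt_id s)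
  refine h.congr_deriv ?_
  ring

theorem expGap_monotoneOn : MonotoneOn expGap (Ici 0) := by
  refine monotoneOn_of_deriv_nonneg (convex_Ici 0) continuous_expGap.continuousOn
    (fun x _ => (hasDerivAt_expGap x).differentiableAt.differentiableWithinAt) fun x hx => ?_
  rw [(hasDerivAt_expGap x).deriv]
  exact one_sub_exp_neg_nonneg (by simpa using interior_subset hx)

theorem expGap_le_sq {s : ℝ} (hs : 0 ≤ s) : expGap s ≤ s ^ 2 := by
  rcases le_total 1 s with h | h
  · exact (expGap_le_self hs).trans (by nlinarith)
  · have h1 := Real.abs_exp_sub_one_sub_id_le (x := -s) (by rw [abs_neg, abs_of_nonneg hs]; exact h)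
    have h2 := le_abs_self (rexp (-s) - 1 - -s)
    rw [expGap]
    nlinarith

section OneDim

variable {q : ℝ}

/-- `s^{1-q}` on `(0, 1]` and `s^{-q}` on `(1, ∞)`. -/
theorem integrableOn_rpow_piecewise (hq1 : 1 < q) (hq2 : q < 2) :
    IntegrableOn (fun s : ℝ => if s ≤ 1 then s ^ (1 - q) else s ^ (-q)) (Ioi 0) := by
  rw [← Ioc_union_Ioi_eq_Ioi zero_le_one]
  refine IntegrableOn.union ?_ ?_
  · have h := (intervalIntegral.integrableOn_Ioo_rpow_iff (s := 1 - q) one_pos).2 (by linarith)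
    rw [← integrableOn_Ioc_iff_integrableOn_Ioo] at h
    exact h.congr_fun (fun s hs => by simp only; rw [if_pos hs.2]) measurableSet_Ioc
  · have h := integrableOn_Ioi_rpow_of_lt (a := -q) (by linarith) one_pos
    exact h.congr_fun (fun s hs => by simp only; rw [if_neg (not_le.2 hs)]) measurableSet_Ioi

theorem integrableOn_rpow_mul_of_le {v : ℝ → ℝ} {r : ℝ} (hq1 : 1 < q) (hq2 : q < 2)
    (hv : Continuous v) (hv0 : ∀ s, 0 < s → 0 ≤ v s)
    (hv1 : ∀ s, 0 < s → s ^ r * v s ≤ if s ≤ 1 then s ^ (1 - q) else s ^ (-q)) :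
    IntegrableOn (fun s => s ^ r * v s) (Ioi 0) := by
  refine (integrableOn_rpow_piecewise hq1 hq2).mono' ?_ ?_
  · exact (by fun_prop : Measurable fun s : ℝ => s ^ r).mul hv.measurable |>.aestronglyMeasurable
  · filter_upwards [ae_restrict_mem measurableSet_Ioi] with s hs
    have hs0 : 0 < s := hs
    rw [Real.norm_of_nonneg (mul_nonneg (by positivity) (hv0 s hs))]
    exact hv1 s hs

theorem tendsto_zero_of_le_rpow {f : ℝ → ℝ} (hq1 : 1 < q) (hq2 : q < 2)
    (h0 : ∀ s, 0 < s → 0 ≤ f s) (h1 : ∀ s, 0 < s → f s ≤ s ^ (2 - q))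
    (h2 : ∀ s, 0 < s → f s ≤ s ^ (1 - q)) :
    Tendsto f (𝓝[>] 0) (𝓝 0) ∧ Tendsto f atTop (𝓝 0) := by
  constructor
  · refine squeeze_zero' (g := fun s => s ^ (2 - q)) ?_ ?_ ?_
    · filter_upwards [self_mem_nhdsWithin] with s hs using h0 s hs
    · filter_upwards [self_mem_nhdsWithin] with s hs using h1 s hs
    · have h := (Real.continuousAt_rpow_const 0 (2 - q) (Or.inr (by linarith))).tendsto
      rw [Real.zero_rpow (by linarith)] at h
      exact h.mono_left nhdsWithin_le_nhds
  · refine squeeze_zero' (g := fun s => s ^ (-(q - 1))) ?_ ?_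
      (tendsto_rpow_neg_atTop (by linarith))
    · filter_upwards [eventually_gt_atTop 0] with s hs using h0 s hs
    · filter_upwards [eventually_gt_atTop 0] with s hs
      rw [neg_sub]
      exact h2 s hs

/-- A majorant that is integrable at `0` and at `∞`. -/
theorem rpow_mul_le_piecewise {v : ℝ → ℝ} {r s A : ℝ} (hs : 0 < s)
    (h1 : v s ≤ s ^ A) (h2 : v s ≤ s ^ (A - 1)) (hr : r + A = 1 - q) :
    s ^ r * v s ≤ if s ≤ 1 then s ^ (1 - q) else s ^ (-q) := by
  split_ifs
  · rw [← hr, Real.rpow_add hs]; gcongr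
  · rw [show -q = r + (A - 1) by linarith, Real.rpow_add hs]; gcongr

/-- The continuation of Euler's integral to the argument `-q`, obtained by two integrations by
parts. -/
theorem integral_rpow_mul_expGap (hq1 : 1 < q) (hq2 : q < 2) :
    ∫ s in Ioi (0 : ℝ), s ^ (-q - 1) * expGap s = Real.Gamma (2 - q) / (q * (q - 1)) := by
  have pos : ∀ {s : ℝ}, 0 < s → 0 ≤ 1 - rexp (-s) := fun hs => one_sub_exp_neg_nonneg hs.le
  have hle1 : ∀ {s : ℝ}, 1 - rexp (-s) ≤ 1 := fun {s} => by linarith [Real.exp_pos (-s)]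
  have i1 : IntegrableOn (fun s : ℝ => s ^ (-q - 1) * expGap s) (Ioi 0) :=
    integrableOn_rpow_mul_of_le hq1 hq2 continuous_expGap (fun s _ => expGap_nonneg s)
      fun s hs => rpow_mul_le_piecewise (A := 2) hs
        (by rw [Real.rpow_two]; exact expGap_le_sq hs.le)
        (by norm_num; exact expGap_le_self hs.le) (by ring)
  have i2 : IntegrableOn (fun s : ℝ => s ^ (-q) * (1 - rexp (-s))) (Ioi 0) :=
    integrableOn_rpow_mul_of_le hq1 hq2 (by fun_prop) (fun s hs => pos hs)
      fun s hs => rpow_mul_le_piecewise (A := 1) (v := fun s => 1 - rexp (-s)) hs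
        (by rw [Real.rpow_one]; exact one_sub_exp_neg_le s)
        (by norm_num; exact (Real.exp_pos _).le) (by ring)
  have i3 : IntegrableOn (fun s : ℝ => rexp (-s) * s ^ (2 - q - 1)) (Ioi 0) :=
    Real.GammaIntegral_convergent (by linarith)
  have split1 : ∀ {s : ℝ}, 0 < s → s ^ (-q) * s ^ (2 : ℝ) = s ^ (2 - q) := fun hs => by
    rw [← Real.rpow_add hs]; congr 1; ring
  have split2 : ∀ {s : ℝ}, 0 < s → s ^ (-q) * s = s ^ (1 - q) := fun {s} hs => by
    nth_rewrite 2 [← Real.rpow_one s]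
    rw [← Real.rpow_add hs]; congr 1; ring
  have split3 : ∀ {s : ℝ}, 0 < s → s ^ (1 - q) * s = s ^ (2 - q) := fun {s} hs => by
    nth_rewrite 2 [← Real.rpow_one s]
    rw [← Real.rpow_add hs]; congr 1; ring
  have t1 := tendsto_zero_of_le_rpow (f := fun s => s ^ (-q) * expGap s) hq1 hq2
    (fun s hs => mul_nonneg (by positivity) (expGap_nonneg s))
    (fun s hs => by
      rw [← split1 hs, Real.rpow_two]
      exact mul_le_mul_of_nonneg_left (expGap_le_sq hs.le) (by positivity))
    (fun s hs => by
      rw [← split2 hs]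
      exact mul_le_mul_of_nonneg_left (expGap_le_self hs.le) (by positivity))
  have t2 := tendsto_zero_of_le_rpow (f := fun s => s ^ (1 - q) * (1 - rexp (-s))) hq1 hq2
    (fun s hs => mul_nonneg (by positivity) (pos hs))
    (fun s hs => by
      rw [← split3 hs]
      exact mul_le_mul_of_nonneg_left (one_sub_exp_neg_le s) (by positivity))
    (fun s hs => mul_le_of_le_one_right (by positivity) hle1)
  have p1 := integral_Ioi_mul_deriv_eq_deriv_mul (a := 0) (u := fun s : ℝ => s ^ (-q)) (v := expGap)
    (u' := fun s => -q * s ^ (-q - 1)) (v' := fun s => 1 - rexp (-s))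
    (fun s hs => Real.hasDerivAt_rpow_const (Or.inl (ne_of_gt hs)))
    (fun s _ => hasDerivAt_expGap s) i2
    (IntegrableOn.congr_fun (i1.const_mul (-q))
      (fun s _ => by simp only [Pi.mul_apply]; ring) measurableSet_Ioi) t1.1 t1.2
  have p2 := integral_Ioi_mul_deriv_eq_deriv_mul (a := 0) (u := fun s : ℝ => s ^ (1 - q))
    (v := fun s => 1 - rexp (-s))
    (u' := fun s => (1 - q) * s ^ (-q)) (v' := fun s => rexp (-s))
    (fun s hs => by
      have := Real.hasDerivAt_rpow_const (x := s) (p := 1 - q) (Or.inl (ne_of_gt hs))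
      rwa [show 1 - q - 1 = -q by ring] at this)
    (fun s _ => by
      have := ((hasDerivAt_neg s).exp).const_sub 1
      refine this.congr_deriv ?_
      ring)
    (i3.congr_fun (fun s _ => by
      simp only [Pi.mul_apply]; rw [show 2 - q - 1 = 1 - q by ring, mul_comm]) measurableSet_Ioi)
    (IntegrableOn.congr_fun (i2.const_mul (1 - q))
      (fun s _ => by simp only [Pi.mul_apply]; ring) measurableSet_Ioi) t2.1 t2.2
  have g : ∫ s in Ioi (0 : ℝ), s ^ (1 - q) * rexp (-s) = Real.Gamma (2 - q) := by
    rw [Real.Gamma_eq_integral (by linarith)]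
    refine setIntegral_congr_fun measurableSet_Ioi fun s _ => ?_
    rw [show 2 - q - 1 = 1 - q by ring, mul_comm]
  simp only [mul_assoc, integral_const_mul, sub_self, zero_sub] at p1 p2
  rw [g] at p2
  rw [p1] at p2
  rw [eq_div_iff (by nlinarith)]
  linear_combination -p2

end OneDim

section Cumulant

variable {d : ℕ} {p : ℝ}

local notation "𝔼" => EuclideanSpace ℝ (Fin d)

/-- The rescaled cumulant function of the compensated Poisson integral of the Riesz kernel. -/
noncomputable def rieszCumulant (d : ℕ) (p lam : ℝ) : ℝ :=
  ∫ u : EuclideanSpace ℝ (Fin d), expGap (lam * ‖u‖ ^ (-p))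

theorem integrable_expGap_riesz (hd : d ≠ 0) (hp : (d : ℝ) < 2 * p) (hpd : p < d) {lam : ℝ}
    (hlam : 0 ≤ lam) : Integrable fun u : 𝔼 => expGap (lam * ‖u‖ ^ (-p)) := by
  have h1 := ((integrableOn_rpow_norm_ball (p := p) hd hpd 1).integrable_indicator
    measurableSet_ball).const_mul lam
  have h2 := (integrable_cappedRiesz (d := d) hp one_pos).const_mul (lam ^ 2)
  refine (h1.add h2).mono' ?_ (ae_of_all _ fun u => ?_)
  · exact (continuous_expGap.measurable.comp
      ((measurable_rpow_norm _).const_mul lam)).aestronglyMeasurable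
  · have h0 : 0 ≤ lam * ‖u‖ ^ (-p) := by positivity
    have hc := cappedRiesz_nonneg (p := 2 * p) zero_le_one u
    rw [Real.norm_of_nonneg (expGap_nonneg _), Pi.add_apply]
    by_cases hu : u ∈ Metric.ball (0 : 𝔼) 1
    · rw [indicator_of_mem hu]
      have := expGap_le_self h0
      nlinarith [mul_nonneg (sq_nonneg lam) hc]
    · rw [indicator_of_notMem hu, mul_zero, zero_add, ← cappedRiesz_sq zero_le_one, ← mul_pow]
      have hu' : 1 ≤ ‖u‖ := by simpa using hu
      rw [cappedRiesz, max_eq_right hu']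
      exact expGap_le_sq h0

theorem rieszCumulant_eq_rpow_mul (hp : 0 < p) {lam : ℝ} (hlam : 0 < lam) :
    rieszCumulant d p lam = lam ^ ((d : ℝ) / p) * rieszCumulant d p 1 := by
  set c := lam ^ (-(1 / p)) with hc
  have hc0 : 0 < c := Real.rpow_pos_of_pos hlam _
  have h := Measure.integral_comp_smul volume (fun u : 𝔼 => expGap (1 * ‖u‖ ^ (-p))) c
  rw [finrank_euclideanSpace, Fintype.card_fin, abs_of_pos (by positivity), smul_eq_mul] at h
  have h1 : ∀ u : 𝔼, 1 * ‖c • u‖ ^ (-p) = lam * ‖u‖ ^ (-p) := fun u => by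
    rw [norm_smul, Real.norm_of_nonneg hc0.le, Real.mul_rpow hc0.le (norm_nonneg _), hc,
      ← Real.rpow_mul hlam.le, one_mul]
    congr 1
    rw [neg_mul_neg, one_div, inv_mul_cancel₀ hp.ne', Real.rpow_one]
  simp only [h1] at h
  rw [rieszCumulant, h, rieszCumulant]
  congr 1
  rw [hc, ← Real.rpow_natCast, ← Real.rpow_mul hlam.le, ← Real.rpow_neg hlam.le]
  congr 1
  field_simp

/-- The constant of the cumulant function, in polar coordinates and with the substitution
`s = r^{-p}`. -/
theorem rieszCumulant_one (hd : d ≠ 0) (hp : (d : ℝ) < 2 * p) (hpd : p < d) :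
    rieszCumulant d p 1 =
      unitBallVolume d * Real.Gamma ((2 * p - d) / p) / (d / p - 1) := by
  have hp0 : 0 < p := by
    have : (0 : ℝ) ≤ d := Nat.cast_nonneg d
    linarith
  have : Nonempty (Fin d) := ⟨⟨0, Nat.pos_of_ne_zero hd⟩⟩
  have hd' : (d : ℝ) ≠ 0 := by exact_mod_cast hd
  set q := (d : ℝ) / p with hq
  have hq1 : 1 < q := (one_lt_div hp0).2 hpd
  have hq2 : q < 2 := (div_lt_iff₀ hp0).2 hp
  have h1 := integral_fun_norm_addHaar (E := 𝔼) volume (fun r : ℝ => expGap (1 * r ^ (-p)))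
  rw [rieszCumulant, h1, finrank_euclideanSpace, Fintype.card_fin]
  have h2 : ∫ y in Ioi (0 : ℝ), y ^ (d - 1) • expGap (1 * y ^ (-p)) =
      p⁻¹ * ∫ s in Ioi (0 : ℝ), s ^ (-q - 1) * expGap s := by
    rw [← integral_comp_rpow_Ioi (fun s => s ^ (-q - 1) * expGap s) (neg_ne_zero.2 hp0.ne'),
      ← integral_const_mul]
    refine setIntegral_congr_fun measurableSet_Ioi fun y hy => ?_
    have hy0 : 0 < y := hy
    simp only [smul_eq_mul, one_mul, abs_neg, abs_of_pos hp0]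
    have h3 : y ^ (-p - 1) * (y ^ (-p)) ^ (-q - 1) = y ^ (d - 1) := by
      rw [← Real.rpow_mul hy0.le, ← Real.rpow_add hy0, ← Real.rpow_natCast,
        Nat.cast_sub (Nat.one_le_iff_ne_zero.2 hd)]
      congr 1
      rw [hq]
      push_cast
      field_simp
      ring
    rw [← h3]
    field_simp
  rw [h2, integral_rpow_mul_expGap hq1 hq2]
  have h4 : (2 * p - d) / p = 2 - q := by rw [hq]; field_simp
  rw [h4, nsmul_eq_mul, smul_eq_mul, unitBallVolume, ← Measure.real]
  have hq0 : q ≠ 0 := by linarith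
  have hq10 : q - 1 ≠ 0 := by linarith
  have h5 : (d : ℝ) = q * p := by rw [hq]; field_simp
  rw [h5]
  field_simp

theorem rieszCumulant_one_pos (hd : d ≠ 0) (hp : (d : ℝ) < 2 * p) (hpd : p < d) :
    0 < rieszCumulant d p 1 := by
  have hp0 : 0 < p := by
    have : (0 : ℝ) ≤ d := Nat.cast_nonneg d
    linarith
  rw [rieszCumulant_one hd hp hpd]
  have h1 : 0 < unitBallVolume d :=
    ENNReal.toReal_pos (Metric.measure_ball_pos _ _ one_pos).ne' measure_ball_lt_top.ne
  have h2 : 0 < Real.Gamma ((2 * p - d) / p) := Real.Gamma_pos_of_pos (div_pos (by linarith) hp0)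
  have h3 : 0 < d / p - 1 := sub_pos.2 ((one_lt_div hp0).2 hpd)
  positivity

end Cumulant

/-! ### Shifted kernels and the convergence of their cumulants -/

section Shifted

variable {d : ℕ} {p : ℝ} {α : ℝ → ℝ}

local notation "𝔼" => EuclideanSpace ℝ (Fin d)

/-- The truncated Riesz kernel with `‖x‖` replaced by `‖x‖ + b`. For negative `b` it is set to zero
where `‖x‖ < 2 |b|`, so that it is bounded unless `b = 0`. -/
noncomputable def shiftedRiesz {d : ℕ} (α : ℝ → ℝ) (p l b : ℝ) (x : EuclideanSpace ℝ (Fin d)) : ℝ :=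
  if -(2 * b) ≤ ‖x‖ then (‖x‖ + b) ^ (-p) * α (l⁻¹ * (‖x‖ + b)) else 0

theorem shiftedRiesz_zero (l : ℝ) : shiftedRiesz (d := d) α p l 0 = nearRiesz α p l := by
  ext x
  rw [shiftedRiesz, if_pos (by simp), add_zero, nearRiesz]

theorem half_norm_le_add {b : ℝ} {x : 𝔼} (h : -(2 * b) ≤ ‖x‖) : ‖x‖ / 2 ≤ ‖x‖ + b := by linarith

theorem truncation_shifted_mem_Icc (hα : IsSmoothTruncation α) {l b : ℝ} (hl : 0 < l) {x : 𝔼}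
    (h : -(2 * b) ≤ ‖x‖) : α (l⁻¹ * (‖x‖ + b)) ∈ Icc (0 : ℝ) 1 := by
  have := half_norm_le_add h
  have := norm_nonneg x
  exact hα.mem_Icc _ (mul_nonneg (inv_nonneg.2 hl.le) (by linarith))

theorem shiftedRiesz_nonneg (hα : IsSmoothTruncation α) {l : ℝ} (hl : 0 < l) (b : ℝ) (x : 𝔼) :
    0 ≤ shiftedRiesz α p l b x := by
  rw [shiftedRiesz]
  split_ifs with h
  · have := half_norm_le_add h
    have := norm_nonneg x
    exact mul_nonneg (Real.rpow_nonneg (by linarith) _) (truncation_shifted_mem_Icc hα hl h).1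
  · exact le_rfl

theorem shiftedRiesz_le_of_le (hα : IsSmoothTruncation α) (hp : 0 ≤ p) {l : ℝ} (hl : 0 < l) {b r : ℝ}
    (hr : 0 < r) {x : 𝔼} (h : -(2 * b) ≤ ‖x‖ → r ≤ ‖x‖ + b) : shiftedRiesz α p l b x ≤ r ^ (-p) := by
  rw [shiftedRiesz]
  split_ifs with hx
  · have h1 := h hx
    refine (mul_le_of_le_one_right (Real.rpow_nonneg (by linarith) _)
      (truncation_shifted_mem_Icc hα hl hx).2).trans ?_
    exact Real.rpow_le_rpow_of_nonpos hr h1 (by linarith)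
  · positivity

theorem shiftedRiesz_le_abs_rpow (hα : IsSmoothTruncation α) (hp : 0 ≤ p) {l : ℝ} (hl : 0 < l)
    {b : ℝ} (hb : b ≠ 0) (x : 𝔼) : shiftedRiesz α p l b x ≤ |b| ^ (-p) :=
  shiftedRiesz_le_of_le hα hp hl (abs_pos.2 hb) fun h => by
    have := norm_nonneg x
    exact abs_le.2 ⟨by linarith, by linarith⟩

theorem shiftedRiesz_le (hα : IsSmoothTruncation α) (hp : 0 ≤ p) {l : ℝ} (hl : 0 < l) (b : ℝ) {x : 𝔼}
    (hx : x ≠ 0) : shiftedRiesz α p l b x ≤ 2 ^ p * ‖x‖ ^ (-p) := by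
  have hx' : 0 < ‖x‖ := norm_pos_iff.2 hx
  refine (shiftedRiesz_le_of_le hα hp hl (half_pos hx') half_norm_le_add).trans_eq ?_
  rw [div_eq_mul_inv, Real.mul_rpow hx'.le (by norm_num), Real.inv_rpow (by norm_num),
    Real.rpow_neg (by norm_num : (0 : ℝ) ≤ 2), inv_inv, mul_comm]

theorem shiftedRiesz_le_of_nonneg (hα : IsSmoothTruncation α) (hp : 0 ≤ p) {l : ℝ} (hl : 0 < l)
    {b : ℝ} (hb : 0 ≤ b) {x : 𝔼} (hx : x ≠ 0) : shiftedRiesz α p l b x ≤ ‖x‖ ^ (-p) :=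
  shiftedRiesz_le_of_le hα hp hl (norm_pos_iff.2 hx) fun _ => by linarith

theorem shiftedRiesz_eq_zero (hα : IsSmoothTruncation α) {l : ℝ} (hl : 0 < l) {b : ℝ} {x : 𝔼}
    (hx : 6 * l ≤ ‖x‖) : shiftedRiesz α p l b x = 0 := by
  rw [shiftedRiesz]
  split_ifs with h
  · have := half_norm_le_add h
    rw [hα.eq_zero, mul_zero]
    rw [inv_mul_eq_div, le_div_iff₀ hl]
    linarith
  · rfl

/-- The Riesz scaling; the shift becomes negligible on the scale `ρ`. -/
theorem shiftedRiesz_smul {l ρ : ℝ} (hρ : 0 < ρ) (b : ℝ) (u : 𝔼) :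
    shiftedRiesz α p (l * ρ) b (ρ • u) = ρ ^ (-p) * shiftedRiesz α p l (b / ρ) u := by
  have e : ρ * ‖u‖ + b = ρ * (‖u‖ + b / ρ) := by field_simp
  have e1 : (l * ρ)⁻¹ * (ρ * (‖u‖ + b / ρ)) = l⁻¹ * (‖u‖ + b / ρ) := by
    rw [mul_inv, mul_assoc, inv_mul_cancel_left₀ hρ.ne']
  have e2 : -(2 * b) ≤ ρ * ‖u‖ ↔ -(2 * (b / ρ)) ≤ ‖u‖ := by
    rw [← mul_le_mul_iff_of_pos_left hρ (b := -(2 * (b / ρ)))]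
    have : ρ * -(2 * (b / ρ)) = -(2 * b) := by field_simp
    rw [this]
  rw [shiftedRiesz, shiftedRiesz, norm_smul, Real.norm_of_nonneg hρ.le, e, e1]
  by_cases h : -(2 * b) ≤ ρ * ‖u‖
  · have h' := e2.1 h
    have := half_norm_le_add h'
    rw [if_pos h, if_pos h', Real.mul_rpow hρ.le (by linarith [norm_nonneg u]), mul_assoc]
  · rw [if_neg h, if_neg (mt e2.2 h), mul_zero]

theorem measurable_shiftedRiesz (hα : IsSmoothTruncation α) {l : ℝ} (hl : 0 < l) (b : ℝ) :
    Measurable (shiftedRiesz (d := d) α p l b) := by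
  have h : shiftedRiesz (d := d) α p l b = {x : 𝔼 | -(2 * b) ≤ ‖x‖}.indicator
      fun x => (‖x‖ + b) ^ (-p) * α (l⁻¹ * max (‖x‖ + b) 0) := by
    ext x
    by_cases hx : -(2 * b) ≤ ‖x‖
    · have := half_norm_le_add hx
      rw [shiftedRiesz, if_pos hx, indicator_of_mem (show x ∈ {x : 𝔼 | -(2 * b) ≤ ‖x‖} from hx),
        max_eq_left (by linarith [norm_nonneg x])]
    · rw [shiftedRiesz, if_neg hx, indicator_of_notMem (show x ∉ {x : 𝔼 | -(2 * b) ≤ ‖x‖} from hx)]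
  rw [h]
  refine Measurable.indicator ?_ (measurableSet_le measurable_const measurable_norm)
  refine ((measurable_norm.add_const b).pow_const _).mul (Continuous.measurable ?_)
  exact hα.continuous_comp (by fun_prop) fun x => by positivity

theorem tendsto_shiftedRiesz (hα : IsSmoothTruncation α) {l : ℝ} (hl : 0 < l) {x : 𝔼} (hx : x ≠ 0) :
    Tendsto (fun b => shiftedRiesz α p l b x) (𝓝 0) (𝓝 (nearRiesz α p l x)) := by
  have hx' : 0 < ‖x‖ := norm_pos_iff.2 hx
  have h1 : ∀ᶠ b in 𝓝 (0 : ℝ), -(‖x‖ / 2) < b := lt_mem_nhds (by linarith)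
  have h2 : Tendsto (fun b : ℝ => ‖x‖ + b) (𝓝 0) (𝓝 ‖x‖) := by
    have : Tendsto (fun b : ℝ => ‖x‖ + b) (𝓝 0) (𝓝 (‖x‖ + 0)) := tendsto_const_nhds.add tendsto_id
    rwa [add_zero] at this
  have h3 : ContinuousAt α (l⁻¹ * ‖x‖) :=
    hα.continuousOn.continuousAt (Ici_mem_nhds (by positivity))
  have h4 := (h2.rpow_const (p := -p) (Or.inl hx'.ne')).mul (h3.tendsto.comp (h2.const_mul l⁻¹))
  refine h4.congr' ?_
  filter_upwards [h1] with b hb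
  rw [shiftedRiesz, if_pos (by linarith)]
  rfl

/-- The radial profile of the truncated Riesz kernel is decreasing. -/
theorem antitoneOn_truncated_rpow (hα : IsSmoothTruncation α) (hp : 0 ≤ p) {l : ℝ} (hl : 0 < l) :
    AntitoneOn (fun t : ℝ => t ^ (-p) * α (l⁻¹ * t)) (Ioi 0) := by
  intro s hs t ht hst
  have hs' : 0 < s := hs
  have ht' : 0 < t := ht
  have hl' := (inv_pos.2 hl).le
  refine mul_le_mul (Real.rpow_le_rpow_of_nonpos hs' hst (by linarith))
    (hα.antitoneOn (mem_Ici.2 (by positivity)) (mem_Ici.2 (by positivity))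
      (mul_le_mul_of_nonneg_left hst hl'))
    (hα.mem_Icc _ (by positivity)).1 (by positivity)

/-- The shift by `R` is a minorant of all translates of the near kernel by `‖y‖ ≤ R`. The point
`x = y` is excluded because `0 ^ (-p) = 0` there. -/
theorem shiftedRiesz_le_nearRiesz_sub (hα : IsSmoothTruncation α) (hp : 0 ≤ p) {l : ℝ} (hl : 0 < l)
    {R : ℝ} {x y : 𝔼} (hy : ‖y‖ ≤ R) (hxy : y ≠ x) :
    shiftedRiesz α p l R x ≤ nearRiesz α p l (y - x) := by
  have h0 : 0 < ‖y - x‖ := norm_pos_iff.2 (sub_ne_zero.2 hxy)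
  have h1 : ‖y - x‖ ≤ ‖x‖ + R := (norm_sub_le y x).trans (by linarith)
  have := norm_nonneg x
  have := norm_nonneg y
  rw [shiftedRiesz, if_pos (by linarith)]
  exact antitoneOn_truncated_rpow hα hp hl h0 (h0.trans_le h1) h1

/-- The shift by `-R` is a majorant of all translates of the near kernel by `‖y‖ ≤ R`, away from
the ball of radius `2R`. -/
theorem nearRiesz_sub_le_shiftedRiesz (hα : IsSmoothTruncation α) (hp : 0 ≤ p) {l : ℝ} (hl : 0 < l)
    {R : ℝ} (hR : 0 < R) {x y : 𝔼} (hy : ‖y‖ ≤ R) (hx : 2 * R ≤ ‖x‖) :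
    nearRiesz α p l (y - x) ≤ shiftedRiesz α p l (-R) x := by
  have h1 : ‖x‖ + -R ≤ ‖y - x‖ := by
    have := norm_sub_norm_le x y
    rw [norm_sub_rev] at this
    linarith
  have h0 : 0 < ‖x‖ + -R := by linarith
  rw [shiftedRiesz, if_pos (by linarith)]
  exact antitoneOn_truncated_rpow hα hp hl h0 (h0.trans_le h1) h1

theorem shiftedRiesz_neg_eq_zero {l R : ℝ} {x : 𝔼} (hx : ‖x‖ < 2 * R) :
    shiftedRiesz α p l (-R) x = 0 := by
  rw [shiftedRiesz, if_neg (by linarith)]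

theorem isTame_shiftedRiesz (hα : IsSmoothTruncation α) (hp : 0 ≤ p) {l : ℝ} (hl : 0 < l) {b : ℝ}
    (hb : b ≠ 0) (ε : ℝ) :
    IsTame (ENNReal.ofReal ε • volume : Measure 𝔼) (shiftedRiesz α p l b) where
  measurable := measurable_shiftedRiesz hα hl b
  bounded := ⟨|b| ^ (-p), fun x => by
    rw [abs_of_nonneg (shiftedRiesz_nonneg hα hl b x)]
    exact shiftedRiesz_le_abs_rpow hα hp hl hb x⟩
  support_ne_top := by
    have h : Function.support (shiftedRiesz (d := d) α p l b) ⊆ Metric.ball 0 (6 * l) := fun x hx => by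
      by_contra h
      exact hx (shiftedRiesz_eq_zero hα hl (by simpa using h))
    refine ((measure_mono h).trans_lt ?_).ne
    rw [Measure.smul_apply, smul_eq_mul]
    exact ENNReal.mul_lt_top ENNReal.ofReal_lt_top measure_ball_lt_top

theorem integral_comp_shiftedRiesz (F : ℝ → ℝ) {l ρ : ℝ} (hρ : 0 < ρ) (b : ℝ) :
    ∫ x : 𝔼, F (shiftedRiesz α p (l * ρ) b x) =
      ρ ^ (d : ℝ) * ∫ u : 𝔼, F (ρ ^ (-p) * shiftedRiesz α p l (b / ρ) u) := by
  have h := Measure.integral_comp_smul volume (fun x : 𝔼 => F (shiftedRiesz α p (l * ρ) b x)) ρ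
  simp only [shiftedRiesz_smul hρ] at h
  rw [h, finrank_euclideanSpace, Fintype.card_fin, abs_of_pos (by positivity), smul_eq_mul,
    Real.rpow_natCast, mul_inv_cancel_left₀ (by positivity)]

/-- An integrable bound for all shifts of the truncated Riesz kernel. -/
theorem integrable_shiftedRiesz_bound (hd : d ≠ 0) (hpd : p < d) (l : ℝ) :
    Integrable ((Metric.ball (0 : 𝔼) (6 * l)).indicator fun x => 2 ^ p * ‖x‖ ^ (-p)) :=
  IntegrableOn.integrable_indicator
    (Integrable.const_mul (integrableOn_rpow_norm_ball hd hpd (6 * l)) (2 ^ p)) measurableSet_ball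

theorem shiftedRiesz_le_indicator (hα : IsSmoothTruncation α) (hp : 0 ≤ p) {l : ℝ} (hl : 0 < l)
    (b : ℝ) {x : 𝔼} (hx : x ≠ 0) : shiftedRiesz α p l b x ≤
      (Metric.ball (0 : 𝔼) (6 * l)).indicator (fun x => 2 ^ p * ‖x‖ ^ (-p)) x := by
  by_cases h : x ∈ Metric.ball (0 : 𝔼) (6 * l)
  · rw [indicator_of_mem h]; exact shiftedRiesz_le hα hp hl b hx
  · rw [indicator_of_notMem h, shiftedRiesz_eq_zero hα hl (by simpa using h)]

theorem ae_ne_zero (hd : d ≠ 0) : ∀ᵐ x : 𝔼, x ≠ 0 := by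
  have : Nonempty (Fin d) := ⟨⟨0, Nat.pos_of_ne_zero hd⟩⟩
  exact compl_mem_ae_iff.2 (measure_singleton 0)

theorem integrable_shiftedRiesz (hα : IsSmoothTruncation α) (hd : d ≠ 0) (hp : 0 ≤ p) (hpd : p < d)
    {l : ℝ} (hl : 0 < l) (b : ℝ) : Integrable (shiftedRiesz (d := d) α p l b) := by
  refine (integrable_shiftedRiesz_bound hd hpd l).mono'
    (measurable_shiftedRiesz hα hl b).aestronglyMeasurable ?_
  filter_upwards [ae_ne_zero hd] with x hx
  rw [Real.norm_of_nonneg (shiftedRiesz_nonneg hα hl b x)]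
  exact shiftedRiesz_le_indicator hα hp hl b hx

/-- Integrals of functions of the shifted kernel are continuous at the shift `0`. -/
theorem tendsto_integral_comp_shiftedRiesz (hα : IsSmoothTruncation α) (hd : d ≠ 0) (hp : 0 ≤ p)
    (hpd : p < d) {l : ℝ} (hl : 0 < l) {F : ℝ → ℝ} (hF : Continuous F) {C : ℝ} (hC : 0 ≤ C)
    (hFC : ∀ s, 0 ≤ s → |F s| ≤ C * s) :
    Tendsto (fun b => ∫ x : 𝔼, F (shiftedRiesz α p l b x)) (𝓝 0)
      (𝓝 (∫ x : 𝔼, F (nearRiesz α p l x))) := by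
  refine tendsto_integral_filter_of_dominated_convergence
    (fun x => C * (Metric.ball (0 : 𝔼) (6 * l)).indicator (fun x => 2 ^ p * ‖x‖ ^ (-p)) x) ?_ ?_ ?_ ?_
  · exact Eventually.of_forall fun b =>
      (hF.measurable.comp (measurable_shiftedRiesz hα hl b)).aestronglyMeasurable
  · refine Eventually.of_forall fun b => ?_
    filter_upwards [ae_ne_zero hd] with x hx
    exact (hFC _ (shiftedRiesz_nonneg hα hl b x)).trans
      (mul_le_mul_of_nonneg_left (shiftedRiesz_le_indicator hα hp hl b hx) hC)
  · exact (integrable_shiftedRiesz_bound hd hpd l).const_mul C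
  · filter_upwards [ae_ne_zero hd] with x hx
    exact (hF.tendsto _).comp (tendsto_shiftedRiesz hα hl hx)

/-- The cumulant function of the truncated Riesz kernel. -/
noncomputable def nearCumulant (d : ℕ) (α : ℝ → ℝ) (p a lam : ℝ) : ℝ :=
  ∫ u : EuclideanSpace ℝ (Fin d), expGap (lam * nearRiesz α p a u)

theorem tendsto_nearCumulant (hα : IsSmoothTruncation α) (hd : d ≠ 0) (hp : (d : ℝ) < 2 * p)
    (hpd : p < d) {lam : ℝ} (hlam : 0 ≤ lam) :
    Tendsto (fun a => nearCumulant d α p a lam) atTop (𝓝 (rieszCumulant d p lam)) := by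
  refine tendsto_integral_filter_of_dominated_convergence
    (fun u : 𝔼 => expGap (lam * ‖u‖ ^ (-p))) ?_ ?_ (integrable_expGap_riesz hd hp hpd hlam) ?_
  · filter_upwards [eventually_gt_atTop 0] with a ha
    exact (continuous_expGap.measurable.comp
      ((measurable_nearRiesz hα ha.le).const_mul lam)).aestronglyMeasurable
  · filter_upwards [eventually_gt_atTop 0] with a ha
    refine ae_of_all _ fun u => ?_
    rw [Real.norm_of_nonneg (expGap_nonneg _)]
    have h0 := nearRiesz_nonneg (p := p) hα ha.le u
    exact expGap_monotoneOn (mem_Ici.2 (mul_nonneg hlam h0)) (mem_Ici.2 (by positivity))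
      (mul_le_mul_of_nonneg_left (nearRiesz_le hα ha u) hlam)
  · refine ae_of_all _ fun u => tendsto_const_nhds.congr' ?_
    filter_upwards [eventually_gt_atTop 0, eventually_ge_atTop ‖u‖] with a ha hau
    rw [nearRiesz, hα.eq_one, mul_one]
    refine ⟨by positivity, ?_⟩
    rw [inv_mul_eq_div, div_le_one ha]
    exact hau

theorem tendsto_integral_expGap_shiftedRiesz (hα : IsSmoothTruncation α) (hd : d ≠ 0) (hp : 0 ≤ p)
    (hpd : p < d) {l : ℝ} (hl : 0 < l) {lam : ℝ} (hlam : 0 ≤ lam) :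
    Tendsto (fun b => ∫ x : 𝔼, expGap (lam * shiftedRiesz α p l b x)) (𝓝 0)
      (𝓝 (nearCumulant d α p l lam)) :=
  tendsto_integral_comp_shiftedRiesz hα hd hp hpd hl (F := fun s => expGap (lam * s))
    (continuous_expGap.comp (continuous_const_mul lam)) hlam fun s hs => by
      rw [abs_of_nonneg (expGap_nonneg _)]; exact expGap_le_self (mul_nonneg hlam hs)

theorem tendsto_integral_shiftedRiesz (hα : IsSmoothTruncation α) (hd : d ≠ 0) (hp : 0 ≤ p)
    (hpd : p < d) {l : ℝ} (hl : 0 < l) :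
    Tendsto (fun b => ∫ x : 𝔼, shiftedRiesz α p l b x) (𝓝 0) (𝓝 (∫ x : 𝔼, nearRiesz α p l x)) :=
  tendsto_integral_comp_shiftedRiesz hα hd hp hpd hl (F := id) continuous_id zero_le_one
    fun s hs => by rw [id, abs_of_nonneg hs, one_mul]

theorem integral_expGap_shiftedRiesz_le (hα : IsSmoothTruncation α) (hd : d ≠ 0)
    (hp : (d : ℝ) < 2 * p) (hpd : p < d) {l : ℝ} (hl : 0 < l) {b : ℝ} (hb : 0 ≤ b) {lam : ℝ}
    (hlam : 0 ≤ lam) :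
    ∫ x : 𝔼, expGap (lam * shiftedRiesz α p l b x) ≤ rieszCumulant d p lam := by
  have hp0 : 0 ≤ p := by linarith [(Nat.cast_nonneg d : (0 : ℝ) ≤ d)]
  refine integral_mono_of_nonneg (ae_of_all _ fun x => expGap_nonneg _)
    (integrable_expGap_riesz hd hp hpd hlam) ?_
  filter_upwards [ae_ne_zero hd] with x hx
  exact expGap_monotoneOn (mem_Ici.2 (mul_nonneg hlam (shiftedRiesz_nonneg hα hl b x)))
    (mem_Ici.2 (by positivity))
    (mul_le_mul_of_nonneg_left (shiftedRiesz_le_of_nonneg hα hp0 hl hb hx) hlam)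

end Shifted

/-! ### Bounds for the near part -/

section NearBounds

variable {d : ℕ} {p : ℝ} {α : ℝ → ℝ}

local notation "𝔼" => EuclideanSpace ℝ (Fin d)

theorem integrable_nearRiesz (hα : IsSmoothTruncation α) (hd : d ≠ 0) (hp : 0 ≤ p) (hpd : p < d)
    {l : ℝ} (hl : 0 < l) : Integrable (nearRiesz (d := d) α p l) := by
  rw [← shiftedRiesz_zero]
  exact integrable_shiftedRiesz hα hd hp hpd hl 0

theorem integrable_shiftedRiesz_of_ball (hα : IsSmoothTruncation α) (hp : 0 ≤ p) {l : ℝ} (hl : 0 < l)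
    {b : ℝ} (hb : b ≠ 0) {ν : Measure 𝔼} (hν : ∀ n : ℕ, ν (Metric.ball 0 (n : ℝ)) < ⊤) :
    Integrable (shiftedRiesz α p l b) ν := by
  obtain ⟨n, hn⟩ := exists_nat_gt (6 * l)
  refine (isTame_shiftedRiesz hα hp hl hb 1).integrable_of_support
    ((measure_mono fun x hx => ?_).trans_lt (hν n)).ne
  by_contra h
  have h' : (n : ℝ) ≤ ‖x‖ := by simpa using h
  exact hx (shiftedRiesz_eq_zero hα hl (hn.le.trans h'))

/-- The near kernel has bounded support, so no limit is needed. -/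
theorem nearFun_eq (hα : IsSmoothTruncation α) (hd : d ≠ 0) (hp : 0 ≤ p) (hpd : p < d) {R : ℝ}
    {D : Set 𝔼} (hD : MeasurableSet D) (hDR : D ⊆ Metric.closedBall 0 R) {a ε : ℝ} (ha : 0 < a)
    (hε : 0 < ε) (ν : Measure 𝔼) {g : 𝔼 → ℝ} (hg : MemLp g 2 (volume.restrict D)) :
    nearFun D α p a ε ν g =
      ((∫⁻ x, smear (sqMeasure D g) (nearRiesz α p (a * lengthScale d p ε)) x
        ∂(contractedField ε ν) : ℝ≥0∞) : EReal) -
      ((l2Norm D g ^ 2 * (ε * ∫ x : 𝔼, nearRiesz α p (a * lengthScale d p ε) x) : ℝ) : EReal) := by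
  have hl : 0 < a * lengthScale d p ε := mul_pos ha (lengthScale_pos hε)
  have := isFiniteMeasure_sqMeasure hg
  have hm : ∀ᵐ y ∂(sqMeasure D g), y ∈ Metric.closedBall 0 R := by
    filter_upwards [ae_mem_sqMeasure hD g] with y hy using hDR hy
  have h0 : 0 ≤ ∫ x : 𝔼, nearRiesz α p (a * lengthScale d p ε) x :=
    integral_nonneg fun x => nearRiesz_nonneg hα hl.le x
  rw [nearFun, nearKernel_eq hε, smearedKernel_eq_smear hg (measurable_nearRiesz hα hl.le)
    (nearRiesz_nonneg hα hl.le), compensatedIntegral_eq_of_tendsto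
    (tendsto_compensatedPartial_of_support fun x hx =>
      smear_eq_zero hm (fun z hz => nearRiesz_eq_zero hα hl hz) hx),
    lintegral_smear _ (measurable_nearRiesz hα hl.le), sqMeasure_univ hg,
    ← ofReal_integral_eq_lintegral_ofReal (integrable_nearRiesz hα hd hp hpd hl)
      (ae_of_all _ (nearRiesz_nonneg hα hl.le)), ← ENNReal.ofReal_mul (by positivity),
    ← ENNReal.ofReal_mul hε.le, EReal.coe_ennreal_ofReal, max_eq_left (by positivity)]
  congr 2
  ring

/-- Lower bound for the near part by the norm of `g` and one Poisson integral that does not depend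
on `g`. -/
theorem le_nearFun (hα : IsSmoothTruncation α) (hd : d ≠ 0) (hp : 0 ≤ p) (hpd : p < d) {R : ℝ}
    (hR : 0 < R) {D : Set 𝔼} (hD : MeasurableSet D) (hDR : D ⊆ Metric.closedBall 0 R) {a ε : ℝ}
    (ha : 0 < a) (hε : 0 < ε) {ν : Measure 𝔼}
    (hν : ∀ n : ℕ, contractedField ε ν (Metric.ball 0 (n : ℝ)) < ⊤) {g : 𝔼 → ℝ}
    (hg : MemLp g 2 (volume.restrict D)) :
    ((l2Norm D g ^ 2 *
        (∫ x, shiftedRiesz α p (a * lengthScale d p ε) R x ∂(contractedField ε ν) -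
          ε * ∫ x : 𝔼, nearRiesz α p (a * lengthScale d p ε) x) : ℝ) : EReal) ≤
      nearFun D α p a ε ν g := by
  have hl : 0 < a * lengthScale d p ε := mul_pos ha (lengthScale_pos hε)
  have hnn := shiftedRiesz_nonneg (d := d) (p := p) hα hl R
  rw [nearFun_eq hα hd hp hpd hD hDR ha hε ν hg, mul_sub, EReal.coe_sub]
  refine EReal.sub_le_sub ?_ le_rfl
  have h1 : ((l2Norm D g ^ 2 * ∫ x, shiftedRiesz α p (a * lengthScale d p ε) R x
      ∂(contractedField ε ν) : ℝ) : EReal) = ((sqMeasure D g univ * ∫⁻ x, ENNReal.ofReal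
        (shiftedRiesz α p (a * lengthScale d p ε) R x) ∂(contractedField ε ν) : ℝ≥0∞) : EReal) := by
    rw [sqMeasure_univ hg, ← ofReal_integral_eq_lintegral_ofReal
      (integrable_shiftedRiesz_of_ball hα hp hl hR.ne' hν) (ae_of_all _ hnn),
      ← ENNReal.ofReal_mul (by positivity), EReal.coe_ennreal_ofReal, max_eq_left]
    exact mul_nonneg (by positivity) (integral_nonneg hnn)
  rw [h1, EReal.coe_ennreal_le_coe_ennreal_iff, ← lintegral_const_mul _
    (measurable_shiftedRiesz hα hl R).ennreal_ofReal]
  refine lintegral_mono fun x => ?_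
  rw [smear, mul_comm (sqMeasure D g univ), ← lintegral_const]
  refine lintegral_mono_ae ?_
  have hx : ∀ᵐ y ∂(sqMeasure D g), y ≠ x := by
    have : Nonempty (Fin d) := ⟨⟨0, Nat.pos_of_ne_zero hd⟩⟩
    exact (sqMeasure_absolutelyContinuous D g).ae_le (compl_mem_ae_iff.2 (measure_singleton x))
  filter_upwards [ae_mem_sqMeasure hD g, hx] with y hy hyx
  exact ENNReal.ofReal_le_ofReal
    (shiftedRiesz_le_nearRiesz_sub hα hp hl (by simpa using hDR hy) hyx)

/-- Upper bound for the near part in the absence of obstacles close to `D`. -/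
theorem nearFun_le (hα : IsSmoothTruncation α) (hd : d ≠ 0) (hp : 0 ≤ p) (hpd : p < d) {R : ℝ}
    (hR : 0 < R) {D : Set 𝔼} (hD : MeasurableSet D) (hDR : D ⊆ Metric.closedBall 0 R) {a ε : ℝ}
    (ha : 0 < a) (hε : 0 < ε) {ν : Measure 𝔼}
    (hν : ∀ n : ℕ, contractedField ε ν (Metric.ball 0 (n : ℝ)) < ⊤)
    (hν0 : contractedField ε ν (Metric.ball 0 (2 * R)) = 0) {g : 𝔼 → ℝ}
    (hg : MemLp g 2 (volume.restrict D)) :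
    nearFun D α p a ε ν g ≤ ((l2Norm D g ^ 2 *
        (∫ x, shiftedRiesz α p (a * lengthScale d p ε) (-R) x ∂(contractedField ε ν) -
          ε * ∫ x : 𝔼, nearRiesz α p (a * lengthScale d p ε) x) : ℝ) : EReal) := by
  have hl : 0 < a * lengthScale d p ε := mul_pos ha (lengthScale_pos hε)
  have hnn := shiftedRiesz_nonneg (d := d) (p := p) hα hl (-R)
  rw [nearFun_eq hα hd hp hpd hD hDR ha hε ν hg, mul_sub, EReal.coe_sub]
  refine EReal.sub_le_sub ?_ le_rfl
  have h1 : ((l2Norm D g ^ 2 * ∫ x, shiftedRiesz α p (a * lengthScale d p ε) (-R) x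
      ∂(contractedField ε ν) : ℝ) : EReal) = ((sqMeasure D g univ * ∫⁻ x, ENNReal.ofReal
        (shiftedRiesz α p (a * lengthScale d p ε) (-R) x) ∂(contractedField ε ν) : ℝ≥0∞) :
          EReal) := by
    rw [sqMeasure_univ hg, ← ofReal_integral_eq_lintegral_ofReal
      (integrable_shiftedRiesz_of_ball hα hp hl (neg_ne_zero.2 hR.ne') hν) (ae_of_all _ hnn),
      ← ENNReal.ofReal_mul (by positivity), EReal.coe_ennreal_ofReal, max_eq_left]
    exact mul_nonneg (by positivity) (integral_nonneg hnn)
  rw [h1, EReal.coe_ennreal_le_coe_ennreal_iff, ← lintegral_const_mul _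
    (measurable_shiftedRiesz hα hl (-R)).ennreal_ofReal]
  refine lintegral_mono_ae ?_
  filter_upwards [measure_eq_zero_iff_ae_notMem.1 hν0] with x hx
  rw [smear, mul_comm (sqMeasure D g univ), ← lintegral_const]
  refine lintegral_mono_ae ?_
  filter_upwards [ae_mem_sqMeasure hD g] with y hy
  exact ENNReal.ofReal_le_ofReal
    (nearRiesz_sub_le_shiftedRiesz hα hp hl hR (by simpa using hDR hy) (by simpa using hx))

/-- The order `ε^{-(2-p)/d}` of the deviations. -/
noncomputable def levelScale (d : ℕ) (p ε : ℝ) : ℝ :=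
  speed d p ε * lengthScale d p ε ^ (-p)

theorem levelScale_pos {ε : ℝ} (hε : 0 < ε) : 0 < levelScale d p ε :=
  mul_pos (speed_pos hε) (Real.rpow_pos_of_pos (lengthScale_pos hε) _)

theorem lengthScale_rpow_mul_levelScale {ε : ℝ} (hε : 0 < ε) :
    lengthScale d p ε ^ p * levelScale d p ε = speed d p ε := by
  rw [levelScale, mul_left_comm, ← Real.rpow_add (lengthScale_pos hε), add_neg_cancel,
    Real.rpow_zero, mul_one]

theorem mul_integral_comp_shiftedRiesz (hd : d ≠ 0) (hpd : p < d) (F : ℝ → ℝ) (a b : ℝ) {ε : ℝ}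
    (hε : 0 < ε) :
    ε * ∫ x : 𝔼, F (shiftedRiesz α p (a * lengthScale d p ε) b x) =
      speed d p ε * ∫ u : 𝔼,
        F (lengthScale d p ε ^ (-p) * shiftedRiesz α p a (b / lengthScale d p ε) u) := by
  rw [integral_comp_shiftedRiesz F (lengthScale_pos hε), ← mul_assoc,
    mul_lengthScale_rpow hd hpd hε]

theorem mul_integral_shiftedRiesz (hd : d ≠ 0) (hpd : p < d) (a b : ℝ) {ε : ℝ} (hε : 0 < ε) :
    ε * ∫ x : 𝔼, shiftedRiesz α p (a * lengthScale d p ε) b x =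
      levelScale d p ε * ∫ u : 𝔼, shiftedRiesz α p a (b / lengthScale d p ε) u := by
  rw [mul_integral_comp_shiftedRiesz hd hpd (fun s => s) a b hε, integral_const_mul, levelScale,
    mul_assoc]

theorem mul_integral_expGap_shiftedRiesz (hd : d ≠ 0) (hpd : p < d) (a b lam : ℝ) {ε : ℝ}
    (hε : 0 < ε) :
    ε * ∫ x : 𝔼,
        expGap (lam * lengthScale d p ε ^ p * shiftedRiesz α p (a * lengthScale d p ε) b x) =
      speed d p ε * ∫ u : 𝔼, expGap (lam * shiftedRiesz α p a (b / lengthScale d p ε) u) := by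
  rw [mul_integral_comp_shiftedRiesz hd hpd (fun s => expGap (lam * lengthScale d p ε ^ p * s)) a b
    hε]
  congr 2
  ext u
  congr 1
  rw [← mul_assoc, mul_assoc lam, ← Real.rpow_add (lengthScale_pos hε), add_neg_cancel,
    Real.rpow_zero, mul_one]

theorem tendsto_div_lengthScale (hd : d ≠ 0) (hpd : p < d) (b : ℝ) :
    Tendsto (fun ε => b / lengthScale d p ε) (𝓝[>] 0) (𝓝 0) :=
  (tendsto_lengthScale hd hpd).const_div_atTop b

/-- The compensators of the shifted and of the near kernel differ by less than the order of the
deviations. -/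
theorem eventually_abs_integral_sub_le (hα : IsSmoothTruncation α) (hd : d ≠ 0) (hp : 0 ≤ p)
    (hpd : p < d) {a : ℝ} (ha : 0 < a) (b : ℝ) {δ : ℝ} (hδ : 0 < δ) :
    ∀ᶠ ε in 𝓝[>] (0 : ℝ), |ε * (∫ x : 𝔼, shiftedRiesz α p (a * lengthScale d p ε) b x) -
      ε * ∫ x : 𝔼, nearRiesz α p (a * lengthScale d p ε) x| ≤ δ * levelScale d p ε := by
  have h := (tendsto_integral_shiftedRiesz (d := d) hα hd hp hpd ha).comp
    (tendsto_div_lengthScale (p := p) hd hpd b)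
  filter_upwards [self_mem_nhdsWithin, h.eventually (Metric.closedBall_mem_nhds _ hδ)] with ε hε h1
  have hε0 : 0 < ε := hε
  rw [← shiftedRiesz_zero, mul_integral_shiftedRiesz hd hpd a b hε0,
    mul_integral_shiftedRiesz hd hpd a 0 hε0, zero_div, shiftedRiesz_zero, ← mul_sub, abs_mul,
    abs_of_pos (levelScale_pos hε0), mul_comm]
  exact mul_le_mul_of_nonneg_right h1 (levelScale_pos hε0).le

theorem integral_smul_ofReal {ε : ℝ} (hε : 0 ≤ ε) (f : 𝔼 → ℝ) :
    ∫ x, f x ∂(ENNReal.ofReal ε • volume) = ε * ∫ x, f x := by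
  rw [integral_smul_measure, ENNReal.toReal_ofReal hε, smul_eq_mul]

/-- Chernoff's bound for the lower tail of the radial minorant of the near part. -/
theorem measure_compInt_shiftedRiesz_le {Ω : Type*} [MeasurableSpace Ω] {P : Measure Ω}
    [IsProbabilityMeasure P] (hα : IsSmoothTruncation α) (hp : (d : ℝ) < 2 * p) (hpd : p < d)
    {N : Ω → Measure 𝔼} (hN : IsPoissonField P N) {R : ℝ} (hR : 0 < R) {a ε : ℝ} (ha : 0 < a)
    (hε : 0 < ε) {lam : ℝ} (hlam : 0 ≤ lam) (x : ℝ) :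
    P {w | compInt (fun w => contractedField ε (N w)) (ENNReal.ofReal ε • volume)
        (shiftedRiesz α p (a * lengthScale d p ε) R) w ≤ -(x * levelScale d p ε)} ≤
      ENNReal.ofReal (rexp (-(lam * x - rieszCumulant d p lam) * speed d p ε)) := by
  have hd : d ≠ 0 := by rintro rfl; simp at hpd; simp at hp; linarith
  have hp0 : 0 ≤ p := by linarith [(Nat.cast_nonneg d : (0 : ℝ) ≤ d)]
  have hρ := lengthScale_pos (d := d) (p := p) hε
  have hl : 0 < a * lengthScale d p ε := mul_pos ha hρ
  refine ((isPoissonMeasure_contractedField hd hN hε).measure_compInt_le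
    (isTame_shiftedRiesz hα hp0 hl hR.ne' ε) (t := lam * lengthScale d p ε ^ p) (by positivity)
    _).trans (ENNReal.ofReal_le_ofReal (Real.exp_le_exp.2 ?_))
  have h1 := mul_integral_expGap_shiftedRiesz (α := α) hd hpd a R lam hε
  have h2 := integral_expGap_shiftedRiesz_le hα hd hp hpd ha (div_pos hR hρ).le hlam
  have h3 := lengthScale_rpow_mul_levelScale (d := d) (p := p) hε
  rw [integral_smul_ofReal hε.le]
  simp only [expGap] at h1 h2
  rw [h1]
  have h4 := mul_le_mul_of_nonneg_left h2 (speed_pos (d := d) (p := p) hε).le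
  have h5 : lam * lengthScale d p ε ^ p * (x * levelScale d p ε) = lam * x * speed d p ε := by
    rw [← h3]; ring
  rw [h5]
  linarith

end NearBounds

/-! ### Upper bound -/

section UpperBound

variable {d : ℕ} {p : ℝ} {α : ℝ → ℝ}

local notation "𝔼" => EuclideanSpace ℝ (Fin d)

theorem deviationLevel_eq_mul_levelScale (hd : d ≠ 0) (hpd : p < d) (γ : ℝ) {ε : ℝ} (hε : 0 < ε) :
    deviationLevel d p γ ε = γ * levelScale d p ε :=
  deviationLevel_eq hd hpd γ hε

/-- Upper bound for the probability that `ζ_ε` falls below the deviation level. A large far part is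
so unlikely that it does not count, and the near part is bounded below by the same Poisson integral
for all `g`. -/
theorem eventually_measure_iInf_zetaFun_le {Ω : Type*} [MeasurableSpace Ω] {P : Measure Ω}
    [IsProbabilityMeasure P] (hp0 : 0 < p) (hp : (d : ℝ) < 2 * p) (hpd : p < d)
    {N : Ω → Measure 𝔼} (hN : IsPoissonField P N) {D : Set 𝔼} (hD : MeasurableSet D) {R : ℝ}
    (hR : 0 < R) (hDR : D ⊆ Metric.closedBall 0 R) (hα : IsSmoothTruncation α) {γ x σ lam : ℝ}
    (hσ : ∀ g ∈ sobolevSphere D, l2Norm D g ^ 2 ≤ σ) (hσ0 : 0 ≤ σ) (hx : 0 ≤ x) (hxγ : x * σ < γ)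
    (hlam : 0 ≤ lam) (hB : 0 ≤ lam * x - rieszCumulant d p lam) :
    ∀ᶠ ε in 𝓝[>] (0 : ℝ),
      P {w | (⨅ g ∈ sobolevSphere D, zetaFun D p ε (N w) g) ≤
        ((-deviationLevel d p γ ε : ℝ) : EReal)} ≤
      ENNReal.ofReal (2 * rexp (-(lam * x - rieszCumulant d p lam) * speed d p ε)) := by
  have hd : d ≠ 0 := by rintro rfl; simp at hpd; linarith
  -- the slack between `x * σ` and `γ` is divided between the compensators and the far part
  set δ : ℝ := (γ - x * σ) / (σ + 1) with hδ
  have hδ0 : 0 < δ := div_pos (by linarith) (by linarith)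
  have hδ1 : σ * (x + δ) + δ = γ := by
    have : (σ + 1) * δ = γ - x * σ := by rw [hδ]; field_simp
    linarith
  obtain ⟨a, ha, ha0⟩ := ((eventually_exists_far_exceptional hp0 hp hpd hN hD hR.le hDR hα hδ0
    hB).and (eventually_gt_atTop 0)).exists
  filter_upwards [self_mem_nhdsWithin, ha,
    eventually_abs_integral_sub_le (d := d) hα hd hp0.le hpd ha0 R hδ0] with ε hε hfar hgap
  have hε0 : 0 < ε := hε
  obtain ⟨S, hS, hSw⟩ := hfar
  have hlev := levelScale_pos (d := d) (p := p) hε0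
  set T : Set Ω := {w | compInt (fun w => contractedField ε (N w)) (ENNReal.ofReal ε • volume)
        (shiftedRiesz α p (a * lengthScale d p ε) R) w ≤ -(x * levelScale d p ε)} with hT
  have hsub : {w | (⨅ g ∈ sobolevSphere D, zetaFun D p ε (N w) g) ≤
        ((-deviationLevel d p γ ε : ℝ) : EReal)} ⊆ S ∪ T := by
    intro w hw
    by_contra hnot
    rw [mem_union, not_or] at hnot
    obtain ⟨hball, b, hb, hz⟩ := hSw w hnot.1
    have hTw : -(x * levelScale d p ε) <
        compInt (fun w => contractedField ε (N w)) (ENNReal.ofReal ε • volume)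
        (shiftedRiesz α p (a * lengthScale d p ε) R) w := not_le.1 hnot.2
    rw [compInt, integral_smul_ofReal hε0.le] at hTw
    rw [deviationLevel_eq_mul_levelScale hd hpd δ hε0] at hb
    have hle : ((-(σ * ((x + δ) * levelScale d p ε)) - b : ℝ) : EReal) ≤
        ⨅ g ∈ sobolevSphere D, zetaFun D p ε (N w) g := by
      refine le_iInf₂ fun g hg => ?_
      have hg2 := memLp_of_mem_sobolevSphere hg
      obtain ⟨z, hz1, hz2⟩ := hz g hg
      rw [zetaFun_eq_add hα hp0 hpd hD hDR ha0 hε0 hball hg2 hz2, farFun,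
        compensatedIntegral_eq_of_tendsto hz2, sub_eq_add_neg, EReal.coe_add]
      refine add_le_add (le_trans (EReal.coe_le_coe_iff.2 ?_)
        (le_nearFun hα hd hp0.le hpd hR hD hDR ha0 hε0 hball hg2))
        (EReal.coe_le_coe_iff.2 (neg_le_of_abs_le hz1))
      have h1 := (abs_le.1 hgap).1
      have h2 : -((x + δ) * levelScale d p ε) ≤
          ∫ x, shiftedRiesz α p (a * lengthScale d p ε) R x ∂(contractedField ε (N w)) -
          ε * ∫ x : 𝔼, nearRiesz α p (a * lengthScale d p ε) x := by linarith
      have h3 := mul_le_mul_of_nonneg_left h2 (sq_nonneg (l2Norm D g))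
      have h4 := mul_le_mul_of_nonneg_right (hσ g hg)
        (show 0 ≤ (x + δ) * levelScale d p ε by positivity)
      linarith
    have h5 := EReal.coe_le_coe_iff.1 (hle.trans hw)
    rw [deviationLevel_eq_mul_levelScale hd hpd γ hε0, ← hδ1] at h5
    linarith
  refine (measure_mono hsub).trans ((measure_union_le _ _).trans ((add_le_add hS
    (measure_compInt_shiftedRiesz_le hα hp hpd hN hR ha0 hε0 hlam x)).trans ?_))
  rw [← ENNReal.ofReal_add (by positivity) (by positivity), two_mul]

end UpperBound

/-! ### Excluding obstacles close to the domain -/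

section LowerBound

variable {d : ℕ} {p : ℝ} {α : ℝ → ℝ}

local notation "𝔼" => EuclideanSpace ℝ (Fin d)

/-- The number of points in a set is almost surely an integer. -/
theorem IsPoissonMeasure.ae_eq_zero_of_lt_one {Ω E : Type*} [MeasurableSpace Ω] [MeasurableSpace E]
    {P : Measure Ω} {M : Ω → Measure E} {μ : Measure E} (hM : IsPoissonMeasure P M μ) {A : Set E}
    (hA : MeasurableSet A) (hμA : μ A ≠ ⊤) : ∀ᵐ w ∂P, M w A < 1 → M w A = 0 := by
  have hmeas := hM.measurable_apply hA
  have hset : MeasurableSet {c : ℝ≥0∞ | c < 1 → c = 0} := by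
    have : {c : ℝ≥0∞ | c < 1 → c = 0} = {c | c < 1}ᶜ ∪ {0} := by
      ext c; simp [imp_iff_not_or, or_comm]
    rw [this]
    exact (measurableSet_lt measurable_id measurable_const).compl.union (measurableSet_singleton 0)
  have h : ∀ᵐ c ∂(P.map fun w => M w A), c < 1 → c = 0 := by
    rw [hM.count_law A hA hμA, ae_map_iff (by fun_prop) hset]
    refine ae_of_all _ fun n hn => ?_
    have : n < 1 := by exact_mod_cast hn
    rw [Nat.lt_one_iff.1 this, Nat.cast_zero]
  exact (ae_map_iff hmeas.aemeasurable hset).1 h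

/-- The radial majorant of the near part outside a ball, plus a large constant on the ball. The
constant is there to make an obstacle in the ball incompatible with a negative value of the
compensated integral. -/
noncomputable def guardedRiesz {d : ℕ} (α : ℝ → ℝ) (p l R T : ℝ)
    (x : EuclideanSpace ℝ (Fin d)) : ℝ :=
  shiftedRiesz α p l (-R) x + T * (Metric.ball 0 (2 * R)).indicator (fun _ => 1) x

theorem isTame_indicator_ball (ε r : ℝ) :
    IsTame (ENNReal.ofReal ε • volume : Measure 𝔼) ((Metric.ball 0 r).indicator fun _ => (1 : ℝ)) :=
  isTame_indicator measurable_const measurableSet_ball (smul_volume_ball_ne_top ε r)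
    (C := 1) fun x _ => by simp

theorem isTame_guardedRiesz (hα : IsSmoothTruncation α) (hp : 0 ≤ p) {l : ℝ} (hl : 0 < l) {R : ℝ}
    (hR : 0 < R) (T ε : ℝ) :
    IsTame (ENNReal.ofReal ε • volume : Measure 𝔼) (guardedRiesz α p l R T) :=
  (isTame_shiftedRiesz hα hp hl (neg_ne_zero.2 hR.ne') ε).add
    ((isTame_indicator_ball ε (2 * R)).const_mul T)

theorem integral_indicator_ball_one (r : ℝ) (ν : Measure 𝔼) :
    ∫ x, (Metric.ball (0 : 𝔼) r).indicator (fun _ => (1 : ℝ)) x ∂ν = ν.real (Metric.ball 0 r) := by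
  rw [integral_indicator measurableSet_ball, setIntegral_const, smul_eq_mul, mul_one]

theorem integral_expGap_guardedRiesz (hα : IsSmoothTruncation α) (hd : d ≠ 0) (hp : 0 ≤ p)
    (hpd : p < d) {l : ℝ} (hl : 0 < l) (R T : ℝ) {t : ℝ} (ht : 0 ≤ t) :
    ∫ x : 𝔼, expGap (t * guardedRiesz α p l R T x) =
      (∫ x : 𝔼, expGap (t * shiftedRiesz α p l (-R) x)) +
        expGap (t * T) * volume.real (Metric.ball (0 : 𝔼) (2 * R)) := by
  rw [← integral_indicator_ball_one, ← integral_const_mul, ← integral_add]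
  · refine integral_congr_ae (ae_of_all _ fun x => ?_)
    simp only [guardedRiesz]
    by_cases hx : x ∈ Metric.ball (0 : 𝔼) (2 * R)
    · rw [shiftedRiesz_neg_eq_zero (by simpa using hx), indicator_of_mem hx, mul_one, mul_one,
        mul_zero, expGap_zero, zero_add, zero_add]
    · rw [indicator_of_notMem hx, mul_zero, mul_zero, add_zero, add_zero]
  · refine ((integrable_shiftedRiesz hα hd hp hpd hl (-R)).const_mul t).mono'
      (continuous_expGap.measurable.comp
        ((measurable_shiftedRiesz hα hl _).const_mul t)).aestronglyMeasurable (ae_of_all _ fun x => ?_)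
    rw [Real.norm_of_nonneg (expGap_nonneg _)]
    exact expGap_le_self (mul_nonneg ht (shiftedRiesz_nonneg hα hl _ x))
  · exact ((integrable_indicator_iff measurableSet_ball).2
      (integrableOn_const measure_ball_lt_top.ne)).const_mul _

/-- The size of the constant in `guardedRiesz` that makes an obstacle in the ball incompatible with
a negative value. -/
noncomputable def guardHeight (d : ℕ) (p a ε : ℝ) : ℝ :=
  2 * ((∫ u : EuclideanSpace ℝ (Fin d),
    (Metric.ball 0 (6 * a)).indicator (fun u => 2 ^ p * ‖u‖ ^ (-p)) u) + 1) * levelScale d p ε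

theorem guardConst_nonneg (a : ℝ) :
    0 ≤ ∫ u : 𝔼, (Metric.ball 0 (6 * a)).indicator (fun u => 2 ^ p * ‖u‖ ^ (-p)) u :=
  integral_nonneg fun u => indicator_nonneg (fun u _ => by positivity) u

/-- If the compensated integral of `guardedRiesz` is at most `-y ≤ 0`, then there are no obstacles
in the ball, and the near part is small. -/
theorem nearFun_le_of_compInt_guardedRiesz_le (hα : IsSmoothTruncation α) (hd : d ≠ 0) (hp : 0 ≤ p)
    (hpd : p < d) {R : ℝ} (hR : 0 < R) {D : Set 𝔼} (hD : MeasurableSet D)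
    (hDR : D ⊆ Metric.closedBall 0 R) {a ε δ : ℝ} (ha : 0 < a) (hε : 0 < ε)
    {Ω : Type*} {N : Ω → Measure 𝔼} {w : Ω}
    (hν : ∀ n : ℕ, contractedField ε (N w) (Metric.ball 0 (n : ℝ)) < ⊤)
    (hν1 : contractedField ε (N w) (Metric.ball 0 (2 * R)) < 1 →
      contractedField ε (N w) (Metric.ball 0 (2 * R)) = 0)
    {g : 𝔼 → ℝ} (hg : MemLp g 2 (volume.restrict D))
    (hgap : |ε * (∫ x : 𝔼, shiftedRiesz α p (a * lengthScale d p ε) (-R) x) -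
      ε * ∫ x : 𝔼, nearRiesz α p (a * lengthScale d p ε) x| ≤ δ * levelScale d p ε)
    (hvol : ε * volume.real (Metric.ball (0 : 𝔼) (2 * R)) ≤ 1 / 2)
    (hvolδ : guardHeight d p a ε * (ε * volume.real (Metric.ball (0 : 𝔼) (2 * R))) ≤
      δ * levelScale d p ε) {y : ℝ} (hy : 0 ≤ y)
    (h : compInt (fun w => contractedField ε (N w)) (ENNReal.ofReal ε • volume)
      (guardedRiesz α p (a * lengthScale d p ε) R (guardHeight d p a ε)) w ≤ -y) :
    nearFun D α p a ε (N w) g ≤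
      ((l2Norm D g ^ 2 * (-y + 2 * δ * levelScale d p ε) : ℝ) : EReal) := by
  have hρ := lengthScale_pos (d := d) (p := p) hε
  have hl : 0 < a * lengthScale d p ε := mul_pos ha hρ
  have hlev := levelScale_pos (d := d) (p := p) hε
  have hC := guardConst_nonneg (d := d) (p := p) a
  set T := guardHeight d p a ε with hT
  set ν := contractedField ε (N w) with hνdef
  have hball : ν (Metric.ball 0 (2 * R)) ≠ ⊤ := by
    obtain ⟨n, hn⟩ := exists_nat_gt (2 * R)
    exact ((measure_mono (Metric.ball_subset_ball hn.le)).trans_lt (hν n)).ne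
  have hI : ∀ {κ : Measure 𝔼}, (κ (Metric.ball 0 (2 * R)) ≠ ⊤) →
      Integrable (shiftedRiesz α p (a * lengthScale d p ε) (-R)) κ →
      ∫ x, guardedRiesz α p (a * lengthScale d p ε) R T x ∂κ =
        (∫ x, shiftedRiesz α p (a * lengthScale d p ε) (-R) x ∂κ) +
          T * κ.real (Metric.ball 0 (2 * R)) := fun {κ} h1 h2 => by
    simp only [guardedRiesz]
    rw [integral_add h2, integral_const_mul, integral_indicator_ball_one]
    exact ((integrable_indicator_iff measurableSet_ball).2 (integrableOn_const h1)).const_mul _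
  rw [compInt, integral_smul_ofReal hε.le,
    hI hball (integrable_shiftedRiesz_of_ball hα hp hl (neg_ne_zero.2 hR.ne') hν),
    hI measure_ball_lt_top.ne (integrable_shiftedRiesz hα hd hp hpd hl (-R))] at h
  have hint : ε * ∫ x : 𝔼, shiftedRiesz α p (a * lengthScale d p ε) (-R) x ≤
      levelScale d p ε * ∫ u : 𝔼, (Metric.ball 0 (6 * a)).indicator
        (fun u => 2 ^ p * ‖u‖ ^ (-p)) u := by
    rw [mul_integral_shiftedRiesz hd hpd a (-R) hε]
    refine mul_le_mul_of_nonneg_left (integral_mono_ae (integrable_shiftedRiesz hα hd hp hpd ha _)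
      (integrable_shiftedRiesz_bound hd hpd a) ?_) hlev.le
    filter_upwards [ae_ne_zero hd] with x hx using shiftedRiesz_le_indicator hα hp ha _ hx
  have hTpos : 0 < T := by rw [hT, guardHeight]; positivity
  have hpos : 0 ≤ ∫ x, shiftedRiesz α p (a * lengthScale d p ε) (-R) x ∂ν :=
    integral_nonneg (shiftedRiesz_nonneg hα hl (-R))
  -- one obstacle in the ball would contribute `T`, more than the compensator of the whole function
  have hempty : ν (Metric.ball 0 (2 * R)) = 0 := by
    refine hν1 ?_
    have h1 : T * ν.real (Metric.ball 0 (2 * R)) < T * 1 := by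
      have h2 := mul_le_mul_of_nonneg_left hvol hTpos.le
      have h3 : T = 2 * (levelScale d p ε * ∫ u : 𝔼, (Metric.ball 0 (6 * a)).indicator
        (fun u => 2 ^ p * ‖u‖ ^ (-p)) u) + 2 * levelScale d p ε := by
        rw [hT, guardHeight]; ring
      linarith
    have h4 := lt_of_mul_lt_mul_left h1 hTpos.le
    rw [Measure.real] at h4
    rw [← ENNReal.ofReal_toReal hball, ← ENNReal.ofReal_one]
    exact (ENNReal.ofReal_lt_ofReal_iff one_pos).2 h4
  refine (nearFun_le hα hd hp hpd hR hD hDR ha hε hν hempty hg).trans (EReal.coe_le_coe_iff.2 ?_)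
  refine mul_le_mul_of_nonneg_left ?_ (sq_nonneg _)
  have h5 := (abs_le.1 hgap).2
  have h6 : ν.real (Metric.ball 0 (2 * R)) = 0 := by rw [Measure.real, hempty, ENNReal.toReal_zero]
  rw [h6, mul_zero, add_zero] at h
  linarith

/-- The logarithm of the moment generating function of the compensated integral of
`guardedRiesz`, on the scale of the large deviations. -/
noncomputable def guardedCumulant (d : ℕ) (α : ℝ → ℝ) (p a R ε lam : ℝ) : ℝ :=
  (∫ u : EuclideanSpace ℝ (Fin d), expGap (lam * shiftedRiesz α p a (-R / lengthScale d p ε) u)) +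
    ε * volume.real (Metric.ball (0 : EuclideanSpace ℝ (Fin d)) (2 * R)) *
      expGap (lam * lengthScale d p ε ^ p * guardHeight d p a ε) / speed d p ε

theorem mgf_compInt_guardedRiesz {Ω : Type*} [MeasurableSpace Ω] {P : Measure Ω}
    [IsProbabilityMeasure P] (hα : IsSmoothTruncation α) (hd : d ≠ 0) (hp : 0 ≤ p) (hpd : p < d)
    {N : Ω → Measure 𝔼} (hN : IsPoissonField P N) {R : ℝ} (hR : 0 < R) {a ε : ℝ} (ha : 0 < a)
    (hε : 0 < ε) {lam : ℝ} (hlam : 0 ≤ lam) :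
    mgf (compInt (fun w => contractedField ε (N w)) (ENNReal.ofReal ε • volume)
      (guardedRiesz α p (a * lengthScale d p ε) R (guardHeight d p a ε))) P
        (-(lam * lengthScale d p ε ^ p)) =
      rexp (guardedCumulant d α p a R ε lam * speed d p ε) := by
  have hρ := lengthScale_pos (d := d) (p := p) hε
  have hn := speed_pos (d := d) (p := p) hε
  have hl : 0 < a * lengthScale d p ε := mul_pos ha hρ
  have h1 := ((isPoissonMeasure_contractedField hd hN hε).exp_compInt
    (isTame_guardedRiesz hα hp hl hR (guardHeight d p a ε) ε) (-(lam * lengthScale d p ε ^ p))).2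
  rw [mgf, h1, integral_smul_ofReal hε.le]
  congr 1
  have h2 := integral_expGap_guardedRiesz (d := d) hα hd hp hpd hl R (guardHeight d p a ε)
    (t := lam * lengthScale d p ε ^ p) (by positivity)
  have h3 := mul_integral_expGap_shiftedRiesz (α := α) hd hpd a (-R) lam hε
  have h4 : (fun x : 𝔼 => rexp (-(lam * lengthScale d p ε ^ p) *
      guardedRiesz α p (a * lengthScale d p ε) R (guardHeight d p a ε) x) - 1 -
      -(lam * lengthScale d p ε ^ p) *
        guardedRiesz α p (a * lengthScale d p ε) R (guardHeight d p a ε) x) =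
      fun x => expGap (lam * lengthScale d p ε ^ p *
        guardedRiesz α p (a * lengthScale d p ε) R (guardHeight d p a ε) x) := by
    ext x
    rw [expGap, neg_mul, sub_neg_eq_add]
  rw [h4, h2, mul_add, h3, guardedCumulant, add_mul, div_mul_cancel₀ _ hn.ne']
  ring

/-- The ball has a volume of order one, so the indicator does not contribute in the limit. -/
theorem tendsto_guardedCumulant (hα : IsSmoothTruncation α) (hd : d ≠ 0) (hp : 0 ≤ p) (hpd : p < d)
    (R : ℝ) {a : ℝ} (ha : 0 < a) {lam : ℝ} (hlam : 0 ≤ lam) :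
    Tendsto (fun ε => guardedCumulant d α p a R ε lam) (𝓝[>] 0) (𝓝 (nearCumulant d α p a lam)) := by
  have h1 := (tendsto_integral_expGap_shiftedRiesz hα hd hp hpd ha hlam).comp
    (tendsto_div_lengthScale (p := p) hd hpd (-R))
  rw [← add_zero (nearCumulant d α p a lam)]
  refine h1.add ?_
  have hC := guardConst_nonneg (d := d) (p := p) a
  set C := ∫ u : 𝔼, (Metric.ball 0 (6 * a)).indicator (fun u => 2 ^ p * ‖u‖ ^ (-p)) u with hCdef
  set V := volume.real (Metric.ball (0 : 𝔼) (2 * R)) with hV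
  have h2 : Tendsto (fun ε : ℝ => ε * (V * (lam * (2 * (C + 1))))) (𝓝[>] 0) (𝓝 0) := by
    have : Tendsto (fun ε : ℝ => ε * (V * (lam * (2 * (C + 1))))) (𝓝 0)
      (𝓝 (0 * (V * (lam * (2 * (C + 1)))))) := tendsto_id.mul_const _
    rw [zero_mul] at this
    exact this.mono_left nhdsWithin_le_nhds
  refine squeeze_zero' ?_ ?_ h2
  · filter_upwards [self_mem_nhdsWithin] with ε hε
    have hε0 : 0 < ε := hε
    have hn := speed_pos (d := d) (p := p) hε0
    exact div_nonneg (mul_nonneg (mul_nonneg hε0.le measureReal_nonneg) (expGap_nonneg _)) hn.le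
  · filter_upwards [self_mem_nhdsWithin] with ε hε
    have hε0 : 0 < ε := hε
    have hn := speed_pos (d := d) (p := p) hε0
    have hρ := lengthScale_pos (d := d) (p := p) hε0
    have hV0 : 0 ≤ V := measureReal_nonneg
    have hlev := levelScale_pos (d := d) (p := p) hε0
    have h3 : lam * lengthScale d p ε ^ p * guardHeight d p a ε =
        lam * (2 * (C + 1)) * speed d p ε := by
      rw [← lengthScale_rpow_mul_levelScale (d := d) (p := p) hε0, guardHeight, ← hCdef]; ring
    rw [h3, div_le_iff₀ hn]
    have h4 := expGap_le_self (s := lam * (2 * (C + 1)) * speed d p ε) (by positivity)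
    calc ε * V * expGap (lam * (2 * (C + 1)) * speed d p ε) ≤
          ε * V * (lam * (2 * (C + 1)) * speed d p ε) := by gcongr
      _ = _ := by ring

end LowerBound

/-! ### The class of admissible functions -/

section Sphere

variable {d : ℕ}

local notation "𝔼" => EuclideanSpace ℝ (Fin d)

theorem l2Norm_const_mul {D : Set 𝔼} (k : ℝ) (f : 𝔼 → ℝ) :
    l2Norm D (fun x => k * f x) = |k| * l2Norm D f := by
  have h : (fun x => k * f x) = k • f := rfl
  rw [h, l2Norm, eLpNorm_const_smul, ENNReal.toReal_mul, toReal_enorm, Real.norm_eq_abs, l2Norm]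

theorem continuous_gradient {φ : 𝔼 → ℝ} (hφ : ContDiff ℝ ∞ φ) : Continuous (gradient φ) :=
  (InnerProductSpace.toDual ℝ 𝔼).symm.continuous.comp (hφ.continuous_fderiv (by simp))

theorem hasCompactSupport_gradient {φ : 𝔼 → ℝ} (hφ : HasCompactSupport φ) :
    HasCompactSupport (gradient φ) :=
  (hφ.fderiv ℝ).comp_left (g := (InnerProductSpace.toDual ℝ 𝔼).symm) (map_zero _)

theorem gradient_const_mul {φ : 𝔼 → ℝ} (hφ : ContDiff ℝ ∞ φ) (k : ℝ) :
    gradient (fun x => k * φ x) = k • gradient φ := by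
  ext1 x
  rw [gradient, fderiv_const_mul (hφ.differentiable (by simp) x), map_smulₛₗ]
  simp [gradient]

theorem hasSobolevGradient_of_contDiff {D : Set 𝔼} {φ : 𝔼 → ℝ} (h1 : ContDiff ℝ ∞ φ)
    (h2 : HasCompactSupport φ) (h3 : tsupport φ ⊆ D) : HasSobolevGradient D φ (gradient φ) := by
  refine ⟨h1.continuous.memLp_of_hasCompactSupport h2,
    (continuous_gradient h1).memLp_of_hasCompactSupport (hasCompactSupport_gradient h2),
    fun _ => φ, fun _ => ⟨h1, h2, h3⟩, ?_, ?_⟩ <;> simp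

/-- The class `𝒢_d(D)` contains a multiple of a bump function. -/
theorem exists_mem_sobolevSphere {D : Set 𝔼} (hD : IsOpen D) (hne : D.Nonempty) :
    ∃ g ∈ sobolevSphere D, 0 < l2Norm D g := by
  obtain ⟨c, hc⟩ := hne
  obtain ⟨r, hr, hrD⟩ := Metric.isOpen_iff.1 hD c hc
  let b : ContDiffBump c := ⟨r / 4, r / 2, by positivity, by linarith⟩
  have h1 : ContDiff ℝ ∞ (b : 𝔼 → ℝ) := b.contDiff
  have h2 : HasCompactSupport (b : 𝔼 → ℝ) := b.hasCompactSupport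
  have h3 : tsupport (b : 𝔼 → ℝ) ⊆ D := by
    rw [b.tsupport_eq]
    exact (Metric.closedBall_subset_ball (half_lt_self hr)).trans hrD
  have hpos : 0 < l2Norm D (b : 𝔼 → ℝ) := by
    have hm : MemLp (b : 𝔼 → ℝ) 2 (volume.restrict D) :=
      h1.continuous.memLp_of_hasCompactSupport h2
    refine ENNReal.toReal_pos (fun h => ?_) hm.eLpNorm_ne_top
    rw [eLpNorm_eq_zero_iff hm.aestronglyMeasurable (by norm_num)] at h
    have h4 := Measure.eqOn_open_of_ae_eq h hD h1.continuous.continuousOn continuousOn_const hc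
    have h5 : b c = 1 := b.one_of_mem_closedBall (Metric.mem_closedBall_self b.rIn_pos.le)
    rw [h5] at h4
    exact one_ne_zero h4
  set s := l2Norm D (b : 𝔼 → ℝ) ^ 2 + 1 / 2 * l2Norm D (gradient (b : 𝔼 → ℝ)) ^ 2 with hs
  have hs0 : 0 < s := by positivity
  have hk : 0 < (√s)⁻¹ := inv_pos.2 (Real.sqrt_pos.2 hs0)
  refine ⟨fun x => (√s)⁻¹ * b x, ⟨gradient fun x => (√s)⁻¹ * b x, hasSobolevGradient_of_contDiff
    (contDiff_const.mul h1) h2.mul_left ((tsupport_mul_subset_right).trans h3), ?_⟩, ?_⟩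
  · have h6 : l2Norm D ((√s)⁻¹ • gradient (b : 𝔼 → ℝ)) =
        (√s)⁻¹ * l2Norm D (gradient (b : 𝔼 → ℝ)) := by
      rw [l2Norm, eLpNorm_const_smul, ENNReal.toReal_mul, toReal_enorm, Real.norm_eq_abs,
        abs_of_pos hk, l2Norm]
    rw [l2Norm_const_mul, gradient_const_mul h1, h6, abs_of_pos hk, mul_pow, mul_pow, inv_pow,
      Real.sq_sqrt hs0.le]
    have h7 : s⁻¹ * s = 1 := inv_mul_cancel₀ hs0.ne'
    linear_combination h7 - s⁻¹ * hs
  · rw [l2Norm_const_mul, abs_of_pos hk]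
    exact mul_pos hk hpos

theorem l2Norm_nonneg {F : Type*} [NormedAddCommGroup F] (D : Set 𝔼) (f : 𝔼 → F) : 0 ≤ l2Norm D f :=
  ENNReal.toReal_nonneg

theorem bddAbove_l2Norm_sobolevSphere (D : Set 𝔼) :
    BddAbove ((fun g => l2Norm D g) '' sobolevSphere D) := by
  refine ⟨1, ?_⟩
  rintro _ ⟨g, hg, rfl⟩
  have := l2Norm_sq_le_one hg
  exact (sq_le_one_iff₀ (l2Norm_nonneg D g)).1 this

end Sphere

/-! ### Legendre transform -/

section Legendre

variable {d : ℕ} {p : ℝ}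

local notation "𝔼" => EuclideanSpace ℝ (Fin d)

/-- The Legendre transform of `rieszCumulant`, in closed form. -/
noncomputable def rieszRate (d : ℕ) (p x : ℝ) : ℝ :=
  (x * ((d : ℝ) - p) / d) ^ ((d : ℝ) / ((d : ℝ) - p)) *
    (unitBallVolume d * Real.Gamma ((2 * p - (d : ℝ)) / p)) ^ (-(p / ((d : ℝ) - p)))

theorem rateFunction_eq_rieszRate (hpd : p < d) {D : Set 𝔼} {γ : ℝ} (hγ : 0 ≤ γ)
    (hσ : 0 < sSup ((fun g => l2Norm D g) '' sobolevSphere D)) :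
    rateFunction D p γ =
      rieszRate d p (γ / sSup ((fun g => l2Norm D g) '' sobolevSphere D) ^ 2) := by
  set σ := sSup ((fun g => l2Norm D g) '' sobolevSphere D) with hσdef
  have hdp : 0 < (d : ℝ) - p := by linarith
  have h1 : γ / σ ^ 2 * ((d : ℝ) - p) / d = γ * ((d : ℝ) - p) / d * (σ ^ 2)⁻¹ := by
    rw [div_eq_mul_inv]; ring
  have h0 : 0 ≤ γ * ((d : ℝ) - p) / d :=
    div_nonneg (mul_nonneg hγ hdp.le) (Nat.cast_nonneg d)
  rw [rateFunction, rieszRate, ← hσdef, h1, Real.mul_rpow h0 (by positivity),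
    ← Real.rpow_natCast, ← Real.rpow_neg hσ.le, ← Real.rpow_mul hσ.le]
  have h2 : -((2 : ℕ) : ℝ) * ((d : ℝ) / ((d : ℝ) - p)) = -(2 * (d : ℝ) / ((d : ℝ) - p)) := by
    push_cast; ring
  rw [h2]
  ring

theorem continuousAt_rieszRate (hd : d ≠ 0) (hpd : p < d) {x : ℝ} (hx : 0 < x) :
    ContinuousAt (rieszRate d p) x := by
  have hdp : 0 < (d : ℝ) - p := by linarith
  have hd' : 0 < (d : ℝ) := by positivity
  have h : ContinuousAt (fun x : ℝ => x * ((d : ℝ) - p) / d) x := by fun_prop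
  exact (h.rpow_const (Or.inl (by positivity))).mul continuousAt_const

/-- The point at which the Legendre transform is attained. The cumulant function is
`c θ^{d/p}` with `d/p > 1`, so the point solves `c q θ^{q-1} = x` with `q = d/p`. -/
theorem exists_dual_point (hd : d ≠ 0) (hp : (d : ℝ) < 2 * p) (hpd : p < d) {x : ℝ} (hx : 0 < x) :
    ∃ θ, 0 < θ ∧ HasDerivAt (rieszCumulant d p) x θ ∧
      θ * x - rieszCumulant d p θ = rieszRate d p x := by
  have hd' : 0 < (d : ℝ) := by positivity
  have hp0 : 0 < p := by linarith
  have hdp : 0 < (d : ℝ) - p := by linarith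
  have hc := rieszCumulant_one_pos hd hp hpd
  set c := rieszCumulant d p 1 with hcdef
  set q := (d : ℝ) / p with hq
  have hq1 : 1 < q := (one_lt_div hp0).2 hpd
  have hq0 : 0 < q := by linarith
  have hq10 : 0 < q - 1 := by linarith
  set θ := (x / (c * q)) ^ (1 / (q - 1)) with hθ
  have hθ0 : 0 < θ := by positivity
  have hpow : θ ^ (q - 1) = x / (c * q) := by
    rw [hθ, ← Real.rpow_mul (by positivity), one_div, inv_mul_cancel₀ hq10.ne', Real.rpow_one]
  have hx' : c * (q * θ ^ (q - 1)) = x := by rw [hpow]; field_simp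
  have hθq : c * θ ^ q = θ * x / q := by
    have : θ ^ q = θ ^ (q - 1) * θ := by
      nth_rewrite 3 [← Real.rpow_one θ]
      rw [← Real.rpow_add hθ0]; congr 1; ring
    rw [this, hpow]; field_simp
  refine ⟨θ, hθ0, ?_, ?_⟩
  · have h1 : HasDerivAt (fun y : ℝ => y ^ q * c) (q * θ ^ (q - 1) * c) θ :=
      (Real.hasDerivAt_rpow_const (Or.inl hθ0.ne')).mul_const c
    have h2 : q * θ ^ (q - 1) * c = x := by rw [← hx']; ring
    rw [h2] at h1
    refine h1.congr_of_eventuallyEq ?_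
    filter_upwards [lt_mem_nhds hθ0] with y hy using rieszCumulant_eq_rpow_mul hp0 hy
  · have e1 : rieszCumulant d p θ = θ * x / q := by
      rw [rieszCumulant_eq_rpow_mul hp0 hθ0, ← hcdef, ← hθq, mul_comm]
    set A := unitBallVolume d * Real.Gamma ((2 * p - d) / p) with hA
    have hcA : c = A / (q - 1) := rieszCumulant_one hd hp hpd
    have hA0 : 0 < A := by
      have : A = c * (q - 1) := by rw [hcA]; field_simp
      rw [this]; positivity
    have hq' : 1 - 1 / q = ((d : ℝ) - p) / d := by rw [hq]; field_simp
    have e2 : x / (c * q) = x * ((d : ℝ) - p) / d * A⁻¹ := by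
      rw [hcA, hq]; field_simp
    have e3 : 1 / (q - 1) = p / ((d : ℝ) - p) := by rw [hq]; field_simp
    have e4 : (d : ℝ) / ((d : ℝ) - p) = 1 + p / ((d : ℝ) - p) := by field_simp; ring
    have hy : 0 < x * ((d : ℝ) - p) / d := by positivity
    rw [e1, rieszRate, ← hA, e4, Real.rpow_add hy, Real.rpow_one, Real.rpow_neg hA0.le,
      ← Real.inv_rpow hA0.le, mul_assoc, ← Real.mul_rpow hy.le (by positivity), ← e2, ← e3, ← hθ,
      mul_div_assoc x, ← hq']
    ring

theorem rieszRate_pos (hd : d ≠ 0) (hp : (d : ℝ) < 2 * p) (hpd : p < d) {x : ℝ} (hx : 0 < x) :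
    0 < rieszRate d p x := by
  have hd' : 0 < (d : ℝ) := by positivity
  have hp0 : 0 < p := by linarith
  have hdp : 0 < (d : ℝ) - p := by linarith
  have h1 : 0 < unitBallVolume d :=
    ENNReal.toReal_pos (Metric.measure_ball_pos _ _ one_pos).ne' measure_ball_lt_top.ne
  have h2 : 0 < Real.Gamma ((2 * p - d) / p) := Real.Gamma_pos_of_pos (div_pos (by linarith) hp0)
  rw [rieszRate]
  positivity

/-- If `x` is the slope of `Λ` at `θ`, then the conditions under which tilting by `θ` is effective
hold for small `s`. -/
theorem exists_tilt_of_hasDerivAt {Λ : ℝ → ℝ} {x θ δ : ℝ} (h : HasDerivAt Λ x θ) (hθ : 0 < θ)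
    (hδ : 0 < δ) :
    ∃ s, 0 < s ∧ s ≤ θ ∧ Λ (θ + s) - s * (x + δ) < Λ θ ∧ Λ (θ - s) + s * (x - δ) < Λ θ := by
  have h1 := (hasDerivAt_iff_isLittleO_nhds_zero.1 h).def (half_pos hδ)
  obtain ⟨r, hr, hball⟩ := Metric.eventually_nhds_iff.1 h1
  have hs : 0 < min (r / 2) θ := lt_min (half_pos hr) hθ
  set s := min (r / 2) θ with hsdef
  have hsr : s < r := (min_le_left _ _).trans_lt (half_lt_self hr)
  have h2 := hball (y := s) (by rw [dist_zero_right, Real.norm_of_nonneg hs.le]; exact hsr)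
  have h3 := hball (y := -s) (by rw [dist_zero_right, norm_neg, Real.norm_of_nonneg hs.le]; exact hsr)
  rw [norm_neg] at h3
  rw [Real.norm_of_nonneg hs.le, Real.norm_eq_abs, abs_le, smul_eq_mul] at h2 h3
  have hsδ := mul_pos hs hδ
  rw [← sub_eq_add_neg] at h3
  exact ⟨s, hs, min_le_right _ _, by nlinarith [h2.2], by nlinarith [h3.2]⟩

end Legendre

/-! ### Lower bound -/

section LowerBound

variable {d : ℕ} {p : ℝ} {α : ℝ → ℝ}

local notation "𝔼" => EuclideanSpace ℝ (Fin d)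

/-- The exponential term with the largest exponent dominates. -/
theorem eventually_exp_le_sub_sub {ι : Type*} {F : Filter ι} {n f g h : ι → ℝ} {a b c η : ℝ}
    (hn : Tendsto n F atTop) (hf : Tendsto f F (𝓝 a)) (hg : Tendsto g F (𝓝 b))
    (hh : Tendsto h F (𝓝 c)) (hba : b < a) (hca : c < a) (hη : 0 < η) :
    ∀ᶠ i in F, rexp ((a - η) * n i) ≤ rexp (f i * n i) - rexp (g i * n i) - rexp (h i * n i) := by
  set m := min η (min (a - b) (a - c)) with hm
  have hm0 : 0 < m := lt_min hη (lt_min (by linarith) (by linarith))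
  have hm1 : m ≤ η := min_le_left _ _
  have hm2 : m ≤ a - b := (min_le_right _ _).trans (min_le_left _ _)
  have hm3 : m ≤ a - c := (min_le_right _ _).trans (min_le_right _ _)
  filter_upwards [hn.eventually_ge_atTop 0,
    (tendsto_exp_atTop.comp (hn.const_mul_atTop (show 0 < m / 4 by positivity))).eventually_ge_atTop 3,
    hf.eventually_const_le (show a - m / 4 < a by linarith),
    hg.eventually_le_const (show b < a - 3 * m / 4 by linarith),
    hh.eventually_le_const (show c < a - 3 * m / 4 by linarith)] with i h0 h1 h2 h3 h4
  have h1' : 3 ≤ rexp (m / 4 * n i) := h1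
  have e1 : rexp ((a - η) * n i) ≤ rexp ((a - 3 * m / 4) * n i) * rexp (m / 4 * n i) * 1 := by
    rw [mul_one, ← Real.exp_add]
    refine Real.exp_le_exp.2 ?_
    nlinarith
  have e2 : rexp ((a - 3 * m / 4) * n i) * (rexp (m / 4 * n i) * rexp (m / 4 * n i)) ≤
      rexp (f i * n i) := by
    rw [← Real.exp_add, ← Real.exp_add]
    refine Real.exp_le_exp.2 ?_
    nlinarith
  have e3 : rexp (g i * n i) ≤ rexp ((a - 3 * m / 4) * n i) :=
    Real.exp_le_exp.2 (mul_le_mul_of_nonneg_right h3 h0)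
  have e4 : rexp (h i * n i) ≤ rexp ((a - 3 * m / 4) * n i) :=
    Real.exp_le_exp.2 (mul_le_mul_of_nonneg_right h4 h0)
  have e5 := Real.exp_pos ((a - 3 * m / 4) * n i)
  nlinarith [mul_nonneg e5.le (show 0 ≤ rexp (m / 4 * n i) * rexp (m / 4 * n i) -
    rexp (m / 4 * n i) - 2 by nlinarith)]

/-- Lower bound for the probability that the near part is small for one `g`, by tilting. -/
theorem eventually_exp_le_measureReal_nearFun_le {Ω : Type*} [MeasurableSpace Ω] {P : Measure Ω}
    [IsProbabilityMeasure P] (hα : IsSmoothTruncation α) (hd : d ≠ 0) (hp : 0 ≤ p) (hpd : p < d)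
    {N : Ω → Measure 𝔼} (hN : IsPoissonField P N) {D : Set 𝔼} (hD : MeasurableSet D) {R : ℝ}
    (hR : 0 < R) (hDR : D ⊆ Metric.closedBall 0 R) {g : 𝔼 → ℝ} (hg : MemLp g 2 (volume.restrict D))
    {a γ x δ θ s η : ℝ} (ha : 0 < a) (hδ : 0 < δ) (hδx : δ ≤ x)
    (hγ : γ ≤ l2Norm D g ^ 2 * (x - 3 * δ)) (hs : 0 ≤ s) (hsθ : s ≤ θ) (hη : 0 < η)
    (h1 : nearCumulant d α p a (θ + s) - s * (x + δ) < nearCumulant d α p a θ)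
    (h2 : nearCumulant d α p a (θ - s) + s * (x - δ) < nearCumulant d α p a θ) :
    ∀ᶠ ε in 𝓝[>] (0 : ℝ),
      rexp ((nearCumulant d α p a θ - θ * (x + δ) - η) * speed d p ε) ≤
        P.real {w | nearFun D α p a ε (N w) g ≤ ((-deviationLevel d p γ ε : ℝ) : EReal)} := by
  have hθ : 0 ≤ θ := hs.trans hsθ
  set V := volume.real (Metric.ball (0 : 𝔼) (2 * R)) with hV
  have hC := guardConst_nonneg (d := d) (p := p) a
  set C := ∫ u : 𝔼, (Metric.ball 0 (6 * a)).indicator (fun u => 2 ^ p * ‖u‖ ^ (-p)) u with hCdef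
  have hid : Tendsto (fun ε : ℝ => ε * V) (𝓝[>] 0) (𝓝 0) := by
    have : Tendsto (fun ε : ℝ => ε * V) (𝓝 0) (𝓝 (0 * V)) := tendsto_id.mul_const _
    rw [zero_mul] at this
    exact this.mono_left nhdsWithin_le_nhds
  have hexp := eventually_exp_le_sub_sub (tendsto_speed hpd)
    (tendsto_guardedCumulant hα hd hp hpd R ha hθ)
    ((tendsto_guardedCumulant hα hd hp hpd R ha (add_nonneg hθ hs)).sub_const (s * (x + δ)))
    ((tendsto_guardedCumulant hα hd hp hpd R ha (sub_nonneg.2 hsθ)).add_const (s * (x - δ)))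
    h1 h2 hη
  filter_upwards [self_mem_nhdsWithin, hexp,
    eventually_abs_integral_sub_le (d := d) hα hd hp hpd ha (-R) hδ,
    hid.eventually_le_const (show (0 : ℝ) < 1 / 2 by norm_num),
    hid.eventually_le_const (show (0 : ℝ) < δ / (2 * (C + 1)) by positivity)]
    with ε hε hmain hgap hvol hvol2
  have hε0 : 0 < ε := hε
  have hρ := lengthScale_pos (d := d) (p := p) hε0
  have hn := speed_pos (d := d) (p := p) hε0
  have hlev := levelScale_pos (d := d) (p := p) hε0
  have hM := isPoissonMeasure_contractedField hd hN hε0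
  have hl : 0 < a * lengthScale d p ε := mul_pos ha hρ
  have hscale : ∀ r y : ℝ, r * lengthScale d p ε ^ p * (y * levelScale d p ε) =
      r * y * speed d p ε := fun r y => by
    rw [← lengthScale_rpow_mul_levelScale (d := d) (p := p) hε0]; ring
  set X := compInt (fun w => contractedField ε (N w)) (ENNReal.ofReal ε • volume)
    (guardedRiesz α p (a * lengthScale d p ε) R (guardHeight d p a ε)) with hX
  have hmgf := fun {lam : ℝ} (hlam : 0 ≤ lam) =>
    mgf_compInt_guardedRiesz (P := P) hα hd hp hpd hN hR ha hε0 hlam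
  have htilt := exp_mul_le_measureReal_le (P := P) (X := X)
    (fun t => (hM.exp_compInt (isTame_guardedRiesz hα hp hl hR (guardHeight d p a ε) ε) t).1)
    (θ := θ * lengthScale d p ε ^ p) (s := s * lengthScale d p ε ^ p) (x := x * levelScale d p ε)
    (δ := δ * levelScale d p ε) (by positivity) (by positivity)
  rw [← add_mul, ← sub_mul, ← add_mul, ← sub_mul, hscale, hscale, hscale, hmgf hθ,
    hmgf (add_nonneg hθ hs), hmgf (sub_nonneg.2 hsθ), ← Real.exp_add, ← Real.exp_add] at htilt
  have hsub : P.real {w | X w ≤ -((x - δ) * levelScale d p ε)} ≤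
      P.real {w | nearFun D α p a ε (N w) g ≤ ((-deviationLevel d p γ ε : ℝ) : EReal)} := by
    refine ENNReal.toReal_mono (measure_ne_top _ _) (measure_mono_ae ?_)
    have hball : ∀ᵐ w ∂P, ∀ n : ℕ, contractedField ε (N w) (Metric.ball 0 (n : ℝ)) < ⊤ :=
      ae_all_iff.2 fun n => hM.ae_lt_top measurableSet_ball (smul_volume_ball_ne_top ε n)
    filter_upwards [hball, hM.ae_eq_zero_of_lt_one measurableSet_ball
      (smul_volume_ball_ne_top ε (2 * R))] with w hw1 hw2 hw
    refine (nearFun_le_of_compInt_guardedRiesz_le hα hd hp hpd hR hD hDR ha hε0 hw1 hw2 hg hgap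
      hvol ?_ (y := (x - δ) * levelScale d p ε) (mul_nonneg (by linarith) hlev.le) hw).trans
      (EReal.coe_le_coe_iff.2 ?_)
    · rw [le_div_iff₀ (by positivity)] at hvol2
      rw [guardHeight, ← hCdef]
      calc _ = ε * V * (2 * (C + 1)) * levelScale d p ε := by ring
        _ ≤ _ := mul_le_mul_of_nonneg_right hvol2 hlev.le
    · rw [deviationLevel_eq_mul_levelScale hd hpd γ hε0]
      have := mul_le_mul_of_nonneg_right hγ hlev.le
      linarith
  refine le_trans ?_ (htilt.trans hsub)
  have e1 : (nearCumulant d α p a θ - θ * (x + δ) - η) * speed d p ε =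
      -(θ * (x + δ) * speed d p ε) + (nearCumulant d α p a θ - η) * speed d p ε := by ring
  rw [e1, Real.exp_add]
  refine mul_le_mul_of_nonneg_left (hmain.trans_eq ?_) (Real.exp_pos _).le
  congr 3 <;> ring

/-- Every exponential rate below `-I_D(γ)` is attained by the near part at a single `g`, even for a
slightly higher level. -/
theorem exists_eventually_exp_le_measureReal_nearFun_le {Ω : Type*} [MeasurableSpace Ω]
    {P : Measure Ω} [IsProbabilityMeasure P] (hα : IsSmoothTruncation α) (hp : (d : ℝ) < 2 * p)
    (hpd : p < d) {N : Ω → Measure 𝔼} (hN : IsPoissonField P N) {D : Set 𝔼} (hD : MeasurableSet D)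
    {R : ℝ} (hR : 0 < R) (hDR : D ⊆ Metric.closedBall 0 R)
    (hσ : 0 < sSup ((fun g => l2Norm D g) '' sobolevSphere D)) {γ L : ℝ} (hγ : 0 < γ)
    (hL : L < -rateFunction D p γ) :
    ∃ g ∈ sobolevSphere D, ∃ γ' > γ, ∀ᶠ a in atTop, ∀ᶠ ε in 𝓝[>] (0 : ℝ),
      rexp (L * speed d p ε) ≤
        P.real {w | nearFun D α p a ε (N w) g ≤ ((-deviationLevel d p γ' ε : ℝ) : EReal)} := by
  have hd : d ≠ 0 := by rintro rfl; simp at hpd; simp at hp; linarith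
  have hp0 : 0 ≤ p := by linarith [(Nat.cast_nonneg d : (0 : ℝ) ≤ d)]
  rw [rateFunction_eq_rieszRate hpd hγ.le hσ] at hL
  set σ := sSup ((fun g => l2Norm D g) '' sobolevSphere D) with hσdef
  have hx0 : 0 < γ / σ ^ 2 := by positivity
  obtain ⟨x, hx1, hx2⟩ : ∃ x, rieszRate d p x < -L ∧ γ / σ ^ 2 < x := by
    have h1 := (continuousAt_rieszRate hd hpd hx0).eventually_lt_const
      (show rieszRate d p (γ / σ ^ 2) < -L by linarith)
    exact ((h1.filter_mono nhdsWithin_le_nhds).and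
      (self_mem_nhdsWithin : Ioi (γ / σ ^ 2) ∈ 𝓝[>] (γ / σ ^ 2))).exists
  have hx : 0 < x := hx0.trans hx2
  -- some `g` almost attains the supremum
  obtain ⟨g, hg, hgx⟩ : ∃ g ∈ sobolevSphere D, γ < l2Norm D g ^ 2 * x := by
    rw [div_lt_iff₀ (by positivity)] at hx2
    have h2 : √(γ / x) < σ := by
      rw [Real.sqrt_lt' hσ, div_lt_iff₀ hx]; linarith
    have hne : ((fun g => l2Norm D g) '' sobolevSphere D).Nonempty := by
      by_contra h
      rw [not_nonempty_iff_eq_empty] at h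
      rw [hσdef, h, Real.sSup_empty] at hσ
      exact lt_irrefl _ hσ
    obtain ⟨_, ⟨g, hg, rfl⟩, h3⟩ := exists_lt_of_lt_csSup hne h2
    refine ⟨g, hg, ?_⟩
    have h4 := (Real.sqrt_lt' ((Real.sqrt_nonneg _).trans_lt h3)).1 h3
    rwa [div_lt_iff₀ hx] at h4
  obtain ⟨γ', hγ1, hγ2⟩ := exists_between hgx
  obtain ⟨θ, hθ, hder, hdual⟩ := exists_dual_point hd hp hpd hx
  have hτ : 0 ≤ l2Norm D g ^ 2 := sq_nonneg _
  set τ := l2Norm D g ^ 2 with hτdef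
  set gap := -L - rieszRate d p x with hgap
  have hgap0 : 0 < gap := by linarith
  -- the level loses `3δ` and the exponent loses `θ δ`
  set δ := min x (min ((τ * x - γ') / (3 * (τ + 1))) (gap / (4 * θ))) with hδdef
  have hδ : 0 < δ := lt_min hx (lt_min (div_pos (by linarith) (by positivity)) (by positivity))
  have hδ1 : δ ≤ x := min_le_left _ _
  have hδ2 : δ ≤ (τ * x - γ') / (3 * (τ + 1)) := (min_le_right _ _).trans (min_le_left _ _)
  have hδ3 : δ ≤ gap / (4 * θ) := (min_le_right _ _).trans (min_le_right _ _)
  rw [le_div_iff₀ (by positivity)] at hδ2 hδ3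
  obtain ⟨s, hs, hsθ, ht1, ht2⟩ := exists_tilt_of_hasDerivAt hder hθ hδ
  have l0 := tendsto_nearCumulant hα hd hp hpd hθ.le
  have l1 := tendsto_nearCumulant hα hd hp hpd (add_nonneg hθ.le hs.le)
  have l2 := tendsto_nearCumulant hα hd hp hpd (sub_nonneg.2 hsθ)
  refine ⟨g, hg, γ', hγ1, ?_⟩
  filter_upwards [eventually_gt_atTop 0, (l1.sub_const (s * (x + δ))).eventually_lt l0 ht1,
    (l2.add_const (s * (x - δ))).eventually_lt l0 ht2,
    l0.eventually_const_le (show rieszCumulant d p θ - gap / 4 < rieszCumulant d p θ by linarith)]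
    with a ha h1 h2 h3
  filter_upwards [self_mem_nhdsWithin, eventually_exp_le_measureReal_nearFun_le (P := P) hα hd hp0
    hpd hN hD hR hDR (memLp_of_mem_sobolevSphere hg) ha hδ hδ1 (γ := γ') (by nlinarith) hs.le hsθ
    (show 0 < gap / 4 by positivity) h1 h2] with ε hε h4
  refine le_trans (Real.exp_le_exp.2 (mul_le_mul_of_nonneg_right ?_ (speed_pos hε).le)) h4
  linarith

end LowerBound

/-! ### Logarithmic scale -/

section LogScale

variable {Ω : Type*} [MeasurableSpace Ω] {P : Measure Ω} {d : ℕ} {p : ℝ}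

theorem rpow_mul_speed {ε : ℝ} (hε : 0 < ε) (c : ℝ) :
    ε ^ (2 / ((d : ℝ) - p)) * (c * speed d p ε) = c := by
  rw [speed, mul_left_comm, ← Real.rpow_add hε, add_neg_cancel, Real.rpow_zero, mul_one]

theorem scaledLogProb_le {ε c : ℝ} (hε : 0 < ε) {A : Set Ω}
    (h : P A ≤ ENNReal.ofReal (rexp (c * speed d p ε))) : scaledLogProb P d p ε A ≤ c := by
  have h1 := ENNReal.log_monotone h
  rw [ENNReal.log_ofReal_of_pos (Real.exp_pos _), Real.log_exp] at h1
  have h2 : (0 : EReal) ≤ ((ε ^ (2 / ((d : ℝ) - p)) : ℝ) : EReal) := by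
    exact_mod_cast Real.rpow_nonneg hε.le _
  refine (mul_le_mul_of_nonneg_left h1 h2).trans_eq ?_
  rw [← EReal.coe_mul, rpow_mul_speed hε]

theorem le_scaledLogProb [IsFiniteMeasure P] {ε c : ℝ} (hε : 0 < ε) {A : Set Ω}
    (h : rexp (c * speed d p ε) ≤ P.real A) : (c : EReal) ≤ scaledLogProb P d p ε A := by
  have h1 : ENNReal.ofReal (rexp (c * speed d p ε)) ≤ P A := by
    rw [← ofReal_measureReal (μ := P) (s := A)]
    exact ENNReal.ofReal_le_ofReal h
  have h1 := ENNReal.log_monotone h1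
  rw [ENNReal.log_ofReal_of_pos (Real.exp_pos _), Real.log_exp] at h1
  have h2 : (0 : EReal) ≤ ((ε ^ (2 / ((d : ℝ) - p)) : ℝ) : EReal) := by
    exact_mod_cast Real.rpow_nonneg hε.le _
  refine le_trans (le_of_eq ?_) (mul_le_mul_of_nonneg_left h1 h2)
  rw [← EReal.coe_mul, rpow_mul_speed hε]

end LogScale

/-! ### The asymptotics -/

section Limits

variable {d : ℕ} {p : ℝ} {α : ℝ → ℝ}

local notation "𝔼" => EuclideanSpace ℝ (Fin d)

/-- The far part is superexponentially negligible. -/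
theorem tendsto_limsup_scaledLogProb_farFun {Ω : Type*} [MeasurableSpace Ω] {P : Measure Ω}
    [IsProbabilityMeasure P] (hp0 : 0 < p) (hp : (d : ℝ) < 2 * p) (hpd : p < d)
    {N : Ω → Measure 𝔼} (hN : IsPoissonField P N) {D : Set 𝔼} (hD : MeasurableSet D) {R : ℝ}
    (hR : 0 ≤ R) (hDR : D ⊆ Metric.closedBall 0 R) (hα : IsSmoothTruncation α) {γ : ℝ}
    (hγ : 0 < γ) :
    Tendsto (fun a : ℝ => limsup (fun ε : ℝ => scaledLogProb P d p ε
        {w | ENNReal.ofReal (deviationLevel d p γ ε) ≤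
          ⨆ g ∈ sobolevSphere D, (farFun D α p a ε (N w) g).abs}) (𝓝[>] 0)) atTop (𝓝 ⊥) := by
  have hd : d ≠ 0 := by rintro rfl; simp at hpd; linarith
  refine EReal.tendsto_nhds_bot_iff_real.2 fun L => ?_
  filter_upwards [eventually_exists_far_exceptional hp0 hp hpd hN hD hR hDR hα hγ
    (B := |L| + 1) (by positivity)] with a ha
  refine lt_of_le_of_lt (limsup_le_of_le (a := ((-(|L| + 1) : ℝ) : EReal)) (by isBoundedDefault) ?_)
    (EReal.coe_lt_coe_iff.2 (by linarith [neg_abs_le L]))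
  filter_upwards [self_mem_nhdsWithin, ha] with ε hε hS
  have hε0 : 0 < ε := hε
  obtain ⟨S, hS, hSw⟩ := hS
  refine scaledLogProb_le hε0 ((measure_mono fun w hw => ?_).trans hS)
  by_contra hwS
  obtain ⟨-, b, hb, hz⟩ := hSw w hwS
  have hpos : 0 < deviationLevel d p γ ε := by
    rw [deviationLevel_eq_mul_levelScale hd hpd γ hε0]
    exact mul_pos hγ (levelScale_pos hε0)
  refine absurd hw (not_le.2 (lt_of_le_of_lt (iSup₂_le fun g hg => ?_)
    ((ENNReal.ofReal_lt_ofReal_iff hpos).2 hb)))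
  obtain ⟨z, hz1, hz2⟩ := hz g hg
  rw [farFun, compensatedIntegral_eq_of_tendsto hz2]
  exact ENNReal.ofReal_le_ofReal hz1

theorem le_liminf_scaledLogProb_nearFun {Ω : Type*} [MeasurableSpace Ω] {P : Measure Ω}
    [IsProbabilityMeasure P] (hα : IsSmoothTruncation α) (hp : (d : ℝ) < 2 * p)
    (hpd : p < d) {N : Ω → Measure 𝔼} (hN : IsPoissonField P N) {D : Set 𝔼} (hD : MeasurableSet D)
    {R : ℝ} (hR : 0 < R) (hDR : D ⊆ Metric.closedBall 0 R)
    (hσ : 0 < sSup ((fun g => l2Norm D g) '' sobolevSphere D)) {γ : ℝ} (hγ : 0 < γ) :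
    ((-rateFunction D p γ : ℝ) : EReal) ≤
      liminf (fun a : ℝ => liminf (fun ε : ℝ => scaledLogProb P d p ε
          {w | (⨅ g ∈ sobolevSphere D, nearFun D α p a ε (N w) g) ≤
            ((-deviationLevel d p γ ε : ℝ) : EReal)}) (𝓝[>] 0)) atTop := by
  have hd : d ≠ 0 := by rintro rfl; simp at hpd; simp at hp; linarith
  refine EReal.ge_of_forall_gt_iff_ge.1 fun L hL => ?_
  obtain ⟨g, hg, γ', hγ', h⟩ := exists_eventually_exp_le_measureReal_nearFun_le (P := P) hα hp hpd hN
    hD hR hDR hσ hγ (EReal.coe_lt_coe_iff.1 hL)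
  refine le_liminf_of_le (by isBoundedDefault) ?_
  filter_upwards [h] with a ha
  refine le_liminf_of_le (by isBoundedDefault) ?_
  filter_upwards [self_mem_nhdsWithin, ha] with ε hε h1
  have hε0 : 0 < ε := hε
  refine le_scaledLogProb hε0 (h1.trans (measureReal_mono fun w hw => ?_))
  refine (iInf₂_le g hg).trans (le_trans hw (EReal.coe_le_coe_iff.2 ?_))
  rw [deviationLevel_eq_mul_levelScale hd hpd _ hε0, deviationLevel_eq_mul_levelScale hd hpd _ hε0]
  exact neg_le_neg (mul_le_mul_of_nonneg_right hγ'.le (levelScale_pos hε0).le)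

theorem tendsto_scaledLogProb_zetaFun {Ω : Type*} [MeasurableSpace Ω] {P : Measure Ω}
    [IsProbabilityMeasure P] (hα : IsSmoothTruncation α) (hp : (d : ℝ) < 2 * p)
    (hpd : p < d) {N : Ω → Measure 𝔼} (hN : IsPoissonField P N) {D : Set 𝔼} (hD : MeasurableSet D)
    {R : ℝ} (hR : 0 < R) (hDR : D ⊆ Metric.closedBall 0 R)
    (hσ : 0 < sSup ((fun g => l2Norm D g) '' sobolevSphere D)) {γ : ℝ} (hγ : 0 < γ) :
    Tendsto (fun ε : ℝ => scaledLogProb P d p ε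
        {w | (⨅ g ∈ sobolevSphere D, zetaFun D p ε (N w) g) ≤
          ((-deviationLevel d p γ ε : ℝ) : EReal)})
      (𝓝[>] 0) (𝓝 ((-rateFunction D p γ : ℝ) : EReal)) := by
  have hd : d ≠ 0 := by rintro rfl; simp at hpd; simp at hp; linarith
  have hp0 : 0 < p := by linarith [(Nat.cast_nonneg d : (0 : ℝ) ≤ d)]
  rw [tendsto_order]
  constructor
  · -- lower bound: a single `g` with small near part suffices
    intro L' hL'
    obtain ⟨L, hL1, hL2⟩ := EReal.lt_iff_exists_real_btwn.1 hL'
    obtain ⟨L₁, hL3, hL4⟩ := exists_between (EReal.coe_lt_coe_iff.1 hL2)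
    obtain ⟨g, hg, γ', hγ', h⟩ := exists_eventually_exp_le_measureReal_nearFun_le (P := P) hα hp hpd
      hN hD hR hDR hσ hγ hL4
    have hδ : 0 < γ' - γ := by linarith
    obtain ⟨a, ⟨ha, hfar⟩, ha0⟩ := ((h.and (eventually_exists_far_exceptional hp0 hp hpd hN hD hR.le
      hDR hα hδ (B := |L₁| + 1) (by positivity))).and (eventually_gt_atTop 0)).exists
    -- the exceptional event is negligible against the event that the near part is small
    have hexp := eventually_exp_le_sub_sub (tendsto_speed hpd) (f := fun _ => L₁)
      (g := fun _ => -(|L₁| + 1)) (h := fun _ => -(|L₁| + 1)) tendsto_const_nhds tendsto_const_nhds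
      tendsto_const_nhds (by linarith [neg_abs_le L₁]) (by linarith [neg_abs_le L₁])
      (show 0 < L₁ - L by linarith)
    filter_upwards [self_mem_nhdsWithin, ha, hfar, hexp] with ε hε h1 hS h2
    have hε0 : 0 < ε := hε
    obtain ⟨S, hS, hSw⟩ := hS
    refine hL1.trans_le (le_scaledLogProb hε0 ?_)
    have hsub : {w | nearFun D α p a ε (N w) g ≤ ((-deviationLevel d p γ' ε : ℝ) : EReal)} ⊆
        {w | (⨅ g ∈ sobolevSphere D, zetaFun D p ε (N w) g) ≤
          ((-deviationLevel d p γ ε : ℝ) : EReal)} ∪ S := by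
      intro w hw
      by_cases hwS : w ∈ S
      · exact Or.inr hwS
      · obtain ⟨hball, b, hb, hz⟩ := hSw w hwS
        obtain ⟨z, hz1, hz2⟩ := hz g hg
        left
        change (⨅ g ∈ sobolevSphere D, zetaFun D p ε (N w) g) ≤ _
        refine le_trans (iInf₂_le g hg) ?_
        rw [zetaFun_eq_add hα hp0 hpd hD hDR ha0 hε0 hball (memLp_of_mem_sobolevSphere hg) hz2, farFun,
          compensatedIntegral_eq_of_tendsto hz2]
        refine (add_le_add_left hw _).trans ?_
        rw [← EReal.coe_add, EReal.coe_le_coe_iff,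
          deviationLevel_eq_mul_levelScale hd hpd _ hε0, deviationLevel_eq_mul_levelScale hd hpd _ hε0]
        rw [deviationLevel_eq_mul_levelScale hd hpd _ hε0] at hb
        linarith [le_abs_self z]
    have h3 := (measureReal_mono (μ := P) hsub).trans (measureReal_union_le _ _)
    have h4 : P.real S ≤ rexp (-(|L₁| + 1) * speed d p ε) := by
      rw [Measure.real]
      exact ENNReal.toReal_le_of_le_ofReal (Real.exp_pos _).le hS
    have h5 : L₁ - (L₁ - L) = L := by ring
    rw [h5] at h2
    linarith [Real.exp_pos (-(|L₁| + 1) * speed d p ε)]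
  · intro U' hU'
    obtain ⟨U, hU1, hU2⟩ := EReal.lt_iff_exists_real_btwn.1 hU'
    have hU := EReal.coe_lt_coe_iff.1 hU1
    rw [rateFunction_eq_rieszRate hpd hγ.le hσ] at hU
    set σ := sSup ((fun g => l2Norm D g) '' sobolevSphere D) with hσdef
    have hx0 : 0 < γ / σ ^ 2 := by positivity
    obtain ⟨θ, hθ, -, hdual⟩ := exists_dual_point hd hp hpd hx0
    have hrate := rieszRate_pos hd hp hpd hx0
    set x₀ := γ / σ ^ 2 with hx₀
    -- the far part needs a little room, so the near part is considered at a level below `x₀`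
    have hcont : ContinuousAt (fun x : ℝ => θ * x - rieszCumulant d p θ) x₀ := by fun_prop
    obtain ⟨x, ⟨⟨hx1, hx2⟩, hx3⟩, hx4⟩ : ∃ x, ((-U < θ * x - rieszCumulant d p θ ∧
        0 < θ * x - rieszCumulant d p θ) ∧ 0 < x) ∧ x < x₀ := by
      have h1 := hcont.eventually_const_lt (show -U < θ * x₀ - rieszCumulant d p θ by linarith)
      have h2 := hcont.eventually_const_lt (show 0 < θ * x₀ - rieszCumulant d p θ by linarith)
      exact ((((h1.and h2).and (lt_mem_nhds hx0)).filter_mono nhdsWithin_le_nhds).and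
        (self_mem_nhdsWithin : Iio x₀ ∈ 𝓝[<] x₀)).exists
    have hle : ∀ g ∈ sobolevSphere D, l2Norm D g ^ 2 ≤ σ ^ 2 := fun g hg =>
      pow_le_pow_left₀ (l2Norm_nonneg D g)
        (le_csSup (bddAbove_l2Norm_sobolevSphere D) (mem_image_of_mem _ hg)) 2
    have hxγ : x * σ ^ 2 < γ := by rwa [hx₀, lt_div_iff₀ (by positivity)] at hx4
    -- the factor `2` is absorbed by a slightly smaller rate
    have h2 : ∀ᶠ ε in 𝓝[>] (0 : ℝ),
        2 ≤ rexp ((U + (θ * x - rieszCumulant d p θ)) * speed d p ε) :=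
      (tendsto_exp_atTop.comp ((tendsto_speed hpd).const_mul_atTop
        (show 0 < U + (θ * x - rieszCumulant d p θ) by linarith))).eventually_ge_atTop 2
    filter_upwards [self_mem_nhdsWithin, h2, eventually_measure_iInf_zetaFun_le (P := P) hp0 hp hpd hN
      hD hR hDR hα hle (by positivity) hx3.le hxγ hθ.le hx2.le] with ε hε h3 h4
    have hε0 : 0 < ε := hε
    refine lt_of_le_of_lt (scaledLogProb_le hε0 (h4.trans (ENNReal.ofReal_le_ofReal ?_))) hU2
    have h5 : rexp (U * speed d p ε) = rexp ((U + (θ * x - rieszCumulant d p θ)) * speed d p ε) *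
        rexp (-(θ * x - rieszCumulant d p θ) * speed d p ε) := by
      rw [← Real.exp_add]; congr 1; ring
    rw [h5]
    exact mul_le_mul_of_nonneg_right h3 (Real.exp_pos _).le

end Limits

theorem theorem3p1 {Ω : Type*} [MeasurableSpace Ω] (P : Measure Ω) [IsProbabilityMeasure P]
    (d : ℕ) (p : ℝ) (hp : (d : ℝ) / 2 < p) (hpd : p < (d : ℝ))
    (N : Ω → Measure (EuclideanSpace ℝ (Fin d))) (hN : IsPoissonField P N)
    (D : Set (EuclideanSpace ℝ (Fin d))) (hD : IsOpen D) (hDb : Bornology.IsBounded D)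
    (hDne : D.Nonempty) (α : ℝ → ℝ) (hα : IsSmoothTruncation α) :
    -- the integrals are well defined: almost surely, for all `g` at once, the limits exist
    (∀ a ε : ℝ, 0 < a → 0 < ε →
      (∀ᵐ w ∂P, ∀ g ∈ sobolevSphere D,
        CompensatedIntegralConverges ε (N w) (smearedKernel D (rieszKernel p) g) ∧
        CompensatedIntegralConverges ε (N w) (smearedKernel D (nearKernel α p a ε) g) ∧
        CompensatedIntegralConverges ε (N w) (smearedKernel D (farKernel α p a ε) g)) ∧
      (∀ g ∈ sobolevSphere D, ∀ᵐ w ∂P,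
        (zetaFun D p ε (N w) g ≠ ⊥ ∧ zetaFun D p ε (N w) g ≠ ⊤) ∧
        (nearFun D α p a ε (N w) g ≠ ⊥ ∧ nearFun D α p a ε (N w) g ≠ ⊤) ∧
        (farFun D α p a ε (N w) g ≠ ⊥ ∧ farFun D α p a ε (N w) g ≠ ⊤))) ∧
    ∀ γ : ℝ, 0 < γ →
      Tendsto (fun a : ℝ => limsup (fun ε : ℝ => scaledLogProb P d p ε
          {w | ENNReal.ofReal (deviationLevel d p γ ε) ≤
            ⨆ g ∈ sobolevSphere D, (farFun D α p a ε (N w) g).abs}) (𝓝[>] 0))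
        atTop (𝓝 ⊥) ∧
      ((-rateFunction D p γ : ℝ) : EReal) ≤
        liminf (fun a : ℝ => liminf (fun ε : ℝ => scaledLogProb P d p ε
          {w | (⨅ g ∈ sobolevSphere D, nearFun D α p a ε (N w) g) ≤
            ((-deviationLevel d p γ ε : ℝ) : EReal)}) (𝓝[>] 0)) atTop ∧
      Tendsto (fun ε : ℝ => scaledLogProb P d p ε
          {w | (⨅ g ∈ sobolevSphere D, zetaFun D p ε (N w) g) ≤
            ((-deviationLevel d p γ ε : ℝ) : EReal)})
        (𝓝[>] 0) (𝓝 ((-rateFunction D p γ : ℝ) : EReal)) := by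
  have hp2 : (d : ℝ) < 2 * p := by linarith
  have hp0 : 0 < p := by linarith [(Nat.cast_nonneg d : (0 : ℝ) ≤ d)]
  obtain ⟨r, hr⟩ := hDb.subset_closedBall 0
  have hDR : D ⊆ Metric.closedBall 0 (max r 1) :=
    hr.trans (Metric.closedBall_subset_closedBall (le_max_left _ _))
  have hR : 0 < max r 1 := lt_max_of_lt_right one_pos
  have hσ : 0 < sSup ((fun g => l2Norm D g) '' sobolevSphere D) := by
    obtain ⟨g, hg, hpos⟩ := exists_mem_sobolevSphere hD hDne
    exact hpos.trans_le (le_csSup (bddAbove_l2Norm_sobolevSphere D) (mem_image_of_mem _ hg))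
  exact ⟨fun a ε ha hε => ae_wellDefined hp0 hp2 hpd hN hD.measurableSet hR.le hDR hα ha hε,
    fun γ hγ => ⟨tendsto_limsup_scaledLogProb_farFun hp0 hp2 hpd hN hD.measurableSet hR.le hDR hα hγ,
      le_liminf_scaledLogProb_nearFun hα hp2 hpd hN hD.measurableSet hR hDR hσ hγ,
      tendsto_scaledLogProb_zetaFun hα hp2 hpd hN hD.measurableSet hR hDR hσ hγ⟩⟩
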